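/- Let $G$ be a compact linear Lie group (a compact subgroup of the unit group of a finite-dimensional real algebra, e.g. a compact matrix group) with semisimple Lie algebra $\mathfrak g$, let $K$ be the Killing form of $\mathfrak g$, and let $\mathfrak g=\mathfrak m\oplus\mathfrak h$, $A\in\mathfrak h$, be a Hermitian symmetric structure: $[\mathfrak h,\mathfrak h]\subseteq\mathfrak h$, $[\mathfrak h,\mathfrak m]\subseteq\mathfrak m$, $[\mathfrak m,\mathfrak m]\subseteq\mathfrak h$, the centralizer of $A$ in $\mathfrak g$ is $\mathfrak h$, and $J=\mathrm{ad}(A)$ satisfies $J^2=-1$ on $\mathfrak m\neq 0$. Put $\rho^2=-K(A,A)$ with $\rho>0$, and let $H\subset G$ be the stabilizer of $A$ under $\mathrm{Ad}$. Embed the Hermitian symmetric space $M=G/H$ isometrically in $(\mathfrak g,-K)$ by $gH\mapsto \mathrm{Ad}(g)A$; its complex structure is $J_\chi=\mathrm{ad}(\chi)$ and its Levi-Civita derivative along a map is the tangential projection $\nabla_x=-J_\chi^2\partial_x$. Identify the flat space $\mathrm{Aff}(G,H)=(G\ltimes\mathfrak g)/G$ with $\mathfrak g$, with norm $|T|^2=-K(T,T)$.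 Let $I\subseteq\mathbb R$ be an open interval; everything is smooth on $x\in\mathbb R$, $t\in I$, or with $t$ in the rescaled interval $c^{-1}I$ wherever $t$ is replaced by $ct$. A *parallel frame* of $\chi:\mathbb R\times I\to M$ is a smooth $\psi:\mathbb R\times I\to G$ with $\chi=\psi H$ and $\tilde q:=\psi^{-1}\psi_x\in\mathfrak m$; its *Hasimoto variable* is $q(x,t)=\tilde q(x,\rho^2t)$. Call $\psi$ *NLS-normalized* if moreover $\psi^{-1}\psi_t=-J\tilde q_x+\tfrac12[\tilde q,J\tilde q]$. Consider $$\text{(S)}\ \ \chi_t=-J_\chi\nabla_x\chi_x,\qquad \text{(N)}\ \ \tfrac1{\rho^2}q_t=-Jq_{xx}+\tfrac12[q,[q,Jq]]\ \ (q\in\mathfrak m),$$ $$\text{(T)}\ \ T_t=\mathrm{ad}(T)^{-1}T_{xx},\qquad \text{(T$'$)}\ \ T_t=-\mathrm{ad}(T)T_{xx},$$ the last two for *spin vectors*, i.e. smooth fields $T$ in $\mathrm{Aff}(G,H)$ with $|T|=1$ and values in $\rho^{-1}\mathrm{Ad}(G)A$; here $\mathrm{ad}(T)^{-1}Y$ is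 the element $Z$ of the image of $\mathrm{ad}(T)$ for which $[T,Z]-Y$ commutes with $T$. Then: 1. Every smooth $\chi$ has a parallel frame, unique up to $\psi\mapsto\psi\,k(t)$ with smooth $k:I\to H$. 2. If $\psi$ is a parallel frame of $\chi$, then $\chi$ solves (S) if and only if for some smooth $k:I\to H$ the frame $\psi k$ is an NLS-normalized parallel frame whose Hasimoto variable solves (N). 3. A function $q$ solves (N) if and only if it is the Hasimoto variable of some solution $\chi$ of (S) in an NLS-normalized parallel frame. If the Hasimoto variable of $\chi$ in an arbitrary parallel frame solves (N), then $g(t)\cdot\chi$ solves (S) for some smooth $g:I\to G$. 4. If $q,q'$ are Hasimoto variables of $\chi,\chi'$ in NLS-normalized parallel frames, then $\chi'=g\cdot\chi$ for a constant $g\in G$ if and only if $q'=\mathrm{Ad}(k)q$ for a constant $k\in H$. The equation (N) is $\mathrm{Ad}(H)$-invariant. For an NLS-normalized parallel frame $\psi$ of $\chi$, $\chi$ is $L$-periodic in $x$ if and only if $\psi(x+L,t)=\psi(x,t)k$ for a constant $k\in H$. 5. For each constant $c>0$ the relation $T(x,t)=\rho^{-1}\chi(x,ct)$ is a correspondence between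 smooth maps $\chi$ into $M$ and spin vectors $T$: each $\chi$ comes from such a $T$ and each $T$ from such a $\chi$. Under it, $\chi$ solves (S) if and only if $T$ solves (T) when $c=\rho$, and if and only if $T$ solves (T$'$) when $c=\rho^{-1}$. A function $q$ solves (N) if and only if it is the Hasimoto variable, in an NLS-normalized parallel frame, of a map $\chi$ for which $T(x,t)=\rho^{-1}\chi(x,\rho t)$ is a spin vector that solves (T). -/

import Mathlib

open scoped ContDiff

attribute [local instance 100] LieRing.ofAssociativeRing

noncomputable section

namespace HermitianNLS

/-! ### Compact linear Lie groups, their Lie algebra and adjoint action -/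

section Ad

variable {𝔸 : Type*} [NormedRing 𝔸]

/-- `Ad(g) X = g X g⁻¹`. -/
def Ad (g : 𝔸ˣ) (X : 𝔸) : 𝔸 := (g : 𝔸) * X * ((g⁻¹ : 𝔸ˣ) : 𝔸)

theorem Ad_mul (g h : 𝔸ˣ) (X : 𝔸) : Ad (g * h) X = Ad g (Ad h X) := by
  simp [Ad, mul_assoc]

theorem Ad_one (X : 𝔸) : Ad (1 : 𝔸ˣ) X = X := by simp [Ad]

theorem Ad_lie (g : 𝔸ˣ) (X Y : 𝔸) : Ad g ⁅X, Y⁆ = ⁅Ad g X, Ad g Y⁆ := by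
  simp [Ad, Ring.lie_def, mul_sub, sub_mul, mul_assoc]

end Ad

section LieGroup

variable {𝔸 : Type*} [NormedRing 𝔸] [NormedAlgebra ℝ 𝔸]

/-- Velocities at `1` of curves in `G`, for a group `G` of units of a real normed algebra `𝔸`
(for example of real or complex matrices). -/
def IsTangent (G : Subgroup 𝔸ˣ) (X : 𝔸) : Prop :=
  ∃ c : ℝ → 𝔸ˣ, (∀ s, c s ∈ G) ∧ c 0 = 1 ∧ HasDerivAt (fun s => (c s : 𝔸)) X 0

theorem IsTangent.conj {G : Subgroup 𝔸ˣ} {X : 𝔸} (hX : IsTangent G X) {g : 𝔸ˣ} (hg : g ∈ G) :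
    IsTangent G ((g : 𝔸) * X * ((g⁻¹ : 𝔸ˣ) : 𝔸)) := by
  obtain ⟨c, hc, h0, hd⟩ := hX
  refine ⟨fun s => g * c s * g⁻¹, fun s => G.mul_mem (G.mul_mem hg (hc s)) (G.inv_mem hg),
    by simp [h0], ?_⟩
  simpa using (hd.const_mul (g : 𝔸)).mul_const ((g⁻¹ : 𝔸ˣ) : 𝔸)

/-- The tangent space of `G` at `1`, as a vector space. -/
def tangentSpace (G : Subgroup 𝔸ˣ) : Submodule ℝ 𝔸 where
  carrier := {X | IsTangent G X}
  zero_mem' := ⟨fun _ => 1, fun _ => G.one_mem, rfl, by simpa using hasDerivAt_const (0 : ℝ) (1 : 𝔸)⟩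
  add_mem' := by
    rintro X Y ⟨c, hc, c0, hX⟩ ⟨d, hd, d0, hY⟩
    refine ⟨fun s => c s * d s, fun s => G.mul_mem (hc s) (hd s), by simp [c0, d0], ?_⟩
    have := hX.mul hY
    simp only [c0, d0, Units.val_one, mul_one, one_mul] at this
    exact this
  smul_mem' := by
    rintro r X ⟨c, hc, c0, hX⟩
    refine ⟨fun s => c (r * s), fun s => hc _, by simp [c0], ?_⟩
    have h1 : HasDerivAt (fun s : ℝ => r * s) r 0 := by
      simpa using (hasDerivAt_id (0 : ℝ)).const_mul r
    have h2 : HasDerivAt (fun s => (c s : 𝔸)) X (r * 0) := by simpa using hX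
    exact h2.scomp (0 : ℝ) h1

variable [FiniteDimensional ℝ 𝔸]

/-- The Lie algebra `𝔤` of `G`: the tangent space at `1`, with the commutator bracket. -/
def lieAlg (G : Subgroup 𝔸ˣ) : LieSubalgebra ℝ 𝔸 where
  toSubmodule := tangentSpace G
  lie_mem' := by
    rintro X Y ⟨c, hc, c0, hX⟩ hY
    have : CompleteSpace 𝔸 := FiniteDimensional.complete ℝ 𝔸
    have hinv : HasDerivAt (fun s => (((c s)⁻¹ : 𝔸ˣ) : 𝔸)) (-X) 0 := by
      have h1 := hasFDerivAt_ringInverse (𝕜 := ℝ) (c 0)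
      have h2 := h1.comp_hasDerivAt (0 : ℝ) hX
      simpa [c0, Function.comp_def] using h2
    have hd : HasDerivAt (fun s => (c s : 𝔸) * Y * (((c s)⁻¹ : 𝔸ˣ) : 𝔸)) (X * Y - Y * X) 0 := by
      have := (hX.mul_const Y).mul hinv
      simp only [c0, inv_one, Units.val_one, mul_one, one_mul, mul_neg, ← sub_eq_add_neg] at this
      exact this
    have hcl : IsClosed ((tangentSpace G : Submodule ℝ 𝔸) : Set 𝔸) :=
      Submodule.closed_of_finiteDimensional _
    have ht := hasDerivAt_iff_tendsto_slope.1 hd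
    have hm : X * Y - Y * X ∈ tangentSpace G := by
      refine hcl.mem_of_tendsto ht (Filter.Eventually.of_forall fun s => ?_)
      have h1 : (c s : 𝔸) * Y * (((c s)⁻¹ : 𝔸ˣ) : 𝔸) ∈ tangentSpace G :=
        IsTangent.conj hY (hc s)
      have h2 : (c 0 : 𝔸) * Y * (((c 0)⁻¹ : 𝔸ˣ) : 𝔸) ∈ tangentSpace G :=
        IsTangent.conj hY (hc 0)
      exact (tangentSpace G).smul_mem _ ((tangentSpace G).sub_mem h1 h2)
    simpa [Ring.lie_def] using hm

theorem Ad_mem {G : Subgroup 𝔸ˣ} {g : 𝔸ˣ} (hg : g ∈ G) {X : 𝔸} (hX : X ∈ lieAlg G) :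
    Ad g X ∈ lieAlg G :=
  IsTangent.conj hX hg

/-- The adjoint representation of `G` on the additive group of `𝔤`. -/
def adHom (G : Subgroup 𝔸ˣ) : G →* MulAut (Multiplicative (lieAlg G)) where
  toFun g := AddEquiv.toMultiplicative
    { toFun := fun X => ⟨Ad (g : 𝔸ˣ) X, Ad_mem g.2 X.2⟩
      invFun := fun X => ⟨Ad ((g⁻¹ : G) : 𝔸ˣ) X, Ad_mem (g⁻¹).2 X.2⟩
      left_inv := fun X => Subtype.ext (by
        simp only [← Ad_mul, ← Subgroup.coe_mul, inv_mul_cancel, Subgroup.coe_one, Ad_one])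
      right_inv := fun X => Subtype.ext (by
        simp only [← Ad_mul, ← Subgroup.coe_mul, mul_inv_cancel, Subgroup.coe_one, Ad_one])
      map_add' := fun X Y => Subtype.ext (by simp [Ad, mul_add, add_mul]) }
  map_one' := by
    ext X
    change Ad ((1 : G) : 𝔸ˣ) _ = _
    simp [Ad_one]
  map_mul' g h := by
    ext X
    change Ad ((g * h : G) : 𝔸ˣ) _ = Ad (g : 𝔸ˣ) (Ad (h : 𝔸ˣ) _)
    simp [Ad_mul]

/-- The affine space `Aff(G,H) = (G ⋉ 𝔤) / G`, where `(g₁, a₁)(g₂, a₂) = (g₁ g₂, Ad(g₁) a₂ + a₁)`. -/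
abbrev Aff (G : Subgroup 𝔸ˣ) : Type _ :=
  (Multiplicative (lieAlg G) ⋊[adHom G] G) ⧸
    (SemidirectProduct.inr : G →* Multiplicative (lieAlg G) ⋊[adHom G] G).range

/-- The canonical identification of `Aff(G,H)` with the flat Euclidean vector space `𝔤`:
the coset of `(g, a)` corresponds to `a`. -/
def Aff.equiv (G : Subgroup 𝔸ˣ) : Aff G ≃ lieAlg G where
  toFun := Quotient.lift (fun p => Multiplicative.toAdd p.left) (by
    intro p r h
    obtain ⟨k, hk⟩ := QuotientGroup.leftRel_apply.1 h
    have : r = p * SemidirectProduct.inr k := by rw [hk]; group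
    simp [this])
  invFun a := QuotientGroup.mk (SemidirectProduct.inl (Multiplicative.ofAdd a))
  left_inv := by
    intro p
    induction p using QuotientGroup.induction_on with
    | H p =>
      refine QuotientGroup.eq.2 ⟨p.right, ?_⟩
      rw [eq_inv_mul_iff_mul_eq]
      exact SemidirectProduct.inl_left_mul_inr_right p
  right_inv := fun a => rfl

/-- The element of `𝔤`, seen in `𝔸`, that represents a vector of `Aff(G,H)`. -/
def Aff.vec {G : Subgroup 𝔸ˣ} (v : Aff G) : 𝔸 := (Aff.equiv G v : 𝔸)

/-- The squared norm of a vector of `Aff(G,H)`, from minus the Killing form of `𝔤`. -/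
def Aff.normSq {G : Subgroup 𝔸ˣ} (v : Aff G) : ℝ :=
  -killingForm ℝ (lieAlg G) (Aff.equiv G v) (Aff.equiv G v)

/-- `Z = ad(X)⁻¹ Y` in `𝔤`: `Z` lies in the image of `ad(X)`, and `[X, Z]` is `Y` up to the
centralizer of `X`. -/
def IsAdInv (G : Subgroup 𝔸ˣ) (X Y Z : 𝔸) : Prop :=
  (∃ W ∈ lieAlg G, Z = ⁅X, W⁆) ∧ ⁅X, Y - ⁅X, Z⁆⁆ = 0

/-- A Hermitian symmetric structure on `𝔤`: a splitting `𝔤 = 𝔪 ⊕ 𝔥` and `A ∈ 𝔥` whose centralizer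
is `𝔥` and for which `ad(A)` is a complex structure on `𝔪`. -/
structure HermSymm (G : Subgroup 𝔸ˣ) where
  𝔥 : Submodule ℝ 𝔸
  𝔪 : Submodule ℝ 𝔸
  A : 𝔸
  sup_eq : 𝔪 ⊔ 𝔥 = (lieAlg G).toSubmodule
  disjoint : Disjoint 𝔪 𝔥
  lie_hh : ∀ X ∈ 𝔥, ∀ Y ∈ 𝔥, ⁅X, Y⁆ ∈ 𝔥
  lie_hm : ∀ X ∈ 𝔥, ∀ Y ∈ 𝔪, ⁅X, Y⁆ ∈ 𝔪
  lie_mm : ∀ X ∈ 𝔪, ∀ Y ∈ 𝔪, ⁅X, Y⁆ ∈ 𝔥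
  A_mem : A ∈ 𝔥
  centralizer : ∀ X ∈ lieAlg G, ⁅A, X⁆ = 0 ↔ X ∈ 𝔥
  sq_eq : ∀ X ∈ 𝔪, ⁅A, ⁅A, X⁆⁆ = -X

namespace HermSymm

variable {G : Subgroup 𝔸ˣ} (D : HermSymm G)

theorem A_mem_lieAlg : D.A ∈ lieAlg G := by
  have : D.A ∈ D.𝔪 ⊔ D.𝔥 := Submodule.mem_sup_right D.A_mem
  rw [D.sup_eq] at this
  exact this

/-- The squared norm `-K(A, A)` of `A`. -/
def normSqA : ℝ := -killingForm ℝ (lieAlg G) ⟨D.A, D.A_mem_lieAlg⟩ ⟨D.A, D.A_mem_lieAlg⟩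

/-- The subgroup `H` of `G`: the stabilizer of `A` under the adjoint action. -/
def H : Subgroup G where
  carrier := {g | Ad (g : 𝔸ˣ) D.A = D.A}
  one_mem' := by simp [Ad_one]
  mul_mem' := by
    intro a b ha hb
    simp only [Set.mem_ofPred_eq] at ha hb ⊢
    rw [Subgroup.coe_mul, Ad_mul, hb, ha]
  inv_mem' := by
    intro a ha
    simp only [Set.mem_ofPred_eq] at ha ⊢
    conv_lhs => rw [← ha]
    rw [← Ad_mul, ← Subgroup.coe_mul, inv_mul_cancel, Subgroup.coe_one, Ad_one]

/-- The Hermitian symmetric space `M = G/H`. -/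
abbrev M : Type _ := G ⧸ D.H

/-- The isometric embedding `gH ↦ Ad(g) A` of `M` onto the adjoint orbit of `A` in `𝔤`. -/
def emb : D.M → 𝔸 :=
  Quotient.lift (fun g : G => Ad (g : 𝔸ˣ) D.A) (by
    intro a b h
    have h1 : Ad ((a⁻¹ * b : G) : 𝔸ˣ) D.A = D.A := QuotientGroup.leftRel_apply.1 h
    have h2 : Ad ((a * (a⁻¹ * b) : G) : 𝔸ˣ) D.A = Ad (a : 𝔸ˣ) D.A := by
      rw [Subgroup.coe_mul, Ad_mul, h1]
    rw [mul_inv_cancel_left] at h2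
    exact h2.symm)

theorem emb_injective : Function.Injective D.emb := by
  intro p r
  induction p using QuotientGroup.induction_on with
  | H a =>
    induction r using QuotientGroup.induction_on with
    | H b =>
      intro h
      replace h : Ad (a : 𝔸ˣ) D.A = Ad (b : 𝔸ˣ) D.A := h
      refine QuotientGroup.eq.2 ?_
      change Ad ((a⁻¹ * b : G) : 𝔸ˣ) D.A = D.A
      rw [Subgroup.coe_mul, Ad_mul, ← h, ← Ad_mul, ← Subgroup.coe_mul, inv_mul_cancel,
        Subgroup.coe_one, Ad_one]

/-- The Hermitian structure `J_p = ad(p)` of `M`; the tangent space at `p`, seen in `𝔤`, is the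
image of `ad(p)`. -/
def Jmap (p : D.M) (Y : 𝔸) : 𝔸 := ⁅D.emb p, Y⁆

/-- `-J_p²` is the projection of `𝔤` onto the tangent space of `M` at `p`, that is onto the image
of `ad(p)`, along the kernel of `ad(p)`, its orthogonal complement for the Killing form. -/
def tangentProj (p : D.M) (Y : 𝔸) : 𝔸 := -D.Jmap p (D.Jmap p Y)

theorem Jmap_cube (p : D.M) {Y : 𝔸} (hY : Y ∈ lieAlg G) :
    D.Jmap p (D.Jmap p (D.Jmap p Y)) = -D.Jmap p Y := by
  induction p using QuotientGroup.induction_on with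
  | H g =>
    have key : ∀ X ∈ lieAlg G, ⁅D.A, ⁅D.A, ⁅D.A, X⁆⁆⁆ = -⁅D.A, X⁆ := by
      intro X hX
      have hX' : X ∈ D.𝔪 ⊔ D.𝔥 := by rw [D.sup_eq]; exact hX
      obtain ⟨y, hy, z, hz, rfl⟩ := Submodule.mem_sup.1 hX'
      have hz' : z ∈ lieAlg G := by
        have : z ∈ D.𝔪 ⊔ D.𝔥 := Submodule.mem_sup_right hz
        rw [D.sup_eq] at this
        exact this
      rw [lie_add, (D.centralizer z hz').2 hz, add_zero, D.sq_eq _ (D.lie_hm _ D.A_mem _ hy)]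
    have hY' : Y = Ad (g : 𝔸ˣ) (Ad ((g⁻¹ : G) : 𝔸ˣ) Y) := by
      rw [← Ad_mul, ← Subgroup.coe_mul, mul_inv_cancel, Subgroup.coe_one, Ad_one]
    have hm := Ad_mem (g⁻¹).2 hY
    set X := Ad ((g⁻¹ : G) : 𝔸ˣ) Y
    have := congrArg (Ad (g : 𝔸ˣ)) (key X hm)
    change ⁅Ad (g : 𝔸ˣ) D.A, ⁅Ad (g : 𝔸ˣ) D.A, ⁅Ad (g : 𝔸ˣ) D.A, Y⁆⁆⁆ = -⁅Ad (g : 𝔸ˣ) D.A, Y⁆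
    rw [hY', ← Ad_lie, ← Ad_lie, ← Ad_lie, this, Ad, Ad, mul_neg, neg_mul]

theorem tangentProj_idem (p : D.M) {Y : 𝔸} (hY : Y ∈ lieAlg G) :
    D.tangentProj p (D.tangentProj p Y) = D.tangentProj p Y := by
  have h : ⁅D.emb p, ⁅D.emb p, ⁅D.emb p, Y⁆⁆⁆ = -⁅D.emb p, Y⁆ := D.Jmap_cube p hY
  simp only [tangentProj, Jmap, lie_neg, h, neg_neg]

end HermSymm

end LieGroup

/-! ### Functions of `(x, t)` -/

section Calculus

variable {V : Type*} [NormedAddCommGroup V] [NormedSpace ℝ V]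

/-- `f(x,t)` is smooth for `x ∈ ℝ`, `t ∈ I`. -/
def Smooth (I : Set ℝ) (f : ℝ → ℝ → V) : Prop :=
  ContDiffOn ℝ ∞ (fun p : ℝ × ℝ => f p.1 p.2) (Set.univ ×ˢ I)

/-- `∂f/∂x`. -/
def dx (f : ℝ → ℝ → V) (x t : ℝ) : V := deriv (fun y => f y t) x

/-- `∂f/∂t`. -/
def dt (f : ℝ → ℝ → V) (x t : ℝ) : V := deriv (fun s => f x s) t

end Calculus

/-- The times `t` with `c t ∈ I`. -/
def scaleTime (c : ℝ) (I : Set ℝ) : Set ℝ := {t | c * t ∈ I}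

/-! ### The three evolution equations -/

section Equations

variable {𝔸 : Type*} [NormedRing 𝔸] [NormedAlgebra ℝ 𝔸] [FiniteDimensional ℝ 𝔸]
variable {G : Subgroup 𝔸ˣ} (D : HermSymm G)

namespace HermSymm

/-- `χ(x,t)` is a smooth map into `M ⊂ 𝔤`, for `t ∈ I`. -/
def SmoothMap (I : Set ℝ) (χ : ℝ → ℝ → D.M) : Prop := Smooth I (fun x t => D.emb (χ x t))

/-- The Levi-Civita derivative `∇ₓ Y` of a tangent vector field `Y` along `χ`: the tangential
projection of the `x`-derivative in the ambient Euclidean space. -/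
def covDx (χ : ℝ → ℝ → D.M) (Y : ℝ → ℝ → 𝔸) (x t : ℝ) : 𝔸 := D.tangentProj (χ x t) (dx Y x t)

/-- The Schrödinger map equation `χ_t = -J_χ ∇ₓ χ_x` on `M`, for `x ∈ ℝ` and `t ∈ I`. -/
def SchrodingerMap (I : Set ℝ) (χ : ℝ → ℝ → D.M) : Prop :=
  ∀ x, ∀ t ∈ I, dt (fun x t => D.emb (χ x t)) x t =
    -D.Jmap (χ x t) (D.covDx χ (dx (fun x t => D.emb (χ x t))) x t)

/-- `q` is a smooth `𝔪`-valued solution of the NLS flow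
`q_t / ‖A‖² = -J q_xx + ½ [q, [q, J q]]`, `J = ad(A)`, for `x ∈ ℝ` and `t ∈ I`. -/
structure NLS (I : Set ℝ) (q : ℝ → ℝ → 𝔸) : Prop where
  smooth : Smooth I q
  mem : ∀ x, ∀ t ∈ I, q x t ∈ D.𝔪
  eqn : ∀ x, ∀ t ∈ I, (1 / D.normSqA) • dt q x t =
    -⁅D.A, dx (dx q) x t⁆ + (1 / 2 : ℝ) • ⁅q x t, ⁅q x t, ⁅D.A, q x t⁆⁆⁆

/-- `T` is a smooth unit vector field in `Aff(G,H)` of the algebraic type of the tangent vectors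
of the non-stretching curves considered: `T = ‖A‖⁻¹ Ad(ψ) A` pointwise, with `ψ ∈ G`. -/
structure SpinVector (I : Set ℝ) (T : ℝ → ℝ → Aff G) : Prop where
  smooth : Smooth I (fun x t => (T x t).vec)
  unit : ∀ x, ∀ t ∈ I, (T x t).normSq = 1
  type : ∀ x, ∀ t ∈ I, ∃ g ∈ G, (T x t).vec = (√D.normSqA)⁻¹ • Ad g D.A

end HermSymm

/-- The general Heisenberg spin model `T_t = ad(T)⁻¹ T_xx`. -/
def Heisenberg (I : Set ℝ) (T : ℝ → ℝ → Aff G) : Prop :=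
  ∀ x, ∀ t ∈ I, IsAdInv G (T x t).vec
    (dx (dx fun x t => (T x t).vec) x t) (dt (fun x t => (T x t).vec) x t)

/-- The general Heisenberg spin model in the normalization `T_t = -ad(T) T_xx`. -/
def Heisenberg' (I : Set ℝ) (T : ℝ → ℝ → Aff G) : Prop :=
  ∀ x, ∀ t ∈ I, dt (fun x t => (T x t).vec) x t =
    -⁅(T x t).vec, dx (dx fun x t => (T x t).vec) x t⁆

/-! ### Hasimoto variable -/

/-- `ψ⁻¹ ∂ψ/∂x`. -/
def hasimoto (ψ : ℝ → ℝ → G) (x t : ℝ) : 𝔸 :=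
  (((ψ x t : 𝔸ˣ)⁻¹ : 𝔸ˣ) : 𝔸) * dx (fun x t => ((ψ x t : 𝔸ˣ) : 𝔸)) x t

/-- `ψ⁻¹ ∂ψ/∂t`. -/
def frameVel (ψ : ℝ → ℝ → G) (x t : ℝ) : 𝔸 :=
  (((ψ x t : 𝔸ˣ)⁻¹ : 𝔸ˣ) : 𝔸) * dt (fun x t => ((ψ x t : 𝔸ˣ) : 𝔸)) x t

namespace HermSymm

/-- `ψ` is a parallel frame of the map `χ = ψH`: a smooth lift to `G` with `ψ⁻¹ ψ_x ∈ 𝔪`. -/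
structure ParallelFrame (I : Set ℝ) (χ : ℝ → ℝ → D.M) (ψ : ℝ → ℝ → G) : Prop where
  smooth : Smooth I (fun x t => ((ψ x t : 𝔸ˣ) : 𝔸))
  lift : ∀ x, ∀ t ∈ I, χ x t = QuotientGroup.mk (ψ x t)
  mem : ∀ x, ∀ t ∈ I, hasimoto ψ x t ∈ D.𝔪

/-- `q` is the Hasimoto variable of `χ` in the parallel frame `ψ`, in the time variable of the NLS
flow, and the frame evolves by the connection variables of the NLS flow:
with `q̃ = ψ⁻¹ ψ_x` and `w = ψ⁻¹ ψ_t` one has `q(x,t) = q̃(x, ‖A‖² t)` and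
`w = -J q̃_x + ½ [q̃, J q̃]`. -/
structure HasimotoFrame (I : Set ℝ) (χ : ℝ → ℝ → D.M) (ψ : ℝ → ℝ → G) (q : ℝ → ℝ → 𝔸) :
    Prop where
  parallel : D.ParallelFrame I χ ψ
  q_eq : ∀ x, ∀ t ∈ scaleTime D.normSqA I, q x t = hasimoto ψ x (D.normSqA * t)
  vel : ∀ x, ∀ t ∈ I, frameVel ψ x t =
    -⁅D.A, dx (hasimoto ψ) x t⁆ + (1 / 2 : ℝ) • ⁅hasimoto ψ x t, ⁅D.A, hasimoto ψ x t⁆⁆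

/-- `T(x,t) = ‖A‖⁻¹ χ(x, c t)` for `x ∈ ℝ` and `c t ∈ I`, under `M ⊂ 𝔤 ≃ Aff(G,H)`. -/
def Corresponds (c : ℝ) (I : Set ℝ) (χ : ℝ → ℝ → D.M) (T : ℝ → ℝ → Aff G) : Prop :=
  ∀ x, ∀ t ∈ scaleTime c I, (T x t).vec = (√D.normSqA)⁻¹ • D.emb (χ x (c * t))

end HermSymm

end Equations

end HermitianNLS

end

open HermitianNLS

/-! Write u = ψ⁻¹ψ_x and w = ψ⁻¹ψ_t for a frame ψ. Equality of mixed partials is the zero-curvature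
equation w_x = u_t - [u, w] (`zero_curvature`). For 𝔪-valued u put N = -Ju_x + ½[u, Ju] and R =
-Ju_xx + ½[u, [u, Ju]]; the bracket relations give N_x = R - [u, N] (`hasDerivAt_nlsVel`). Every
statement about NLS compares w with N.

In a parallel frame the Schrödinger map equation reads [A, w] = u_x (`schrodinger_iff`), and [A, N]
= u_x holds identically. So a frame with w = N belongs to a Schrödinger map, and zero curvature then
forces u_t = R, the NLS flow in the time of the map. Conversely, for a Schrödinger map c = w - N
commutes with A, hence lies in 𝔥; its x-derivative u_t - R - [u, c] lies in 𝔪, so c depends on t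
only and a gauge transformation by a curve in H removes it. If instead u_t = R is given, then w - N
satisfies (w - N)_x = -[u, w - N], so Ad(ψ)(w - N) depends on t only and a time-dependent left
motion removes it. The same observation rebuilds a frame from q: integrate N along x = 0, then u
along x.

Parallel frames come from the equation m_x = -m[p, p_x] for p = Ad(g)A, which carries p back to A
because ad(p)² = -1 on velocities of the orbit. That last fact (`deriv_orbit_mem`) is obtained
without lifting curves from the orbit to G, by differentiating ad(p)³ = -ad(p); semisimplicity
enters here, through the trivial centre.

The analytic input is the linear equation y_x = yu with smooth dependence on t (`exists_linearODE`),
solved by inverting 1 minus a Volterra operator, and the fact that solutions starting in a compact G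
stay in G when u is tangent (`mem_image_of_ODE`), a Gronwall estimate on the distance to G.

The spin models need no frame: since ad(p)³ = -ad(p), the Schrödinger map equation is p_t = -[p,
p_xx] in 𝔤 (`schrodinger_iff_lie`), and the time scales ρ and ρ⁻¹ absorb the factor ρ⁻¹ in T. -/

noncomputable section

namespace HermitianNLS

set_option linter.unusedSectionVars false

/-! ### Linear equations with parameters: smooth maps into C([0,1], F). -/

section LinearODE

open Set Filter Topology

variable {P F E : Type*} [TopologicalSpace P]
  [NormedAddCommGroup F] [NormedSpace ℝ F] [NormedAddCommGroup E] [NormedSpace ℝ E]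

/-- The linear map `(x, t) ↦ x a + t b`. -/
def pairMap (a b : F) : ℝ × ℝ →L[ℝ] F :=
  (ContinuousLinearMap.fst ℝ ℝ ℝ).smulRight a + (ContinuousLinearMap.snd ℝ ℝ ℝ).smulRight b

theorem pairMap_apply (a b : F) (h : ℝ × ℝ) : pairMap a b h = h.1 • a + h.2 • b := rfl

theorem pairMap_eta (L : ℝ × ℝ →L[ℝ] F) : pairMap (L (1, 0)) (L (0, 1)) = L := by
  ext <;> simp [pairMap_apply]

theorem norm_pairMap_sub_le (a b a' b' : F) :
    ‖pairMap a b - pairMap a' b'‖ ≤ ‖a - a'‖ + ‖b - b'‖ := by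
  refine ContinuousLinearMap.opNorm_le_bound _ (by positivity) fun h => ?_
  have : (pairMap a b - pairMap a' b') h = h.1 • (a - a') + h.2 • (b - b') := by
    simp only [sub_apply, pairMap_apply, smul_sub]
    abel
  rw [this, add_mul]
  refine (norm_add_le _ _).trans (add_le_add ?_ ?_)
  · rw [norm_smul, mul_comm]
    gcongr
    exact norm_fst_le h
  · rw [norm_smul, mul_comm]
    gcongr
    exact norm_snd_le h

theorem ContDiffOn_pairMap {X : Type*} [NormedAddCommGroup X] [NormedSpace ℝ X] {n : WithTop ℕ∞}
    {s : Set X} {f g : X → F} (hf : ContDiffOn ℝ n f s) (hg : ContDiffOn ℝ n g s) :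
    ContDiffOn ℝ n (fun p => pairMap (f p) (g p)) s :=
  (contDiffOn_const.smulRight hf).add (contDiffOn_const.smulRight hg)

/-- Currying turns joint continuity into continuity for the topology of C([0,1], F), the sup-norm
topology because the interval is compact. -/
theorem continuousOn_curry {U : Set P} {W : Set (P × ℝ)} {f : P × ℝ → F}
    (hUW : U ×ˢ Icc 0 1 ⊆ W) (hf : ContinuousOn f W) {g : P → C(unitInterval, F)}
    (hg : ∀ p ∈ U, ∀ s : unitInterval, g p s = f (p, s)) : ContinuousOn g U := by
  rw [continuousOn_iff_continuous_domRestrict]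
  have hc : Continuous fun q : U × unitInterval => f ((q.1 : P), (q.2 : ℝ)) :=
    hf.comp_continuous (by fun_prop) fun q => hUW ⟨q.1.2, q.2.2⟩
  have : U.domRestrict g = ContinuousMap.curry ⟨_, hc⟩ := by
    funext p
    ext s
    exact hg p p.2 s
  rw [this]
  exact (ContinuousMap.curry _).continuous

theorem exists_curry {U : Set P} {W : Set (P × ℝ)} {f : P × ℝ → F}
    (hUW : U ×ˢ Icc 0 1 ⊆ W) (hf : ContinuousOn f W) :
    ∃ g : P → C(unitInterval, F), ∀ p ∈ U, ∀ s : unitInterval, g p s = f (p, s) := by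
  classical
  have hc : ∀ p ∈ U, Continuous fun s : unitInterval => f (p, (s : ℝ)) := fun p hp =>
    hf.comp_continuous (by fun_prop) fun s => hUW ⟨hp, s.2⟩
  exact ⟨fun p => if h : p ∈ U then ⟨_, hc p h⟩ else 0, fun p hp s => by simp [hp]⟩

/-- The curried partials g₁, g₂ are continuous in the sup norm, so near p they vary by at most ε/2
each, uniformly in s. The mean value inequality at fixed s then bounds the remainder by ε‖p' - p‖
for all s at once. -/
theorem hasFDerivAt_curry {U : Set (ℝ × ℝ)} (hU : IsOpen U) {W : Set ((ℝ × ℝ) × ℝ)}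
    (hW : IsOpen W) (hUW : U ×ˢ Icc 0 1 ⊆ W) {f : (ℝ × ℝ) × ℝ → F} (hf : ContDiffOn ℝ 1 f W)
    {g g₁ g₂ : ℝ × ℝ → C(unitInterval, F)}
    (hg : ∀ p ∈ U, ∀ s : unitInterval, g p s = f (p, s))
    (hg₁ : ∀ p ∈ U, ∀ s : unitInterval, g₁ p s = fderiv ℝ f (p, s) ((1, 0), 0))
    (hg₂ : ∀ p ∈ U, ∀ s : unitInterval, g₂ p s = fderiv ℝ f (p, s) ((0, 1), 0))
    {p : ℝ × ℝ} (hp : p ∈ U) : HasFDerivAt g (pairMap (g₁ p) (g₂ p)) p := by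
  have hfd := hf.continuousOn_fderiv_of_isOpen hW le_rfl
  have hc₁ : ContinuousOn g₁ U := continuousOn_curry hUW
    (f := fun q => fderiv ℝ f q ((1, 0), 0)) (hfd.clm_apply continuousOn_const) hg₁
  have hc₂ : ContinuousOn g₂ U := continuousOn_curry hUW
    (f := fun q => fderiv ℝ f q ((0, 1), 0)) (hfd.clm_apply continuousOn_const) hg₂
  refine HasFDerivAt.of_isLittleO (Asymptotics.isLittleO_iff.2 fun ε hε => ?_)
  have h₁ := (hc₁.continuousAt (hU.mem_nhds hp)).preimage_mem_nhds
    (Metric.closedBall_mem_nhds (g₁ p) (half_pos hε))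
  have h₂ := (hc₂.continuousAt (hU.mem_nhds hp)).preimage_mem_nhds
    (Metric.closedBall_mem_nhds (g₂ p) (half_pos hε))
  obtain ⟨δ, hδ, hball⟩ := Metric.mem_nhds_iff.1 (inter_mem (inter_mem h₁ h₂) (hU.mem_nhds hp))
  filter_upwards [Metric.ball_mem_nhds p hδ] with p' hp'
  refine (ContinuousMap.norm_le _ (by positivity)).2 fun s => ?_
  have happ : ∀ h, pairMap (g₁ p) (g₂ p) h s = pairMap (g₁ p s) (g₂ p s) h := fun h => rfl
  simp only [ContinuousMap.sub_apply, happ, hg _ hp, hg _ (hball hp').2]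
  refine Convex.norm_image_sub_le_of_norm_hasFDerivWithin_le' (f := fun q => f (q, (s : ℝ)))
    (f' := fun q => pairMap (g₁ q s) (g₂ q s)) (s := Metric.ball p δ) (fun q hq => ?_)
    (fun q hq => ?_) (convex_ball _ _) (Metric.mem_ball_self hδ) hp'
  · have hd : HasFDerivAt f (fderiv ℝ f (q, (s : ℝ))) (q, (s : ℝ)) :=
      ((hf.contDiffAt (hW.mem_nhds (hUW ⟨(hball hq).2, s.2⟩))).differentiableAt
        (by simp)).hasFDerivAt
    have hd' := hd.comp q (hasFDerivAt_prodMk_left (𝕜 := ℝ) q (s : ℝ))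
    rw [hg₁ q (hball hq).2, hg₂ q (hball hq).2]
    have he := pairMap_eta ((fderiv ℝ f (q, (s : ℝ))).comp (ContinuousLinearMap.inl ℝ (ℝ × ℝ) ℝ))
    rw [← he] at hd'
    exact hd'.hasFDerivWithinAt
  · have hb := (hball hq).1
    have h1 : ‖g₁ q - g₁ p‖ ≤ ε / 2 := mem_closedBall_iff_norm.1 hb.1
    have h2 : ‖g₂ q - g₂ p‖ ≤ ε / 2 := mem_closedBall_iff_norm.1 hb.2
    refine (norm_pairMap_sub_le _ _ _ _).trans ?_
    have h3 := ((g₁ q - g₁ p).norm_coe_le_norm s).trans h1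
    have h4 := ((g₂ q - g₂ p).norm_coe_le_norm s).trans h2
    simp only [ContinuousMap.sub_apply] at h3 h4
    linarith

/-- The derivative of a curried map is built from the curried partials of f, which are one order
less regular; hence the induction runs over all f and g. -/
theorem contDiffOn_curry_nat {U : Set (ℝ × ℝ)} (hU : IsOpen U) {W : Set ((ℝ × ℝ) × ℝ)}
    (hW : IsOpen W) (hUW : U ×ˢ Icc 0 1 ⊆ W) (n : ℕ) :
    ∀ {f : (ℝ × ℝ) × ℝ → F}, ContDiffOn ℝ n f W → ∀ {g : ℝ × ℝ → C(unitInterval, F)},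
      (∀ p ∈ U, ∀ s : unitInterval, g p s = f (p, s)) → ContDiffOn ℝ n g U := by
  induction n with
  | zero =>
    intro f hf g hg
    exact contDiffOn_zero.2 (continuousOn_curry hUW hf.continuousOn hg)
  | succ n ih =>
    intro f hf g hg
    have hd := (contDiffOn_succ_iff_fderiv_of_isOpen (n := n) hW).1 (by exact_mod_cast hf)
    have hf1 : ContDiffOn ℝ 1 f W := hf.of_le (by norm_cast; omega)
    have hd₁ : ContDiffOn ℝ n (fun q => fderiv ℝ f q ((1, 0), 0)) W :=
      hd.2.2.clm_apply contDiffOn_const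
    have hd₂ : ContDiffOn ℝ n (fun q => fderiv ℝ f q ((0, 1), 0)) W :=
      hd.2.2.clm_apply contDiffOn_const
    obtain ⟨g₁, hg₁⟩ := exists_curry hUW hd₁.continuousOn
    obtain ⟨g₂, hg₂⟩ := exists_curry hUW hd₂.continuousOn
    have hder : ∀ p ∈ U, HasFDerivAt g (pairMap (g₁ p) (g₂ p)) p := fun p hp =>
      hasFDerivAt_curry hU hW hUW hf1 hg hg₁ hg₂ hp
    rw [Nat.cast_add, Nat.cast_one]
    refine (contDiffOn_succ_iff_fderiv_of_isOpen (n := n) hU).2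
      ⟨fun p hp => (hder p hp).differentiableAt.differentiableWithinAt, by simp, ?_⟩
    exact (ContDiffOn_pairMap (ih hd₁ hg₁) (ih hd₂ hg₂)).congr fun p hp => (hder p hp).fderiv

theorem contDiffOn_curry {U : Set (ℝ × ℝ)} (hU : IsOpen U) {W : Set ((ℝ × ℝ) × ℝ)}
    (hW : IsOpen W) (hUW : U ×ˢ Icc 0 1 ⊆ W) {f : (ℝ × ℝ) × ℝ → F} (hf : ContDiffOn ℝ ∞ f W)
    {g : ℝ × ℝ → C(unitInterval, F)} (hg : ∀ p ∈ U, ∀ s : unitInterval, g p s = f (p, s)) :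
    ContDiffOn ℝ ∞ g U :=
  contDiffOn_infty.2 fun n =>
    contDiffOn_curry_nat hU hW hUW n (hf.of_le (by exact_mod_cast le_top)) hg

/-! ### The Volterra operator -/

/-- The extension of a function on `[0,1]` to the line. -/
def extendLine (v : C(unitInterval, E)) (s : ℝ) : E := v (projIcc 0 1 zero_le_one s)

theorem continuous_extendLine (v : C(unitInterval, E)) : Continuous (extendLine v) :=
  v.continuous.comp continuous_projIcc

theorem extendLine_coe (v : C(unitInterval, E)) (s : unitInterval) : extendLine v s = v s := by
  simp [extendLine]

theorem norm_extendLine_le (v : C(unitInterval, E)) (s : ℝ) : ‖extendLine v s‖ ≤ ‖v‖ :=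
  v.norm_coe_le_norm _

/-- `v ↦ ∫₀ˢ v`. -/
def primitive (E : Type*) [NormedAddCommGroup E] [NormedSpace ℝ E] [CompleteSpace E] :
    C(unitInterval, E) →L[ℝ] C(unitInterval, E) :=
  LinearMap.mkContinuous
    ({ toFun := fun v => ⟨fun s => ∫ r in (0 : ℝ)..s, extendLine v r,
          (intervalIntegral.continuous_primitive
            (fun a b => (continuous_extendLine v).intervalIntegrable a b) 0).comp
            continuous_subtype_val⟩
       map_add' := fun v w => by
        ext s
        exact intervalIntegral.integral_add ((continuous_extendLine v).intervalIntegrable _ _)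
          ((continuous_extendLine w).intervalIntegrable _ _)
       map_smul' := fun r v => by
        ext s
        exact intervalIntegral.integral_smul r (extendLine v) } :
      C(unitInterval, E) →ₗ[ℝ] C(unitInterval, E)) 1 (by
    intro v
    refine (ContinuousMap.norm_le _ (by positivity)).2 fun s => ?_
    have h := intervalIntegral.norm_integral_le_of_norm_le_const (a := (0 : ℝ)) (b := (s : ℝ))
      (f := extendLine v) (C := ‖v‖) fun x _ => norm_extendLine_le v x
    refine h.trans ?_
    rw [sub_zero, abs_of_nonneg s.2.1, one_mul]
    exact mul_le_of_le_one_right (norm_nonneg _) s.2.2)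

variable [CompleteSpace E]

/-- The map `v ↦ T(v a)`, for an operator `T` of an algebra. -/
def opMul {X : Type*} [NormedRing X] [NormedAlgebra ℝ X] (T : X →L[ℝ] X) (a : X) : X →L[ℝ] X :=
  T.comp ((ContinuousLinearMap.mul ℝ X).flip a)

theorem opMul_apply {X : Type*} [NormedRing X] [NormedAlgebra ℝ X] (T : X →L[ℝ] X) (a v : X) :
    opMul T a v = T (v * a) := rfl

/-- 1 - Vⁿ is invertible as soon as ‖Vⁿ‖ < 1, and it factors as 1 - V times a geometric sum
commuting with 1 - V. -/
theorem isUnit_one_sub_opMul {X : Type*} [NormedRing X] [NormedAlgebra ℝ X] [CompleteSpace X]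
    (T : X →L[ℝ] X) (a : X) {n : ℕ} {C : ℝ} (hC : C < 1) (hC0 : 0 ≤ C)
    (h : ∀ v, ‖(opMul T a ^ n) v‖ ≤ C * ‖v‖) : IsUnit (1 - opMul T a) := by
  have hu : IsUnit (1 - opMul T a ^ n) :=
    isUnit_one_sub_of_norm_lt_one ((ContinuousLinearMap.opNorm_le_bound _ hC0 h).trans_lt hC)
  rw [← mul_neg_geom_sum] at hu
  refine ((Commute.isUnit_mul_iff ?_).1 hu).1
  exact (Commute.one_left _).sub_left (Commute.sum_right _ _ _ fun i _ => Commute.self_pow _ _)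

/-- The solution `v` of `v = c + T(v a)`. -/
def opSol {X : Type*} [NormedRing X] [NormedAlgebra ℝ X] (T : X →L[ℝ] X) (a c : X) : X :=
  Ring.inverse (1 - opMul T a) c

theorem opSol_iff {X : Type*} [NormedRing X] [NormedAlgebra ℝ X] (T : X →L[ℝ] X) {a c v : X}
    (h : IsUnit (1 - opMul T a)) : v = opSol T a c ↔ v = c + T (v * a) := by
  have h0 : v = c + T (v * a) ↔ (1 - opMul T a) v = c := by
    rw [sub_apply, opMul_apply, one_apply_eq_self, sub_eq_iff_eq_add]
  rw [h0]
  constructor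
  · rintro rfl
    rw [opSol, ← mul_apply_eq_comp, Ring.mul_inverse_cancel _ h, one_apply_eq_self]
  · rintro rfl
    rw [opSol, ← mul_apply_eq_comp, Ring.inverse_mul_cancel _ h, one_apply_eq_self]

/-- Inversion is smooth at units of the Banach algebra of operators, so the solution is smooth in
the data; no separate differentiation of the integral equation is needed. -/
theorem contDiffOn_opSol {X Y : Type*} [NormedRing X] [NormedAlgebra ℝ X] [CompleteSpace X]
    [NormedAddCommGroup Y] [NormedSpace ℝ Y] (T : X →L[ℝ] X) (h : ∀ a, IsUnit (1 - opMul T a))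
    {a c : Y → X} {s : Set Y} (ha : ContDiffOn ℝ ∞ a s) (hc : ContDiffOn ℝ ∞ c s) :
    ContDiffOn ℝ ∞ (fun y => opSol T (a y) (c y)) s := by
  have h1 : ContDiffOn ℝ ∞ (fun y => 1 - opMul T (a y)) s :=
    contDiffOn_const.sub (contDiffOn_const.clm_comp
      ((ContinuousLinearMap.mul ℝ X).flip.contDiff.comp_contDiffOn ha))
  have h2 : ContDiffOn ℝ ∞ (fun y => Ring.inverse (1 - opMul T (a y))) s := by
    intro y hy
    obtain ⟨u, hu⟩ := h (a y)
    have h3 : ContDiffAt ℝ ∞ Ring.inverse (1 - opMul T (a y)) := by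
      rw [← hu]
      exact contDiffAt_ringInverse ℝ u
    exact h3.comp_contDiffWithinAt y (h1 y hy)
  exact h2.clm_apply hc

variable {𝔸 : Type*} [NormedRing 𝔸] [NormedAlgebra ℝ 𝔸] [CompleteSpace 𝔸]

/-- The Volterra operator `v ↦ ∫₀ˢ v a`. -/
def volterra (a : C(unitInterval, 𝔸)) : C(unitInterval, 𝔸) →L[ℝ] C(unitInterval, 𝔸) :=
  opMul (primitive 𝔸) a

theorem volterra_apply (a v : C(unitInterval, 𝔸)) (s : unitInterval) :
    volterra a v s = ∫ r in (0 : ℝ)..s, extendLine v r * extendLine a r := rfl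

/-- Each further integration of rⁿ yields sⁿ⁺¹/(n+1): the iterates decay factorially, with no
smallness condition on a. -/
theorem norm_volterra_pow_apply_le (a v : C(unitInterval, 𝔸)) (n : ℕ) (s : unitInterval) :
    ‖(volterra a ^ n) v s‖ ≤ (‖a‖ * s) ^ n / n.factorial * ‖v‖ := by
  induction n generalizing s with
  | zero => simpa using v.norm_coe_le_norm s
  | succ n ih =>
    rw [pow_succ', mul_apply_eq_comp, volterra_apply]
    have hs := s.2.1
    have hb : ∀ r ∈ Ioc (0 : ℝ) s, ‖extendLine ((volterra a ^ n) v) r * extendLine a r‖ ≤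
        ‖a‖ ^ (n + 1) / n.factorial * ‖v‖ * r ^ n := by
      intro r hr
      have hr' : r ∈ Icc (0 : ℝ) 1 := ⟨hr.1.le, hr.2.trans s.2.2⟩
      have h1 := ih ⟨r, hr'⟩
      have h2 : extendLine ((volterra a ^ n) v) r = (volterra a ^ n) v ⟨r, hr'⟩ :=
        extendLine_coe _ ⟨r, hr'⟩
      rw [h2]
      refine (norm_mul_le _ _).trans ?_
      refine (mul_le_mul h1 (norm_extendLine_le a r) (norm_nonneg _)
        ((norm_nonneg _).trans h1)).trans (le_of_eq ?_)
      simp only [mul_pow]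
      ring
    refine (intervalIntegral.norm_integral_le_of_norm_le hs
      (MeasureTheory.ae_of_all _ hb) (by
        apply Continuous.intervalIntegrable; fun_prop)).trans (le_of_eq ?_)
    rw [intervalIntegral.integral_const_mul, integral_pow, Nat.factorial_succ]
    push_cast
    have : (n.factorial : ℝ) ≠ 0 := by positivity
    field_simp
    ring

theorem isUnit_one_sub_volterra (a : C(unitInterval, 𝔸)) :
    IsUnit (1 - opMul (primitive 𝔸) a) := by
  obtain ⟨n, hn⟩ := ((FloorSemiring.tendsto_pow_div_factorial_atTop ‖a‖).eventually_lt_const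
    (zero_lt_one' ℝ)).exists
  refine isUnit_one_sub_opMul (primitive 𝔸) a (n := n) hn (by positivity) fun v => ?_
  refine (ContinuousMap.norm_le _ (by positivity)).2 fun s => ?_
  refine (norm_volterra_pow_apply_le a v n s).trans ?_
  have := s.2.1
  gcongr
  exact mul_le_of_le_one_right (norm_nonneg _) s.2.2

/-- The equivalence records both existence and uniqueness; uniqueness is what later proves the
scaling relation of the solutions. -/
theorem exists_volterraSol (𝔸 : Type*) [NormedRing 𝔸] [NormedAlgebra ℝ 𝔸] [CompleteSpace 𝔸] :
    ∃ S : C(unitInterval, 𝔸) → C(unitInterval, 𝔸) → C(unitInterval, 𝔸),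
      (∀ a c v, v = S a c ↔
        ∀ s : unitInterval, v s = c s + ∫ r in (0 : ℝ)..s, extendLine v r * extendLine a r) ∧
      ∀ (Ω : Set (ℝ × ℝ)) (a c : ℝ × ℝ → C(unitInterval, 𝔸)), ContDiffOn ℝ ∞ a Ω →
        ContDiffOn ℝ ∞ c Ω → ContDiffOn ℝ ∞ (fun p => S (a p) (c p)) Ω := by
  refine ⟨opSol (primitive 𝔸), fun a c v => ?_, fun Ω a c ha hc =>
    contDiffOn_opSol _ isUnit_one_sub_volterra ha hc⟩
  rw [opSol_iff _ (isUnit_one_sub_volterra a), ContinuousMap.ext_iff]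
  rfl

/-- The linear equation `y_x = y u` on a domain that is star-shaped in `x`, with smooth dependence
on the parameter `t`. -/
theorem exists_linearODE {Ω : Set (ℝ × ℝ)} (hΩ : IsOpen Ω)
    (hstar : ∀ p ∈ Ω, ∀ s ∈ Icc (0 : ℝ) 1, (s * p.1, p.2) ∈ Ω) {u : ℝ × ℝ → 𝔸}
    (hu : ContDiffOn ℝ ∞ u Ω) {φ : ℝ → 𝔸} (hφ : ContDiffOn ℝ ∞ (fun p : ℝ × ℝ => φ p.2) Ω) :
    ∃ y : ℝ × ℝ → 𝔸, ContDiffOn ℝ ∞ y Ω ∧ (∀ t, (0, t) ∈ Ω → y (0, t) = φ t) ∧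
      ∀ p ∈ Ω, HasDerivAt (fun x => y (x, p.2)) (y p * u p) p.1 := by
  -- The substitution x ↦ sx moves the variable endpoint x to the fixed interval [0,1]: v(s) = y(sx,
  -- t) has coefficient x·u(sx, t), and (x, t) becomes a parameter.
  let m : (ℝ × ℝ) × ℝ → ℝ × ℝ := fun q => (q.2 * q.1.1, q.1.2)
  have hm : ContDiff ℝ ∞ m := by fun_prop
  let W : Set ((ℝ × ℝ) × ℝ) := m ⁻¹' Ω ∩ Prod.fst ⁻¹' Ω
  have hW : IsOpen W := (hΩ.preimage hm.continuous).inter (hΩ.preimage continuous_fst)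
  have hUW : Ω ×ˢ Icc 0 1 ⊆ W := fun q hq => ⟨hstar _ hq.1 _ hq.2, hq.1⟩
  have hf₀ : ContDiffOn ℝ ∞ (fun q => u (m q)) W :=
    hu.comp (s := W) hm.contDiffOn fun q (hq : q ∈ W) => hq.1
  have hf₁ : ContDiffOn ℝ ∞ (fun q : (ℝ × ℝ) × ℝ => q.1.1 • u (m q)) W :=
    (by fun_prop : ContDiff ℝ ∞ fun q : (ℝ × ℝ) × ℝ => q.1.1).contDiffOn.smul hf₀
  have hf₂ : ContDiffOn ℝ ∞ (fun q : (ℝ × ℝ) × ℝ => φ q.1.2) W :=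
    hφ.comp (s := W) contDiff_fst.contDiffOn fun q (hq : q ∈ W) => hq.2
  obtain ⟨a, ha⟩ := exists_curry hUW hf₁.continuousOn
  obtain ⟨c, hc⟩ := exists_curry hUW hf₂.continuousOn
  have ha' := contDiffOn_curry hΩ hW hUW hf₁ ha
  have hc' := contDiffOn_curry hΩ hW hUW hf₂ hc
  obtain ⟨S, hS, hSd⟩ := exists_volterraSol 𝔸
  obtain ⟨v, hvdef⟩ : ∃ v : ℝ × ℝ → C(unitInterval, 𝔸), v = fun p => S (a p) (c p) := ⟨_, rfl⟩
  have hv : ContDiffOn ℝ ∞ v Ω := by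
    rw [hvdef]
    exact hSd Ω a c ha' hc'
  have hveq : ∀ p ∈ Ω, ∀ s : unitInterval,
      v p s = φ p.2 + ∫ r in (0 : ℝ)..s, extendLine (v p) r * extendLine (a p) r := by
    intro p hp s
    rw [← hc p hp s]
    exact (hS (a p) (c p) (v p)).1 (by rw [hvdef]) s
  -- Restricting the solution for (x, t) to [0, s] and rescaling solves the equation for (sx, t). By
  -- uniqueness the solutions for different x are pieces of one function y.
  have hscale : ∀ p ∈ Ω, ∀ s r : unitInterval, v (s * p.1, p.2) r = v p (s * r) := by
    intro p hp s
    have hp' := hstar p hp s s.2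
    obtain ⟨w, hwr⟩ : ∃ w : C(unitInterval, 𝔸), ∀ r, w r = v p (s * r) :=
      ⟨⟨fun r => v p (s * r), by fun_prop⟩, fun r => rfl⟩
    have hw : w = S (a (s * p.1, p.2)) (c (s * p.1, p.2)) := by
      refine (hS _ _ _).2 fun r => ?_
      rw [hwr, hveq p hp, hc _ hp']
      congr 1
      have h3 := intervalIntegral.smul_integral_comp_mul_left (a := 0) (b := (r : ℝ))
        (fun x => extendLine (v p) x * extendLine (a p) x) (s : ℝ)
      rw [mul_zero] at h3
      rw [Set.Icc.coe_mul, ← h3, ← intervalIntegral.integral_smul]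
      refine intervalIntegral.integral_congr fun x hx => ?_
      rw [uIcc_of_le r.2.1] at hx
      have hx' : x ∈ Icc (0 : ℝ) 1 := ⟨hx.1, hx.2.trans r.2.2⟩
      have e1 := extendLine_coe (v p) (s * ⟨x, hx'⟩)
      have e2 := extendLine_coe (a p) (s * ⟨x, hx'⟩)
      have e3 := extendLine_coe w ⟨x, hx'⟩
      have e4 := extendLine_coe (a (s * p.1, p.2)) ⟨x, hx'⟩
      rw [Set.Icc.coe_mul] at e1 e2
      simp only at e1 e2 e3 e4 ⊢
      rw [e1, e2, e3, e4, hwr, ha _ hp', ha _ hp]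
      have h4 : x * (s * p.1) = s * x * p.1 := by ring
      simp only [m, Set.Icc.coe_mul, mul_smul, mul_smul_comm, h4]
    intro r
    rw [← hwr, hw, hvdef]
  obtain ⟨y, hydef⟩ : ∃ y : ℝ × ℝ → 𝔸, ∀ p, y p = v p 1 := ⟨fun p => v p 1, fun p => rfl⟩
  have heval : IsBoundedLinearMap ℝ fun w : C(unitInterval, 𝔸) => w 1 :=
    IsLinearMap.with_bound ⟨fun _ _ => rfl, fun _ _ => rfl⟩ 1 fun w => by
      rw [one_mul]
      exact w.norm_coe_le_norm 1
  have hy' : ContDiffOn ℝ ∞ (fun p => v p 1) Ω := heval.contDiff.comp_contDiffOn hv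
  have hy : ContDiffOn ℝ ∞ y Ω := hy'.congr fun p _ => hydef p
  have hyv : ∀ p ∈ Ω, ∀ s : unitInterval, v p s = y (s * p.1, p.2) := fun p hp s => by
    rw [hydef, hscale p hp s 1, mul_one]
  have hyeq : ∀ p ∈ Ω, y p = φ p.2 + ∫ x in (0 : ℝ)..p.1, y (x, p.2) * u (x, p.2) := by
    intro p hp
    have h3 := intervalIntegral.smul_integral_comp_mul_right (a := (0 : ℝ)) (b := 1)
      (fun x => y (x, p.2) * u (x, p.2)) p.1
    rw [zero_mul, one_mul] at h3
    rw [← h3, ← intervalIntegral.integral_smul]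
    rw [hydef, hveq p hp 1]
    congr 1
    refine intervalIntegral.integral_congr fun x hx => ?_
    rw [Set.Icc.coe_one, uIcc_of_le zero_le_one] at hx
    have e1 := extendLine_coe (v p) ⟨x, hx⟩
    have e2 := extendLine_coe (a p) ⟨x, hx⟩
    simp only at e1 e2 ⊢
    rw [e1, e2, hyv p hp, ha p hp, mul_smul_comm]
  refine ⟨y, hy, fun t ht => by simpa using hyeq (0, t) ht, ?_⟩
  rintro ⟨x, t⟩ hp
  clear hyv hscale hveq hvdef hv
  have hS : IsOpen {x : ℝ | (x, t) ∈ Ω} := hΩ.preimage (by fun_prop)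
  have hcont : ContinuousOn (fun x => y (x, t) * u (x, t)) {x : ℝ | (x, t) ∈ Ω} :=
    (hy.continuousOn.mul hu.continuousOn).comp (f := fun x : ℝ => (x, t)) (by fun_prop)
      fun x hx => hx
  have hsub : uIcc 0 x ⊆ {x : ℝ | (x, t) ∈ Ω} := by
    intro z hz
    rw [← segment_eq_uIcc, segment_eq_image] at hz
    obtain ⟨θ, hθ, rfl⟩ := hz
    simpa using hstar (x, t) hp θ hθ
  have hd := intervalIntegral.integral_hasDerivAt_right (hcont.mono hsub).intervalIntegrable
    (hcont.stronglyMeasurableAtFilter hS x hp) (hcont.continuousAt (hS.mem_nhds hp))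
  refine (hd.const_add (φ t)).congr_of_eventuallyEq ?_
  filter_upwards [hS.mem_nhds hp] with z hz using hyeq (z, t) hz

end LinearODE

/-! ### Linear equations whose solutions stay in a compact group. -/

section GroupODE

open Set Filter Topology

variable {𝔸 : Type*} [NormedRing 𝔸] [NormedAlgebra ℝ 𝔸] [FiniteDimensional ℝ 𝔸]
variable {G : Subgroup 𝔸ˣ}

theorem inv_mul_deriv_mem {c : ℝ → G} {c' : 𝔸} {s₀ : ℝ}
    (h : HasDerivAt (fun s => ((c s : 𝔸ˣ) : 𝔸)) c' s₀) :
    (((c s₀ : 𝔸ˣ)⁻¹ : 𝔸ˣ) : 𝔸) * c' ∈ lieAlg G := by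
  refine ⟨fun s => (c s₀ : 𝔸ˣ)⁻¹ * c (s₀ + s), fun s => G.mul_mem (G.inv_mem (c s₀).2) (c _).2,
    by simp, ?_⟩
  have h1 : HasDerivAt (fun s => ((c (s₀ + s) : 𝔸ˣ) : 𝔸)) c' 0 :=
    HasDerivAt.comp_const_add s₀ 0 (by simpa using h)
  simpa using h1.const_mul (((c s₀ : 𝔸ˣ)⁻¹ : 𝔸ˣ) : 𝔸)

theorem hasDerivAt_units_inv {c : ℝ → 𝔸ˣ} {c' : 𝔸} {s₀ : ℝ}
    (h : HasDerivAt (fun s => (c s : 𝔸)) c' s₀) :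
    HasDerivAt (fun s => (((c s)⁻¹ : 𝔸ˣ) : 𝔸))
      (-((((c s₀)⁻¹ : 𝔸ˣ) : 𝔸) * c' * (((c s₀)⁻¹ : 𝔸ˣ) : 𝔸))) s₀ := by
  have : CompleteSpace 𝔸 := FiniteDimensional.complete ℝ 𝔸
  have h1 := (hasFDerivAt_ringInverse (𝕜 := ℝ) (c s₀)).comp_hasDerivAt s₀ h
  simpa [Function.comp_def] using h1

theorem contDiffOn_units_inv {X : Type*} [NormedAddCommGroup X] [NormedSpace ℝ X] {c : X → 𝔸ˣ}
    {s : Set X} (h : ContDiffOn ℝ ∞ (fun p => (c p : 𝔸)) s) :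
    ContDiffOn ℝ ∞ (fun p => (((c p)⁻¹ : 𝔸ˣ) : 𝔸)) s := by
  have : CompleteSpace 𝔸 := FiniteDimensional.complete ℝ 𝔸
  intro p hp
  have h1 := (contDiffAt_ringInverse ℝ (n := ∞) (c p)).comp_contDiffWithinAt p (h p hp)
  simpa [Function.comp_def] using h1

theorem isCompact_units_coe_image (hG : IsCompact (G : Set 𝔸ˣ)) :
    IsCompact ((fun g : 𝔸ˣ => (g : 𝔸)) '' (G : Set 𝔸ˣ)) :=
  hG.image Units.continuous_val

/-- Invariance of a closed set under a tangent field, without an exponential map. Let d be the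
distance from y to G and g a nearest point, which exists by compactness. A curve c in G with
velocity a at 1 gives the competitor g·c(z - x) in G, so the right growth rate of d is at most ‖(y -
g)a‖ ≤ K d. Gronwall and d(t₀) = 0 give d = 0. -/
theorem mem_image_of_ODE_right (hG : IsCompact (G : Set 𝔸ˣ)) {y a : ℝ → 𝔸} {t₀ b : ℝ}
    (h0 : y t₀ ∈ (fun g : 𝔸ˣ => (g : 𝔸)) '' (G : Set 𝔸ˣ))
    (hy : ∀ t ∈ Icc t₀ b, HasDerivAt y (y t * a t) t) (ha : ContinuousOn a (Icc t₀ b))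
    (hmem : ∀ t ∈ Icc t₀ b, a t ∈ lieAlg G) {t : ℝ} (ht : t ∈ Icc t₀ b) :
    y t ∈ (fun g : 𝔸ˣ => (g : 𝔸)) '' (G : Set 𝔸ˣ) := by
  set S := (fun g : 𝔸ˣ => (g : 𝔸)) '' (G : Set 𝔸ˣ) with hSdef
  have hS : IsCompact S := isCompact_units_coe_image hG
  have hne : S.Nonempty := ⟨_, h0⟩
  obtain ⟨K, hK⟩ := isCompact_Icc.exists_bound_of_continuousOn ha
  have hcont : ContinuousOn y (Icc t₀ b) := fun t ht => (hy t ht).continuousAt.continuousWithinAt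
  have key := le_gronwallBound_of_liminf_deriv_right_le (f := fun t => Metric.infDist (y t) S)
    (f' := fun t => K * Metric.infDist (y t) S) (δ := 0) (K := K) (ε := 0) (a := t₀) (b := b)
    ((Metric.continuous_infDist_pt S).comp_continuousOn hcont) ?_
    (Metric.infDist_zero_of_mem h0).le (fun x _ => by simp) t ht
  · rw [gronwallBound_ε0_δ0] at key
    exact (hS.isClosed.mem_iff_infDist_zero hne).2 (le_antisymm key Metric.infDist_nonneg)
  · intro x hx r hr
    have hx' : x ∈ Icc t₀ b := ⟨hx.1, hx.2.le⟩
    obtain ⟨_, ⟨g, hg, rfl⟩, hgd⟩ := hS.exists_infDist_eq_dist hne (y x)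
    obtain ⟨c, hc, c0, hcd⟩ := hmem x hx'
    have h1 : HasDerivAt (fun z => (c (z - x) : 𝔸)) (a x) x :=
      HasDerivAt.comp_sub_const (f := fun s => (c s : 𝔸)) x x (by rwa [sub_self])
    have h2 := (hy x hx').sub (h1.const_mul (g : 𝔸))
    have h3 : ‖y x * a x - (g : 𝔸) * a x‖ < r := by
      refine lt_of_le_of_lt ?_ hr
      rw [hgd, dist_eq_norm, ← sub_mul]
      refine (norm_mul_le _ _).trans ?_
      rw [mul_comm]
      gcongr
      exact hK x hx'
    have h4 := h2.hasDerivWithinAt.limsup_slope_norm_le (s := Ioi x) h3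
    refine Eventually.frequently ?_
    filter_upwards [h4, self_mem_nhdsWithin] with z hz hzx
    have hzx' : 0 < z - x := sub_pos.2 hzx
    refine lt_of_le_of_lt ?_ hz
    rw [Real.norm_of_nonneg hzx'.le]
    refine mul_le_mul_of_nonneg_left ?_ (inv_nonneg.2 hzx'.le)
    simp only [Pi.sub_apply, sub_self, c0, Units.val_one, mul_one]
    refine sub_le_sub ?_ (by rw [hgd, dist_eq_norm])
    rw [← dist_eq_norm]
    exact Metric.infDist_le_dist_of_mem ⟨g * c (z - x), G.mul_mem hg (hc _), by simp⟩

theorem mem_image_of_ODE (hG : IsCompact (G : Set 𝔸ˣ)) {y a : ℝ → 𝔸} {J : Set ℝ}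
    (hJ : J.OrdConnected) {t₀ : ℝ} (ht₀ : t₀ ∈ J)
    (h0 : y t₀ ∈ (fun g : 𝔸ˣ => (g : 𝔸)) '' (G : Set 𝔸ˣ))
    (hy : ∀ t ∈ J, HasDerivAt y (y t * a t) t) (ha : ContinuousOn a J)
    (hmem : ∀ t ∈ J, a t ∈ lieAlg G) {t : ℝ} (ht : t ∈ J) :
    y t ∈ (fun g : 𝔸ˣ => (g : 𝔸)) '' (G : Set 𝔸ˣ) := by
  rcases le_total t₀ t with h | h
  · have hsub := hJ.out ht₀ ht
    exact mem_image_of_ODE_right hG h0 (fun s hs => hy s (hsub hs)) (ha.mono hsub)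
      (fun s hs => hmem s (hsub hs)) ⟨h, le_rfl⟩
  · have hsub := hJ.out ht ht₀
    have hneg : ∀ s ∈ Icc (-t₀) (-t), -s ∈ J := fun s hs =>
      hsub ⟨le_neg.2 hs.2, neg_le.2 hs.1⟩
    -- Backwards in time, s ↦ y(-s) solves the same kind of equation with coefficient -a(-s).
    have := mem_image_of_ODE_right hG (y := fun s => y (-s)) (a := fun s => -a (-s))
      (t₀ := -t₀) (b := -t) (by simpa using h0) (fun s hs => ?_)
      ((ha.comp continuous_neg.continuousOn hneg).neg)
      (fun s hs => (lieAlg G).neg_mem (hmem _ (hneg s hs))) (t := -t) ⟨neg_le_neg h, le_rfl⟩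
    · simpa using this
    · have h1 := (hy _ (hneg s hs)).scomp s (hasDerivAt_neg s)
      simpa [Function.comp_def] using h1

theorem exists_group_lift {X : Type*} {s : Set X} {y : X → 𝔸}
    (h : ∀ p ∈ s, y p ∈ (fun g : 𝔸ˣ => (g : 𝔸)) '' (G : Set 𝔸ˣ)) :
    ∃ c : X → G, ∀ p ∈ s, ((c p : 𝔸ˣ) : 𝔸) = y p := by
  classical
  choose! g hg using h
  exact ⟨fun p => if hp : p ∈ s then ⟨g p, (hg p hp).1⟩ else 1, fun p hp => by
    simpa [hp] using (hg p hp).2⟩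

/-- Solutions of `k' = k a` in `G` over an interval. -/
theorem exists_curve (hG : IsCompact (G : Set 𝔸ˣ)) {I : Set ℝ} (hI : IsOpen I)
    (hIc : I.OrdConnected) {a : ℝ → 𝔸} (ha : ContDiffOn ℝ ∞ a I)
    (hmem : ∀ t ∈ I, a t ∈ lieAlg G) {t₀ : ℝ} (ht₀ : t₀ ∈ I) (g₀ : G) :
    ∃ k : ℝ → G, k t₀ = g₀ ∧ ContDiffOn ℝ ∞ (fun t => ((k t : 𝔸ˣ) : 𝔸)) I ∧
      ∀ t ∈ I, HasDerivAt (fun t => ((k t : 𝔸ˣ) : 𝔸)) (((k t : 𝔸ˣ) : 𝔸) * a t) t := by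
  have : CompleteSpace 𝔸 := FiniteDimensional.complete ℝ 𝔸
  -- Shifting t₀ to 0 makes the interval star-shaped about 0; the second coordinate is a dummy
  -- parameter.
  let Ω : Set (ℝ × ℝ) := (fun p => p.1 + t₀) ⁻¹' I
  have hΩ : IsOpen Ω := hI.preimage (by fun_prop)
  have hstar : ∀ p ∈ Ω, ∀ s ∈ Icc (0 : ℝ) 1, (s * p.1, p.2) ∈ Ω := by
    intro p hp s hs
    have h1 : (1 - s) • t₀ + s • (p.1 + t₀) ∈ I :=
      hIc.convex ht₀ hp (by linarith [hs.2]) hs.1 (by ring)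
    have h2 : (1 - s) • t₀ + s • (p.1 + t₀) = s * p.1 + t₀ := by simp only [smul_eq_mul]; ring
    rw [h2] at h1
    exact h1
  obtain ⟨y, hy, hy0, hyd⟩ := exists_linearODE hΩ hstar (u := fun p => a (p.1 + t₀))
    (φ := fun _ => ((g₀ : 𝔸ˣ) : 𝔸))
    (ha.comp (s := Ω) (by fun_prop : ContDiff ℝ ∞ fun p : ℝ × ℝ => p.1 + t₀).contDiffOn
      fun p hp => hp) contDiffOn_const
  have hin : ∀ t ∈ I, (t - t₀, (0 : ℝ)) ∈ Ω := fun t ht => by simpa [Ω] using ht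
  have hd : ∀ t ∈ I, HasDerivAt (fun t => y (t - t₀, 0)) (y (t - t₀, 0) * a t) t := by
    intro t ht
    have h1 := hyd _ (hin t ht)
    simp only [sub_add_cancel] at h1
    exact HasDerivAt.comp_sub_const t t₀ h1
  have h0 : y (t₀ - t₀, 0) = ((g₀ : 𝔸ˣ) : 𝔸) := by
    rw [sub_self]
    exact hy0 0 (by simpa [Ω] using ht₀)
  have hG' : ∀ t ∈ I, y (t - t₀, 0) ∈ (fun g : 𝔸ˣ => (g : 𝔸)) '' (G : Set 𝔸ˣ) := fun t ht =>
    mem_image_of_ODE hG hIc ht₀ ⟨g₀, g₀.2, h0.symm⟩ hd ha.continuousOn hmem ht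
  obtain ⟨k, hk⟩ := exists_group_lift hG'
  refine ⟨k, Subtype.ext (Units.ext ((hk t₀ ht₀).trans h0)), ?_, fun t ht => ?_⟩
  · have h1 : ContDiffOn ℝ ∞ (fun t => y (t - t₀, 0)) I :=
      hy.comp (s := I) (by fun_prop : ContDiff ℝ ∞ fun t : ℝ => (t - t₀, (0 : ℝ))).contDiffOn hin
    exact h1.congr hk
  · rw [hk t ht]
    refine (hd t ht).congr_of_eventuallyEq ?_
    filter_upwards [hI.mem_nhds ht] with s hs using hk s hs

/-- Solutions of `ψ_x = ψ u` in `G`, with a parameter. -/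
theorem exists_family (hG : IsCompact (G : Set 𝔸ˣ)) {I : Set ℝ} (hI : IsOpen I)
    {u : ℝ → ℝ → 𝔸} (hu : Smooth I u) (hmem : ∀ x, ∀ t ∈ I, u x t ∈ lieAlg G) {φ : ℝ → G}
    (hφ : ContDiffOn ℝ ∞ (fun t => ((φ t : 𝔸ˣ) : 𝔸)) I) :
    ∃ ψ : ℝ → ℝ → G, Smooth I (fun x t => ((ψ x t : 𝔸ˣ) : 𝔸)) ∧ (∀ t ∈ I, ψ 0 t = φ t) ∧
      ∀ x, ∀ t ∈ I, HasDerivAt (fun x => ((ψ x t : 𝔸ˣ) : 𝔸)) (((ψ x t : 𝔸ˣ) : 𝔸) * u x t) x := by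
  have : CompleteSpace 𝔸 := FiniteDimensional.complete ℝ 𝔸
  have hΩ : IsOpen ((univ : Set ℝ) ×ˢ I) := isOpen_univ.prod hI
  obtain ⟨y, hy, hy0, hyd⟩ := exists_linearODE hΩ (fun p hp s _ => ⟨mem_univ _, hp.2⟩) hu
    (φ := fun t => ((φ t : 𝔸ˣ) : 𝔸))
    (hφ.comp (s := (univ : Set ℝ) ×ˢ I) contDiff_snd.contDiffOn fun p hp => hp.2)
  have h0 : ∀ t ∈ I, y (0, t) = ((φ t : 𝔸ˣ) : 𝔸) := fun t ht => hy0 t ⟨mem_univ _, ht⟩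
  have hcu : ∀ t ∈ I, ContinuousOn (fun x => u x t) univ := fun t ht =>
    hu.continuousOn.comp (f := fun x : ℝ => (x, t)) (by fun_prop) fun x _ => ⟨mem_univ _, ht⟩
  have hG' : ∀ p ∈ (univ : Set ℝ) ×ˢ I, y p ∈ (fun g : 𝔸ˣ => (g : 𝔸)) '' (G : Set 𝔸ˣ) := by
    rintro ⟨x, t⟩ ⟨-, ht⟩
    exact mem_image_of_ODE hG ordConnected_univ (mem_univ 0) (y := fun x => y (x, t))
      ⟨φ t, (φ t).2, (h0 t ht).symm⟩ (fun x _ => hyd (x, t) ⟨mem_univ _, ht⟩) (hcu t ht)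
      (fun x _ => hmem x t ht) (mem_univ x)
  obtain ⟨c, hc⟩ := exists_group_lift hG'
  refine ⟨fun x t => c (x, t), hy.congr fun p hp => hc p hp, fun t ht => ?_, fun x t ht => ?_⟩
  · exact Subtype.ext (Units.ext ((hc (0, t) ⟨mem_univ _, ht⟩).trans (h0 t ht)))
  · rw [hc (x, t) ⟨mem_univ _, ht⟩]
    exact (hyd (x, t) ⟨mem_univ _, ht⟩).congr_of_eventuallyEq
      (Eventually.of_forall fun z => hc (z, t) ⟨mem_univ _, ht⟩)

end GroupODE

/-! ### Calculus of functions of x and t. -/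

section TwoVariable

open Set Filter Topology

variable {V : Type*} [NormedAddCommGroup V] [NormedSpace ℝ V] {I : Set ℝ} {f g : ℝ → ℝ → V}

theorem strip_mem_nhds (hI : IsOpen I) (x : ℝ) {t : ℝ} (ht : t ∈ I) :
    (univ : Set ℝ) ×ˢ I ∈ 𝓝 (x, t) :=
  (isOpen_univ.prod hI).mem_nhds ⟨mem_univ _, ht⟩

theorem hasDerivAt_of_hasFDerivAt_fst {F : ℝ × ℝ → V} {F' : ℝ × ℝ →L[ℝ] V} {x t : ℝ}
    (h : HasFDerivAt F F' (x, t)) : HasDerivAt (fun y => F (y, t)) (F' (1, 0)) x :=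
  HasFDerivAt.comp_hasDerivAt (f := fun y : ℝ => (y, t)) x h
    ((hasDerivAt_id x).prodMk (hasDerivAt_const x t))

theorem hasDerivAt_of_hasFDerivAt_snd {F : ℝ × ℝ → V} {F' : ℝ × ℝ →L[ℝ] V} {x t : ℝ}
    (h : HasFDerivAt F F' (x, t)) : HasDerivAt (fun s => F (x, s)) (F' (0, 1)) t :=
  HasFDerivAt.comp_hasDerivAt (f := fun s : ℝ => (x, s)) t h
    ((hasDerivAt_const t x).prodMk (hasDerivAt_id t))

theorem Smooth.hasFDerivAt (hf : Smooth I f) (hI : IsOpen I) (x : ℝ) {t : ℝ} (ht : t ∈ I) :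
    HasFDerivAt (fun p : ℝ × ℝ => f p.1 p.2) (fderiv ℝ (fun p : ℝ × ℝ => f p.1 p.2) (x, t))
      (x, t) :=
  ((hf.contDiffAt (strip_mem_nhds hI x ht)).differentiableAt (by simp)).hasFDerivAt

theorem Smooth.hasDerivAt_fst (hf : Smooth I f) (hI : IsOpen I) (x : ℝ) {t : ℝ} (ht : t ∈ I) :
    HasDerivAt (fun y => f y t) (fderiv ℝ (fun p : ℝ × ℝ => f p.1 p.2) (x, t) (1, 0)) x :=
  hasDerivAt_of_hasFDerivAt_fst (hf.hasFDerivAt hI x ht)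

theorem Smooth.hasDerivAt_snd (hf : Smooth I f) (hI : IsOpen I) (x : ℝ) {t : ℝ} (ht : t ∈ I) :
    HasDerivAt (fun s => f x s) (fderiv ℝ (fun p : ℝ × ℝ => f p.1 p.2) (x, t) (0, 1)) t :=
  hasDerivAt_of_hasFDerivAt_snd (hf.hasFDerivAt hI x ht)

theorem Smooth.hasDerivAt_dx (hf : Smooth I f) (hI : IsOpen I) (x : ℝ) {t : ℝ} (ht : t ∈ I) :
    HasDerivAt (fun y => f y t) (dx f x t) x :=
  (hf.hasDerivAt_fst hI x ht).differentiableAt.hasDerivAt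

theorem Smooth.hasDerivAt_dt (hf : Smooth I f) (hI : IsOpen I) (x : ℝ) {t : ℝ} (ht : t ∈ I) :
    HasDerivAt (fun s => f x s) (dt f x t) t :=
  (hf.hasDerivAt_snd hI x ht).differentiableAt.hasDerivAt

theorem Smooth.fderiv (hf : Smooth I f) (hI : IsOpen I) :
    ContDiffOn ℝ ∞ (fderiv ℝ fun p : ℝ × ℝ => f p.1 p.2) (univ ×ˢ I) :=
  hf.fderiv_of_isOpen (isOpen_univ.prod hI) (by simp)

theorem Smooth.congr (hf : Smooth I f) (h : ∀ x, ∀ t ∈ I, g x t = f x t) : Smooth I g :=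
  ContDiffOn.congr hf fun p hp => h p.1 p.2 hp.2

theorem Smooth.dx_apply (hf : Smooth I f) (hI : IsOpen I) (x : ℝ) {t : ℝ} (ht : t ∈ I) :
    dx f x t = _root_.fderiv ℝ (fun p : ℝ × ℝ => f p.1 p.2) (x, t) (1, 0) :=
  (hf.hasDerivAt_fst hI x ht).deriv

theorem Smooth.dt_apply (hf : Smooth I f) (hI : IsOpen I) (x : ℝ) {t : ℝ} (ht : t ∈ I) :
    dt f x t = _root_.fderiv ℝ (fun p : ℝ × ℝ => f p.1 p.2) (x, t) (0, 1) :=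
  (hf.hasDerivAt_snd hI x ht).deriv

theorem Smooth.dx (hf : Smooth I f) (hI : IsOpen I) : Smooth I (dx f) :=
  ((hf.fderiv hI).clm_apply contDiffOn_const).congr fun p hp => hf.dx_apply hI p.1 hp.2

theorem Smooth.dt (hf : Smooth I f) (hI : IsOpen I) : Smooth I (dt f) :=
  ((hf.fderiv hI).clm_apply contDiffOn_const).congr fun p hp => hf.dt_apply hI p.1 hp.2

/-- Partial derivatives commute. -/
theorem Smooth.dx_dt (hf : Smooth I f) (hI : IsOpen I) (x : ℝ) {t : ℝ} (ht : t ∈ I) :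
    HermitianNLS.dx (HermitianNLS.dt f) x t = HermitianNLS.dt (HermitianNLS.dx f) x t := by
  have hat := hf.contDiffAt (strip_mem_nhds hI x ht)
  have hsymm : IsSymmSndFDerivAt ℝ (fun p : ℝ × ℝ => f p.1 p.2) (x, t) :=
    hat.isSymmSndFDerivAt (by simpa using WithTop.coe_le_coe.2 (le_top : (2 : ℕ∞) ≤ ⊤))
  have hF : HasFDerivAt (_root_.fderiv ℝ fun p : ℝ × ℝ => f p.1 p.2)
      (_root_.fderiv ℝ (_root_.fderiv ℝ fun p : ℝ × ℝ => f p.1 p.2) (x, t)) (x, t) :=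
    (((hf.fderiv hI).contDiffAt (strip_mem_nhds hI x ht)).differentiableAt
      (by simp)).hasFDerivAt
  have h1 : HasDerivAt (fun y => HermitianNLS.dt f y t)
      (_root_.fderiv ℝ (_root_.fderiv ℝ fun p : ℝ × ℝ => f p.1 p.2) (x, t) (1, 0) (0, 1)) x := by
    have := (hasDerivAt_of_hasFDerivAt_fst hF).clm_apply
      (hasDerivAt_const x ((0, 1) : ℝ × ℝ))
    simp only [map_zero, add_zero] at this
    exact this.congr_of_eventuallyEq (Eventually.of_forall fun y => hf.dt_apply hI y ht)
  have h2 : HasDerivAt (fun s => HermitianNLS.dx f x s)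
      (_root_.fderiv ℝ (_root_.fderiv ℝ fun p : ℝ × ℝ => f p.1 p.2) (x, t) (0, 1) (1, 0)) t := by
    have := (hasDerivAt_of_hasFDerivAt_snd hF).clm_apply
      (hasDerivAt_const t ((1, 0) : ℝ × ℝ))
    simp only [map_zero, add_zero] at this
    refine this.congr_of_eventuallyEq ?_
    filter_upwards [hI.mem_nhds ht] with s hs using hf.dx_apply hI x hs
  exact h1.deriv.trans ((hsymm.eq _ _).trans h2.deriv.symm)

theorem Smooth.add (hf : Smooth I f) (hg : Smooth I g) : Smooth I fun x t => f x t + g x t :=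
  ContDiffOn.add hf hg

theorem Smooth.sub (hf : Smooth I f) (hg : Smooth I g) : Smooth I fun x t => f x t - g x t :=
  ContDiffOn.sub hf hg

theorem Smooth.neg (hf : Smooth I f) : Smooth I fun x t => -f x t := ContDiffOn.neg hf

theorem Smooth.const_smul (hf : Smooth I f) (r : ℝ) : Smooth I fun x t => r • f x t :=
  ContDiffOn.const_smul r hf

theorem smooth_const (v : V) : Smooth I fun _ _ => v := contDiffOn_const

theorem smooth_of_contDiffOn {k : ℝ → V} (hk : ContDiffOn ℝ ∞ k I) : Smooth I fun _ t => k t :=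
  ContDiffOn.comp (s := univ ×ˢ I) hk contDiff_snd.contDiffOn fun _ hp => hp.2

theorem Smooth.contDiffOn_slice (hf : Smooth I f) (x : ℝ) : ContDiffOn ℝ ∞ (fun t => f x t) I :=
  ContDiffOn.comp (s := I) (g := fun p : ℝ × ℝ => f p.1 p.2) hf (by fun_prop : ContDiff ℝ ∞ fun t : ℝ => (x, t)).contDiffOn
    fun _ ht => ⟨mem_univ _, ht⟩

theorem Smooth.scaleTime (hf : Smooth I f) (c : ℝ) :
    Smooth (scaleTime c I) fun x t => f x (c * t) :=
  ContDiffOn.comp (s := univ ×ˢ HermitianNLS.scaleTime c I) hf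
    (by fun_prop : ContDiff ℝ ∞ fun p : ℝ × ℝ => (p.1, c * p.2)).contDiffOn
    fun _ hp => ⟨mem_univ _, hp.2⟩

theorem Smooth.translate (hf : Smooth I f) (L : ℝ) : Smooth I fun x t => f (x + L) t :=
  ContDiffOn.comp (s := univ ×ˢ I) hf
    (by fun_prop : ContDiff ℝ ∞ fun p : ℝ × ℝ => (p.1 + L, p.2)).contDiffOn
    fun _ hp => ⟨mem_univ _, hp.2⟩

theorem isOpen_scaleTime (hI : IsOpen I) (c : ℝ) : IsOpen (scaleTime c I) :=
  hI.preimage (by fun_prop)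

theorem scaleTime_mem_iff {c : ℝ} (hc : c ≠ 0) {t : ℝ} : t / c ∈ scaleTime c I ↔ t ∈ I := by
  simp [HermitianNLS.scaleTime, mul_div_cancel₀ _ hc]

theorem dx_congr (h : ∀ x, ∀ t ∈ I, f x t = g x t) (x : ℝ) {t : ℝ} (ht : t ∈ I) :
    dx f x t = dx g x t := by
  have : (fun y => f y t) = fun y => g y t := funext fun y => h y t ht
  simp only [dx, this]

theorem dt_congr (hI : IsOpen I) (h : ∀ x, ∀ t ∈ I, f x t = g x t) (x : ℝ) {t : ℝ} (ht : t ∈ I) :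
    dt f x t = dt g x t := by
  refine Filter.EventuallyEq.deriv_eq ?_
  filter_upwards [hI.mem_nhds ht] with s hs using h x s hs

theorem dt_comp_mul (f : ℝ → ℝ → V) (c x t : ℝ) :
    dt (fun x t => f x (c * t)) x t = c • dt f x (c * t) :=
  deriv_comp_mul_left c (fun s => f x s) t

/-- Subspaces are closed in finite dimension, so limits of difference quotients stay inside. This
keeps velocities in 𝔤, 𝔪 or 𝔥. -/
theorem HasDerivAt.mem_submodule [FiniteDimensional ℝ V] (S : Submodule ℝ V) {c : ℝ → V} {c' : V}
    {s : ℝ} (h : HasDerivAt c c' s) (hc : ∀ᶠ r in 𝓝 s, c r ∈ S) : c' ∈ S := by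
  have hcl : IsClosed (S : Set V) := S.closed_of_finiteDimensional
  refine hcl.mem_of_tendsto (hasDerivAt_iff_tendsto_slope.1 h) ?_
  filter_upwards [hc.filter_mono nhdsWithin_le_nhds] with r hr
  exact S.smul_mem _ (S.sub_mem hr hc.self_of_nhds)

theorem eq_of_hasDerivAt_zero {c : ℝ → V} {J : Set ℝ} (hJ : IsOpen J) (hJc : J.OrdConnected)
    (h : ∀ s ∈ J, HasDerivAt c 0 s) {s r : ℝ} (hs : s ∈ J) (hr : r ∈ J) : c s = c r :=
  hJ.is_const_of_deriv_eq_zero hJc.isPreconnected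
    (fun z hz => (h z hz).differentiableAt.differentiableWithinAt) (fun z hz => (h z hz).deriv) hs hr

end TwoVariable

/-! ### Differentiating brackets and the adjoint action. -/

section AdCalculus

open Set Filter Topology

variable {𝔸 : Type*} [NormedRing 𝔸] [NormedAlgebra ℝ 𝔸] [FiniteDimensional ℝ 𝔸]
variable {I : Set ℝ} {f g : ℝ → ℝ → 𝔸}

theorem Smooth.mul (hf : Smooth I f) (hg : Smooth I g) : Smooth I fun x t => f x t * g x t :=
  ContDiffOn.mul hf hg

theorem Smooth.lie (hf : Smooth I f) (hg : Smooth I g) : Smooth I fun x t => ⁅f x t, g x t⁆ := by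
  simp only [Ring.lie_def]
  exact (hf.mul hg).sub (hg.mul hf)

theorem hasDerivAt_lie {a b : ℝ → 𝔸} {a' b' : 𝔸} {s : ℝ} (ha : HasDerivAt a a' s)
    (hb : HasDerivAt b b' s) : HasDerivAt (fun s => ⁅a s, b s⁆) (⁅a', b s⁆ + ⁅a s, b'⁆) s := by
  have h := (ha.mul hb).sub (hb.mul ha)
  simp only [Ring.lie_def]
  refine h.congr_deriv ?_
  abel

theorem Ad_add (g : 𝔸ˣ) (X Y : 𝔸) : Ad g (X + Y) = Ad g X + Ad g Y := by
  simp [Ad, mul_add, add_mul]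

theorem Ad_sub (g : 𝔸ˣ) (X Y : 𝔸) : Ad g (X - Y) = Ad g X - Ad g Y := by
  simp [Ad, mul_sub, sub_mul]

theorem Ad_neg (g : 𝔸ˣ) (X : 𝔸) : Ad g (-X) = -Ad g X := by simp [Ad]

theorem Ad_zero (g : 𝔸ˣ) : Ad g (0 : 𝔸) = 0 := by simp [Ad]

theorem Ad_smul (g : 𝔸ˣ) (r : ℝ) (X : 𝔸) : Ad g (r • X) = r • Ad g X := by simp [Ad]

theorem Ad_inv_Ad (g : 𝔸ˣ) (X : 𝔸) : Ad g⁻¹ (Ad g X) = X := by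
  rw [← Ad_mul, inv_mul_cancel, Ad_one]

theorem Ad_Ad_inv (g : 𝔸ˣ) (X : 𝔸) : Ad g (Ad g⁻¹ X) = X := by
  rw [← Ad_mul, mul_inv_cancel, Ad_one]

theorem Ad_injective (g : 𝔸ˣ) : Function.Injective (Ad g : 𝔸 → 𝔸) := fun X Y h => by
  rw [← Ad_inv_Ad g X, h, Ad_inv_Ad]

/-- The derivative of `Ad(c) X` for a curve with `c' = c a`. -/
theorem hasDerivAt_Ad {c : ℝ → 𝔸ˣ} {a : 𝔸} {X : ℝ → 𝔸} {X' : 𝔸} {s : ℝ}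
    (hc : HasDerivAt (fun s => (c s : 𝔸)) (c s * a) s) (hX : HasDerivAt X X' s) :
    HasDerivAt (fun s => Ad (c s) (X s)) (Ad (c s) (⁅a, X s⁆ + X')) s := by
  have h := (hc.mul hX).mul (hasDerivAt_units_inv hc)
  simp only [Ad, Ring.lie_def]
  refine h.congr_deriv ?_
  simp only [Pi.mul_apply, mul_add, add_mul, mul_sub, sub_mul, mul_neg, mul_assoc, Units.inv_mul_cancel_left]
  abel

theorem Smooth.Ad {c : ℝ → ℝ → 𝔸ˣ} (hc : Smooth I fun x t => (c x t : 𝔸)) (hf : Smooth I f) :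
    Smooth I fun x t => HermitianNLS.Ad (c x t) (f x t) :=
  (hc.mul hf).mul (contDiffOn_units_inv (c := fun p : ℝ × ℝ => c p.1 p.2) hc)

end AdCalculus

/-! ### Algebra of the Hermitian symmetric structure and tangent vectors of the orbit. -/

section Algebra

open Set Filter Topology

variable {𝔸 : Type*} [NormedRing 𝔸] [NormedAlgebra ℝ 𝔸] [FiniteDimensional ℝ 𝔸]
variable {G : Subgroup 𝔸ˣ}

/-- `Ad(g)` as an automorphism of the Lie algebra. -/
def adEquiv (g : G) : lieAlg G ≃ₗ⁅ℝ⁆ lieAlg G where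
  toFun X := ⟨Ad (g : 𝔸ˣ) X, Ad_mem g.2 X.2⟩
  map_add' _ _ := Subtype.ext (Ad_add _ _ _)
  map_smul' _ _ := Subtype.ext (Ad_smul _ _ _)
  map_lie' := Subtype.ext (Ad_lie _ _ _)
  invFun X := ⟨Ad (g : 𝔸ˣ)⁻¹ X, Ad_mem (G.inv_mem g.2) X.2⟩
  left_inv _ := Subtype.ext (Ad_inv_Ad _ _)
  right_inv _ := Subtype.ext (Ad_Ad_inv _ _)

theorem killingForm_Ad (g : G) {X : 𝔸} (hX : X ∈ lieAlg G) :
    killingForm ℝ (lieAlg G) ⟨Ad (g : 𝔸ˣ) X, Ad_mem g.2 hX⟩ ⟨Ad (g : 𝔸ˣ) X, Ad_mem g.2 hX⟩ =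
      killingForm ℝ (lieAlg G) ⟨X, hX⟩ ⟨X, hX⟩ :=
  LieAlgebra.killingForm_of_equiv_apply (adEquiv g) ⟨X, hX⟩ ⟨X, hX⟩

theorem eq_zero_of_central (hss : LieAlgebra.IsSemisimple ℝ (lieAlg G)) {Z : 𝔸}
    (hZ : Z ∈ lieAlg G) (h : ∀ X ∈ lieAlg G, ⁅Z, X⁆ = 0) : Z = 0 := by
  have h1 : (⟨Z, hZ⟩ : lieAlg G) ∈ (LieAlgebra.ad ℝ (lieAlg G)).ker := by
    rw [LieHom.mem_ker]
    ext X
    exact h X X.2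
  rw [LieAlgebra.ad_ker_eq_bot_of_hasTrivialRadical, LieSubmodule.mem_bot] at h1
  exact congrArg Subtype.val h1

namespace HermSymm

variable (D : HermSymm G)

theorem mem_lieAlg_of_mem_m {X : 𝔸} (hX : X ∈ D.𝔪) : X ∈ lieAlg G := by
  have : X ∈ D.𝔪 ⊔ D.𝔥 := Submodule.mem_sup_left hX
  rwa [D.sup_eq] at this

theorem mem_lieAlg_of_mem_h {X : 𝔸} (hX : X ∈ D.𝔥) : X ∈ lieAlg G := by
  have : X ∈ D.𝔪 ⊔ D.𝔥 := Submodule.mem_sup_right hX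
  rwa [D.sup_eq] at this

theorem exists_decomp {X : 𝔸} (hX : X ∈ lieAlg G) : ∃ Y ∈ D.𝔪, ∃ Z ∈ D.𝔥, Y + Z = X := by
  have : X ∈ D.𝔪 ⊔ D.𝔥 := by rw [D.sup_eq]; exact hX
  exact Submodule.mem_sup.1 this

theorem eq_zero_of_mem_of_mem {X : 𝔸} (h₁ : X ∈ D.𝔪) (h₂ : X ∈ D.𝔥) : X = 0 :=
  Submodule.disjoint_def.1 D.disjoint X h₁ h₂

theorem A_lie_h {X : 𝔸} (hX : X ∈ D.𝔥) : ⁅D.A, X⁆ = 0 :=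
  (D.centralizer X (D.mem_lieAlg_of_mem_h hX)).2 hX

theorem A_lie_m {X : 𝔸} (hX : X ∈ D.𝔪) : ⁅D.A, X⁆ ∈ D.𝔪 := D.lie_hm _ D.A_mem _ hX

theorem A_lie_mem {X : 𝔸} (hX : X ∈ lieAlg G) : ⁅D.A, X⁆ ∈ D.𝔪 := by
  obtain ⟨Y, hY, Z, hZ, rfl⟩ := D.exists_decomp hX
  rw [lie_add, D.A_lie_h hZ, add_zero]
  exact D.A_lie_m hY

/-- ad(A) kills 𝔥 and preserves 𝔪, so its image lies in 𝔪. -/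
theorem mem_m_of_sq {X : 𝔸} (hX : X ∈ lieAlg G) (h : ⁅D.A, ⁅D.A, X⁆⁆ = -X) : X ∈ D.𝔪 := by
  have h1 := D.A_lie_m (D.A_lie_mem hX)
  rw [h] at h1
  exact (Submodule.neg_mem_iff _).1 h1

theorem lie_mh {X Y : 𝔸} (hX : X ∈ D.𝔪) (hY : Y ∈ D.𝔥) : ⁅X, Y⁆ ∈ D.𝔪 := by
  rw [← lie_skew]
  exact D.𝔪.neg_mem (D.lie_hm _ hY _ hX)

/-- Since [X, Y] ∈ 𝔥 commutes with A, the Leibniz rule gives [[A, X], Y] + [X, [A, Y]] = 0. -/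
theorem lie_A_comm {X Y : 𝔸} (hX : X ∈ D.𝔪) (hY : Y ∈ D.𝔪) : ⁅X, ⁅D.A, Y⁆⁆ = ⁅Y, ⁅D.A, X⁆⁆ := by
  have h := D.A_lie_h (D.lie_mm _ hX _ hY)
  rw [leibniz_lie] at h
  rw [eq_neg_of_add_eq_zero_right h, lie_skew]

theorem Ad_A {k : G} (hk : k ∈ D.H) : Ad (k : 𝔸ˣ) D.A = D.A := hk

theorem Ad_A_lie {k : G} (hk : k ∈ D.H) (X : 𝔸) : Ad (k : 𝔸ˣ) ⁅D.A, X⁆ = ⁅D.A, Ad (k : 𝔸ˣ) X⁆ := by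
  rw [Ad_lie, D.Ad_A hk]

theorem Ad_mem_m {k : G} (hk : k ∈ D.H) {X : 𝔸} (hX : X ∈ D.𝔪) : Ad (k : 𝔸ˣ) X ∈ D.𝔪 := by
  refine D.mem_m_of_sq (Ad_mem k.2 (D.mem_lieAlg_of_mem_m hX)) ?_
  rw [← D.Ad_A_lie hk, ← D.Ad_A_lie hk, D.sq_eq X hX, Ad_neg]

theorem Ad_inv_mem_m {k : G} (hk : k ∈ D.H) {X : 𝔸} (hX : X ∈ D.𝔪) :
    Ad (k : 𝔸ˣ)⁻¹ X ∈ D.𝔪 :=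
  D.Ad_mem_m (D.H.inv_mem hk) hX

/-- -ad(A)² is the projection of 𝔤 onto 𝔪 along 𝔥, so its trace -K(A, A) equals dim 𝔪. -/
theorem normSqA_pos (hm : D.𝔪 ≠ ⊥) : 0 < D.normSqA := by
  let L := lieAlg G
  let a : L := ⟨D.A, D.A_mem_lieAlg⟩
  let p : Submodule ℝ L := D.𝔪.comap L.toSubmodule.subtype
  let f : L →ₗ[ℝ] L := -(LieAlgebra.ad ℝ L a ∘ₗ LieAlgebra.ad ℝ L a)
  have hfa : ∀ X : L, ((f X : L) : 𝔸) = -⁅D.A, ⁅D.A, (X : 𝔸)⁆⁆ := fun X => rfl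
  have hf : LinearMap.IsProj p f :=
    { map_mem := fun X => by
        change ((f X : L) : 𝔸) ∈ D.𝔪
        rw [hfa]
        exact D.𝔪.neg_mem (D.A_lie_m (D.A_lie_mem X.2))
      map_id := fun X hX => by
        refine Subtype.ext ?_
        rw [hfa, D.sq_eq (X : 𝔸) hX, neg_neg] }
  have htr := hf.trace
  have hn : D.normSqA = LinearMap.trace ℝ L f := by
    rw [map_neg]
    rfl
  rw [hn, htr]
  have hp : p ≠ ⊥ := by
    obtain ⟨X, hX, hX0⟩ := Submodule.exists_mem_ne_zero_of_ne_bot hm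
    refine (Submodule.ne_bot_iff _).2 ⟨⟨X, D.mem_lieAlg_of_mem_m hX⟩, hX, fun h => hX0 ?_⟩
    exact congrArg Subtype.val h
  have : Nontrivial p := Submodule.nontrivial_iff_ne_bot.2 hp
  exact_mod_cast Module.finrank_pos (R := ℝ) (M := p)

theorem emb_mk (g : G) : D.emb (QuotientGroup.mk g) = Ad (g : 𝔸ˣ) D.A := rfl

theorem exists_emb_eq (p : D.M) : ∃ g : G, p = QuotientGroup.mk g ∧ D.emb p = Ad (g : 𝔸ˣ) D.A := by
  obtain ⟨g, rfl⟩ := QuotientGroup.mk_surjective p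
  exact ⟨g, rfl, rfl⟩

theorem emb_mem (p : D.M) : D.emb p ∈ lieAlg G := by
  obtain ⟨g, -, h⟩ := D.exists_emb_eq p
  rw [h]
  exact Ad_mem g.2 D.A_mem_lieAlg

/-- The hypothesis is ad(p)³ = -ad(p) linearized at p = A in direction Y. For the 𝔥-part Z of Y it
reads -3[Z, X] = -[Z, X] on 𝔪 and 0 = -[Z, X] on 𝔥, after the 𝔪-part cancels. So Z is central, hence
0. -/
theorem mem_m_of_sq_central (hss : LieAlgebra.IsSemisimple ℝ (lieAlg G)) {Y : 𝔸}
    (hY : Y ∈ lieAlg G)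
    (h : ∀ X ∈ lieAlg G, ⁅Y, ⁅D.A, ⁅D.A, X⁆⁆⁆ + (⁅D.A, ⁅Y, ⁅D.A, X⁆⁆⁆ + ⁅D.A, ⁅D.A, ⁅Y, X⁆⁆⁆) =
      -⁅Y, X⁆) : Y ∈ D.𝔪 := by
  obtain ⟨Y, hYm, Z, hZ, rfl⟩ := D.exists_decomp hY
  have hAZ := D.A_lie_h hZ
  have hcomm : ∀ X : 𝔸, ⁅D.A, ⁅Z, X⁆⁆ = ⁅Z, ⁅D.A, X⁆⁆ := fun X => by
    rw [leibniz_lie D.A Z X, hAZ, zero_lie, zero_add]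
  have hZm : ∀ X ∈ D.𝔪, ⁅Z, X⁆ = 0 := by
    intro X hX
    have h1 := h X (D.mem_lieAlg_of_mem_m hX)
    simp only [add_lie, lie_add, D.sq_eq X hX, D.A_lie_h (D.lie_mm _ hYm _ (D.A_lie_m hX)),
      D.A_lie_h (D.lie_mm _ hYm _ hX), hcomm, lie_neg, lie_zero] at h1
    have h2 : (2 : ℝ) • ⁅Z, X⁆ = 0 := by
      rw [two_smul]
      rw [← sub_eq_zero] at h1
      rw [← neg_eq_zero, ← h1]
      abel
    exact (smul_eq_zero.1 h2).resolve_left two_ne_zero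
  have hZh : ∀ X ∈ D.𝔥, ⁅Z, X⁆ = 0 := by
    intro X hX
    have h1 := h X (D.mem_lieAlg_of_mem_h hX)
    simp only [add_lie, lie_add, D.A_lie_h hX, lie_zero, D.A_lie_h (D.lie_hh _ hZ _ hX),
      D.sq_eq _ (D.lie_mh hYm hX), zero_add, add_zero, neg_add] at h1
    rw [left_eq_add, neg_eq_zero] at h1
    exact h1
  have hZ0 : Z = 0 := by
    refine eq_zero_of_central hss (D.mem_lieAlg_of_mem_h hZ) fun X hX => ?_
    obtain ⟨X, hXm, W, hW, rfl⟩ := D.exists_decomp hX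
    rw [lie_add, hZm X hXm, hZh W hW, add_zero]
  rw [hZ0, add_zero]
  exact hYm

theorem Ad_A_cube (g : G) {X : 𝔸} (hX : X ∈ lieAlg G) :
    ⁅Ad (g : 𝔸ˣ) D.A, ⁅Ad (g : 𝔸ˣ) D.A, ⁅Ad (g : 𝔸ˣ) D.A, X⁆⁆⁆ = -⁅Ad (g : 𝔸ˣ) D.A, X⁆ :=
  D.Jmap_cube (QuotientGroup.mk g) hX

/-- A curve in the orbit `Ad(G) A` has its velocity in the tangent space of the orbit. -/
theorem deriv_orbit_mem (hss : LieAlgebra.IsSemisimple ℝ (lieAlg G)) {p : ℝ → 𝔸} {p' : 𝔸} {s : ℝ}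
    (hp : HasDerivAt p p' s) (ho : ∀ᶠ r in 𝓝 s, ∃ g : G, p r = Ad (g : 𝔸ˣ) D.A) {g : G}
    (hg : p s = Ad (g : 𝔸ˣ) D.A) : Ad (g : 𝔸ˣ)⁻¹ p' ∈ D.𝔪 := by
  let q : ℝ → 𝔸 := fun r => Ad (g : 𝔸ˣ)⁻¹ (p r)
  have hq : HasDerivAt q (Ad (g : 𝔸ˣ)⁻¹ p') s := (hp.const_mul _).mul_const _
  have hqA : q s = D.A := by
    change Ad (g : 𝔸ˣ)⁻¹ (p s) = _
    rw [hg, Ad_inv_Ad]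
  have hqo : ∀ᶠ r in 𝓝 s, ∃ g : G, q r = Ad (g : 𝔸ˣ) D.A := by
    filter_upwards [ho] with r hr
    obtain ⟨h, hr⟩ := hr
    refine ⟨g⁻¹ * h, ?_⟩
    change Ad (g : 𝔸ˣ)⁻¹ (p r) = _
    rw [hr, ← Ad_mul]
    rfl
  have hmem : Ad (g : 𝔸ˣ)⁻¹ p' ∈ lieAlg G := by
    refine HasDerivAt.mem_submodule (lieAlg G).toSubmodule hq ?_
    filter_upwards [hqo] with r hr
    obtain ⟨h, hr⟩ := hr
    rw [hr]
    exact Ad_mem h.2 D.A_mem_lieAlg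
  refine D.mem_m_of_sq_central hss hmem fun X hX => ?_
  have hX' := hasDerivAt_const s X
  have h1 := hasDerivAt_lie hq hX'
  have h3 := hasDerivAt_lie hq (hasDerivAt_lie hq h1)
  -- The cubic identity holds at every point of the orbit, so both sides may be differentiated along
  -- q; q itself is all that has to be differentiable.
  have h4 : (fun r => ⁅q r, ⁅q r, ⁅q r, X⁆⁆⁆) =ᶠ[𝓝 s] fun r => -⁅q r, X⁆ := by
    filter_upwards [hqo] with r hr
    obtain ⟨h, hr⟩ := hr
    rw [hr, D.Ad_A_cube h hX]
  have h5 := (h3.congr_of_eventuallyEq h4.symm).unique h1.neg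
  simp only [hqA, lie_zero, add_zero, lie_add] at h5
  exact h5

end HermSymm

end Algebra

/-! ### Frames, their velocities and the zero-curvature equation. -/

section Frames

open Set Filter Topology

variable {𝔸 : Type*} [NormedRing 𝔸] [NormedAlgebra ℝ 𝔸] [FiniteDimensional ℝ 𝔸]
variable {G : Subgroup 𝔸ˣ} {I : Set ℝ} {ψ : ℝ → ℝ → G}

theorem smooth_hasimoto (hI : IsOpen I) (hψ : Smooth I fun x t => ((ψ x t : 𝔸ˣ) : 𝔸)) :
    Smooth I (hasimoto ψ) :=
  Smooth.mul (contDiffOn_units_inv (c := fun p : ℝ × ℝ => (ψ p.1 p.2 : 𝔸ˣ)) hψ) (hψ.dx hI)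

theorem smooth_frameVel (hI : IsOpen I) (hψ : Smooth I fun x t => ((ψ x t : 𝔸ˣ) : 𝔸)) :
    Smooth I (frameVel ψ) :=
  Smooth.mul (contDiffOn_units_inv (c := fun p : ℝ × ℝ => (ψ p.1 p.2 : 𝔸ˣ)) hψ) (hψ.dt hI)

theorem mul_hasimoto (ψ : ℝ → ℝ → G) (x t : ℝ) : ((ψ x t : 𝔸ˣ) : 𝔸) * hasimoto ψ x t =
    dx (fun x t => ((ψ x t : 𝔸ˣ) : 𝔸)) x t := Units.mul_inv_cancel_left _ _

theorem mul_frameVel (ψ : ℝ → ℝ → G) (x t : ℝ) : ((ψ x t : 𝔸ˣ) : 𝔸) * frameVel ψ x t =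
    dt (fun x t => ((ψ x t : 𝔸ˣ) : 𝔸)) x t := Units.mul_inv_cancel_left _ _

theorem hasDerivAt_frame_x (hI : IsOpen I) (hψ : Smooth I fun x t => ((ψ x t : 𝔸ˣ) : 𝔸)) (x : ℝ)
    {t : ℝ} (ht : t ∈ I) : HasDerivAt (fun y => ((ψ y t : 𝔸ˣ) : 𝔸))
      (((ψ x t : 𝔸ˣ) : 𝔸) * hasimoto ψ x t) x := by
  rw [mul_hasimoto]
  exact hψ.hasDerivAt_dx hI x ht

theorem hasDerivAt_frame_t (hI : IsOpen I) (hψ : Smooth I fun x t => ((ψ x t : 𝔸ˣ) : 𝔸)) (x : ℝ)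
    {t : ℝ} (ht : t ∈ I) : HasDerivAt (fun s => ((ψ x s : 𝔸ˣ) : 𝔸))
      (((ψ x t : 𝔸ˣ) : 𝔸) * frameVel ψ x t) t := by
  rw [mul_frameVel]
  exact hψ.hasDerivAt_dt hI x ht

theorem hasimoto_eq_of_hasDerivAt {x t : ℝ} {a : 𝔸} (h : HasDerivAt
    (fun y => ((ψ y t : 𝔸ˣ) : 𝔸)) (((ψ x t : 𝔸ˣ) : 𝔸) * a) x) : hasimoto ψ x t = a := by
  have h1 : dx (fun x t => ((ψ x t : 𝔸ˣ) : 𝔸)) x t = ((ψ x t : 𝔸ˣ) : 𝔸) * a := h.deriv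
  rw [hasimoto, h1, Units.inv_mul_cancel_left]

theorem frameVel_eq_of_hasDerivAt {x t : ℝ} {a : 𝔸} (h : HasDerivAt
    (fun s => ((ψ x s : 𝔸ˣ) : 𝔸)) (((ψ x t : 𝔸ˣ) : 𝔸) * a) t) : frameVel ψ x t = a := by
  have h1 : dt (fun x t => ((ψ x t : 𝔸ˣ) : 𝔸)) x t = ((ψ x t : 𝔸ˣ) : 𝔸) * a := h.deriv
  rw [frameVel, h1, Units.inv_mul_cancel_left]

theorem hasimoto_congr {ψ' : ℝ → ℝ → G} (h : ∀ x, ∀ t ∈ I, ψ' x t = ψ x t) (x : ℝ) {t : ℝ}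
    (ht : t ∈ I) : hasimoto ψ' x t = hasimoto ψ x t := by
  have h1 := dx_congr (f := fun x t => ((ψ' x t : 𝔸ˣ) : 𝔸)) (g := fun x t => ((ψ x t : 𝔸ˣ) : 𝔸))
    (fun x t ht => by rw [h x t ht]) x ht
  rw [hasimoto, hasimoto, h1, h x t ht]

theorem frameVel_congr (hI : IsOpen I) {ψ' : ℝ → ℝ → G} (h : ∀ x, ∀ t ∈ I, ψ' x t = ψ x t) (x : ℝ)
    {t : ℝ} (ht : t ∈ I) : frameVel ψ' x t = frameVel ψ x t := by
  have h1 := dt_congr (f := fun x t => ((ψ' x t : 𝔸ˣ) : 𝔸)) (g := fun x t => ((ψ x t : 𝔸ˣ) : 𝔸))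
    hI (fun x t ht => by rw [h x t ht]) x ht
  rw [frameVel, frameVel, h1, h x t ht]

theorem frameVel_mem (hI : IsOpen I) (hψ : Smooth I fun x t => ((ψ x t : 𝔸ˣ) : 𝔸)) (x : ℝ)
    {t : ℝ} (ht : t ∈ I) : frameVel ψ x t ∈ lieAlg G :=
  inv_mul_deriv_mem (c := fun s => ψ x s) (hψ.hasDerivAt_dt hI x ht)

/-- The zero-curvature equation of a frame. -/
theorem zero_curvature (hI : IsOpen I) (hψ : Smooth I fun x t => ((ψ x t : 𝔸ˣ) : 𝔸)) (x : ℝ)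
    {t : ℝ} (ht : t ∈ I) :
    dx (frameVel ψ) x t = dt (hasimoto ψ) x t - ⁅hasimoto ψ x t, frameVel ψ x t⁆ := by
  have hu := smooth_hasimoto hI hψ
  have hw := smooth_frameVel hI hψ
  have h := hψ.dx_dt hI x ht
  have h1 := (hasDerivAt_frame_x hI hψ x ht).mul (hw.hasDerivAt_dx hI x ht)
  have h2 := (hasDerivAt_frame_t hI hψ x ht).mul (hu.hasDerivAt_dt hI x ht)
  have e1 : HasDerivAt (fun y => dt (fun x t => ((ψ x t : 𝔸ˣ) : 𝔸)) y t)
      (((ψ x t : 𝔸ˣ) : 𝔸) * hasimoto ψ x t * frameVel ψ x t +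
        ((ψ x t : 𝔸ˣ) : 𝔸) * dx (frameVel ψ) x t) x :=
    h1.congr_of_eventuallyEq (Eventually.of_forall fun y => (mul_frameVel ψ y t).symm)
  have e2 : HasDerivAt (fun s => dx (fun x t => ((ψ x t : 𝔸ˣ) : 𝔸)) x s)
      (((ψ x t : 𝔸ˣ) : 𝔸) * frameVel ψ x t * hasimoto ψ x t +
        ((ψ x t : 𝔸ˣ) : 𝔸) * dt (hasimoto ψ) x t) t :=
    h2.congr_of_eventuallyEq (Eventually.of_forall fun s => (mul_hasimoto ψ x s).symm)
  replace h := e1.deriv.symm.trans (h.trans e2.deriv)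
  have h3 := congrArg (fun z => (((ψ x t : 𝔸ˣ)⁻¹ : 𝔸ˣ) : 𝔸) * z) h
  simp only [mul_add, mul_assoc, Units.inv_mul_cancel_left] at h3
  rw [Ring.lie_def, eq_sub_iff_add_eq, ← sub_eq_zero]
  rw [← sub_eq_zero] at h3
  rw [← h3]
  abel

/-- This one product rule serves both the gauge transformations ψk and the rigid motions gψ, in x
and in t. -/
theorem hasDerivAt_mul_curve {c k : ℝ → G} {a b : 𝔸} {s : ℝ}
    (hc : HasDerivAt (fun s => ((c s : 𝔸ˣ) : 𝔸)) (((c s : 𝔸ˣ) : 𝔸) * a) s)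
    (hk : HasDerivAt (fun s => ((k s : 𝔸ˣ) : 𝔸)) (((k s : 𝔸ˣ) : 𝔸) * b) s) :
    HasDerivAt (fun s => (((c s * k s : G) : 𝔸ˣ) : 𝔸))
      ((((c s * k s : G) : 𝔸ˣ) : 𝔸) * (Ad (k s : 𝔸ˣ)⁻¹ a + b)) s := by
  have h := hc.mul hk
  simp only [Subgroup.coe_mul, Units.val_mul]
  refine h.congr_deriv ?_
  simp only [Ad, inv_inv, mul_add, mul_assoc, Units.mul_inv_cancel_left]

theorem hasDerivAt_inv_curve {c : ℝ → G} {a : 𝔸} {s : ℝ}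
    (hc : HasDerivAt (fun s => ((c s : 𝔸ˣ) : 𝔸)) (((c s : 𝔸ˣ) : 𝔸) * a) s) :
    HasDerivAt (fun s => ((((c s)⁻¹ : G) : 𝔸ˣ) : 𝔸))
      (((((c s)⁻¹ : G) : 𝔸ˣ) : 𝔸) * (-Ad (c s : 𝔸ˣ) a)) s := by
  have h := hasDerivAt_units_inv hc
  simp only [Subgroup.coe_inv]
  refine h.congr_deriv ?_
  simp only [Ad, mul_neg, mul_assoc, Units.inv_mul_cancel_left]

theorem contDiffOn_curve_inv {X : Type*} [NormedAddCommGroup X] [NormedSpace ℝ X] {c : X → G}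
    {s : Set X} (h : ContDiffOn ℝ ∞ (fun p => ((c p : 𝔸ˣ) : 𝔸)) s) :
    ContDiffOn ℝ ∞ (fun p => ((((c p)⁻¹ : G) : 𝔸ˣ) : 𝔸)) s :=
  contDiffOn_units_inv (c := fun p => (c p : 𝔸ˣ)) h

theorem contDiffOn_curve_mul {X : Type*} [NormedAddCommGroup X] [NormedSpace ℝ X] {c k : X → G}
    {s : Set X} (hc : ContDiffOn ℝ ∞ (fun p => ((c p : 𝔸ˣ) : 𝔸)) s)
    (hk : ContDiffOn ℝ ∞ (fun p => ((k p : 𝔸ˣ) : 𝔸)) s) :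
    ContDiffOn ℝ ∞ (fun p => (((c p * k p : G) : 𝔸ˣ) : 𝔸)) s := by
  simp only [Subgroup.coe_mul, Units.val_mul]
  exact hc.mul hk

theorem hasDerivAt_curve (hI : IsOpen I) {k : ℝ → G}
    (hk : ContDiffOn ℝ ∞ (fun t => ((k t : 𝔸ˣ) : 𝔸)) I) {t : ℝ} (ht : t ∈ I) :
    HasDerivAt (fun t => ((k t : 𝔸ˣ) : 𝔸)) (((k t : 𝔸ˣ) : 𝔸) * ((((k t : 𝔸ˣ)⁻¹ : 𝔸ˣ) : 𝔸) *
      deriv (fun t => ((k t : 𝔸ˣ) : 𝔸)) t)) t := by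
  rw [Units.mul_inv_cancel_left]
  exact ((hk.contDiffAt (hI.mem_nhds ht)).differentiableAt (by simp)).hasDerivAt

theorem hasDerivAt_const_mul_zero (g : G) (s : ℝ) :
    HasDerivAt (fun _ : ℝ => ((g : 𝔸ˣ) : 𝔸)) (((g : 𝔸ˣ) : 𝔸) * 0) s := by
  rw [mul_zero]
  exact hasDerivAt_const s _

theorem hasDerivAt_Ad_const {X : ℝ → 𝔸} {X' : 𝔸} {s : ℝ} (hX : HasDerivAt X X' s) (g : 𝔸ˣ) :
    HasDerivAt (fun s => Ad g (X s)) (Ad g X') s :=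
  (hX.const_mul _).mul_const _

/-- Solutions of `k' = k a` in `G` over an interval, without initial condition. -/
theorem exists_curve_of_velocity (hG : IsCompact (G : Set 𝔸ˣ)) (hI : IsOpen I)
    (hIc : I.OrdConnected) {a : ℝ → 𝔸} (ha : ContDiffOn ℝ ∞ a I)
    (hmem : ∀ t ∈ I, a t ∈ lieAlg G) :
    ∃ k : ℝ → G, ContDiffOn ℝ ∞ (fun t => ((k t : 𝔸ˣ) : 𝔸)) I ∧
      ∀ t ∈ I, HasDerivAt (fun t => ((k t : 𝔸ˣ) : 𝔸)) (((k t : 𝔸ˣ) : 𝔸) * a t) t := by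
  rcases I.eq_empty_or_nonempty with rfl | ⟨t₀, ht₀⟩
  · exact ⟨fun _ => 1, contDiffOn_const, fun t ht => ht.elim⟩
  · obtain ⟨k, -, h⟩ := exists_curve hG hI hIc ha hmem ht₀ 1
    exact ⟨k, h⟩

/-- A curve in `G` over an interval with vanishing velocity is constant. -/
theorem curve_eq_of_hasDerivAt_zero {J : Set ℝ} (hJ : IsOpen J) (hJc : J.OrdConnected) {k : ℝ → G}
    (hk : ∀ t ∈ J, HasDerivAt (fun t => ((k t : 𝔸ˣ) : 𝔸)) (((k t : 𝔸ˣ) : 𝔸) * 0) t) {s r : ℝ}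
    (hs : s ∈ J) (hr : r ∈ J) : k s = k r := by
  refine Subtype.ext (Units.ext (eq_of_hasDerivAt_zero (c := fun t => ((k t : 𝔸ˣ) : 𝔸)) hJ hJc
    (fun t ht => ?_) hs hr))
  have := hk t ht
  rwa [mul_zero] at this

/-- Two solutions of the zero-curvature equation for the same `ψ⁻¹ψ_x` differ by a field that is
parallel along `x`. -/
theorem Ad_frameVel_sub_const (hI : IsOpen I) (hψ : Smooth I fun x t => ((ψ x t : 𝔸ˣ) : 𝔸))
    {N : ℝ → ℝ → 𝔸} (hN : ∀ x, ∀ t ∈ I, HasDerivAt (fun y => N y t)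
      (dt (hasimoto ψ) x t - ⁅hasimoto ψ x t, N x t⁆) x) (x : ℝ) {t : ℝ} (ht : t ∈ I) :
    Ad (ψ x t : 𝔸ˣ) (frameVel ψ x t - N x t) = Ad (ψ 0 t : 𝔸ˣ) (frameVel ψ 0 t - N 0 t) := by
  refine eq_of_hasDerivAt_zero (c := fun x => Ad (ψ x t : 𝔸ˣ) (frameVel ψ x t - N x t))
    isOpen_univ ordConnected_univ (fun y _ => ?_) (mem_univ x) (mem_univ 0)
  have h1 := ((smooth_frameVel hI hψ).hasDerivAt_dx hI y ht).sub (hN y t ht)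
  refine (hasDerivAt_Ad (hasDerivAt_frame_x hI hψ y ht) h1).congr_deriv ?_
  -- Subtracting the two zero-curvature equations gives (w - N)_x = -[u, w - N], which is exactly
  -- the cancellation that makes Ad(ψ)(w - N) constant in x.
  have h2 : ∀ a b c : 𝔸, a - b + (c - a - (c - b)) = 0 := fun a b c => by abel
  rw [zero_curvature hI hψ y ht, Pi.sub_apply, lie_sub, h2, Ad_zero]

end Frames

/-! ### The NLS connection and the Schrödinger map equation in a parallel frame. -/

section NLSFrames

open Set Filter Topology

variable {𝔸 : Type*} [NormedRing 𝔸] [NormedAlgebra ℝ 𝔸] [FiniteDimensional ℝ 𝔸]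
variable {G : Subgroup 𝔸ˣ} {I : Set ℝ}

namespace HermSymm

variable (D : HermSymm G)

/-- The velocity `-J u_x + ½ [u, J u]` of a normalized frame. -/
def nlsVel (u : ℝ → ℝ → 𝔸) (x t : ℝ) : 𝔸 :=
  -⁅D.A, dx u x t⁆ + (1 / 2 : ℝ) • ⁅u x t, ⁅D.A, u x t⁆⁆

/-- The right-hand side `-J u_xx + ½ [u, [u, J u]]` of the NLS flow. -/
def nlsRhs (u : ℝ → ℝ → 𝔸) (x t : ℝ) : 𝔸 :=
  -⁅D.A, dx (dx u) x t⁆ + (1 / 2 : ℝ) • ⁅u x t, ⁅u x t, ⁅D.A, u x t⁆⁆⁆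

variable {u : ℝ → ℝ → 𝔸}

theorem dx_mem_m (hI : IsOpen I) (hu : Smooth I u) (hm : ∀ x, ∀ t ∈ I, u x t ∈ D.𝔪) (x : ℝ) {t : ℝ}
    (ht : t ∈ I) : dx u x t ∈ D.𝔪 :=
  HasDerivAt.mem_submodule D.𝔪 (hu.hasDerivAt_dx hI x ht) (Eventually.of_forall fun y => hm y t ht)

theorem dt_mem_m (hI : IsOpen I) (hu : Smooth I u) (hm : ∀ x, ∀ t ∈ I, u x t ∈ D.𝔪) (x : ℝ) {t : ℝ}
    (ht : t ∈ I) : dt u x t ∈ D.𝔪 := by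
  refine HasDerivAt.mem_submodule D.𝔪 (hu.hasDerivAt_dt hI x ht) ?_
  filter_upwards [hI.mem_nhds ht] with s hs using hm x s hs

theorem smooth_nlsVel (hI : IsOpen I) (hu : Smooth I u) : Smooth I (D.nlsVel u) :=
  (((smooth_const D.A).lie (hu.dx hI)).neg).add
    ((hu.lie ((smooth_const D.A).lie hu)).const_smul _)

theorem nlsVel_mem (hI : IsOpen I) (hu : Smooth I u) (hm : ∀ x, ∀ t ∈ I, u x t ∈ D.𝔪) (x : ℝ)
    {t : ℝ} (ht : t ∈ I) : D.nlsVel u x t ∈ lieAlg G := by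
  have h1 := D.mem_lieAlg_of_mem_m (D.dx_mem_m hI hu hm x ht)
  have h2 := D.mem_lieAlg_of_mem_m (hm x t ht)
  exact (lieAlg G).add_mem ((lieAlg G).neg_mem ((lieAlg G).lie_mem D.A_mem_lieAlg h1))
    ((lieAlg G).smul_mem _ ((lieAlg G).lie_mem h2 ((lieAlg G).lie_mem D.A_mem_lieAlg h2)))

/-- J² = -1 on the 𝔪-part -Ju_x, and the 𝔥-part ½[u, Ju] commutes with A. -/
theorem A_lie_nlsVel (hI : IsOpen I) (hu : Smooth I u) (hm : ∀ x, ∀ t ∈ I, u x t ∈ D.𝔪) (x : ℝ)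
    {t : ℝ} (ht : t ∈ I) : ⁅D.A, D.nlsVel u x t⁆ = dx u x t := by
  rw [nlsVel, lie_add, lie_neg, D.sq_eq _ (D.dx_mem_m hI hu hm x ht), neg_neg, lie_smul,
    D.A_lie_h (D.lie_mm _ (hm x t ht) _ (D.A_lie_m (hm x t ht))), smul_zero, add_zero]

/-- The NLS flow is the zero-curvature equation for `u` and `nlsVel u`. -/
theorem hasDerivAt_nlsVel (hI : IsOpen I) (hu : Smooth I u) (hm : ∀ x, ∀ t ∈ I, u x t ∈ D.𝔪)
    (x : ℝ) {t : ℝ} (ht : t ∈ I) : HasDerivAt (fun y => D.nlsVel u y t)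
      (D.nlsRhs u x t - ⁅u x t, D.nlsVel u x t⁆) x := by
  have h0 := hu.hasDerivAt_dx hI x ht
  have h1 := (hu.dx hI).hasDerivAt_dx hI x ht
  have hA := hasDerivAt_const x D.A
  have h2 := (hasDerivAt_lie hA h1).neg.add
    ((hasDerivAt_lie h0 (hasDerivAt_lie hA h0)).const_smul (1 / 2 : ℝ))
  refine h2.congr_deriv ?_
  -- The two terms from differentiating ½[u, Ju] coincide; their sum is [u, Ju_x], which is also
  -- what -[u, N] contributes.
  have e1 : ⁅dx u x t, ⁅D.A, u x t⁆⁆ = ⁅u x t, ⁅D.A, dx u x t⁆⁆ :=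
    D.lie_A_comm (D.dx_mem_m hI hu hm x ht) (hm x t ht)
  simp only [nlsRhs, nlsVel, zero_lie, zero_add, lie_add, lie_neg, lie_smul, e1]
  rw [← two_smul ℝ ⁅u x t, ⁅D.A, dx u x t⁆⁆, smul_smul,
    show (1 / 2 : ℝ) * 2 = 1 by norm_num, one_smul]
  abel

variable {χ : ℝ → ℝ → D.M} {ψ : ℝ → ℝ → G}

namespace ParallelFrame

variable {D}

theorem emb_eq (h : D.ParallelFrame I χ ψ) (x : ℝ) {t : ℝ} (ht : t ∈ I) :
    D.emb (χ x t) = Ad (ψ x t : 𝔸ˣ) D.A := by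
  rw [h.lift x t ht, D.emb_mk]

theorem hasDerivAt_emb_x (h : D.ParallelFrame I χ ψ) (hI : IsOpen I) (x : ℝ) {t : ℝ} (ht : t ∈ I) :
    HasDerivAt (fun y => D.emb (χ y t)) (Ad (ψ x t : 𝔸ˣ) ⁅hasimoto ψ x t, D.A⁆) x := by
  have h1 := hasDerivAt_Ad (hasDerivAt_frame_x hI h.smooth x ht) (hasDerivAt_const x D.A)
  rw [add_zero] at h1
  exact h1.congr_of_eventuallyEq (Eventually.of_forall fun y => h.emb_eq y ht)

theorem hasDerivAt_emb_t (h : D.ParallelFrame I χ ψ) (hI : IsOpen I) (x : ℝ) {t : ℝ} (ht : t ∈ I) :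
    HasDerivAt (fun s => D.emb (χ x s)) (Ad (ψ x t : 𝔸ˣ) ⁅frameVel ψ x t, D.A⁆) t := by
  have h1 := hasDerivAt_Ad (hasDerivAt_frame_t hI h.smooth x ht) (hasDerivAt_const t D.A)
  rw [add_zero] at h1
  refine h1.congr_of_eventuallyEq ?_
  filter_upwards [hI.mem_nhds ht] with s hs using h.emb_eq x hs

theorem smoothMap (h : D.ParallelFrame I χ ψ) : D.SmoothMap I χ :=
  (Smooth.Ad (c := fun x t => (ψ x t : 𝔸ˣ)) h.smooth (smooth_const D.A)).congr
    fun x _ ht => h.emb_eq x ht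

/-- χ_x = Ad(ψ)[u, A], and differentiating again adds Ad(ψ)[u, [u, A]]. This term is Ad(ψ) of an
element of 𝔥, hence normal, and the projection removes it. -/
theorem covDx_eq (h : D.ParallelFrame I χ ψ) (hI : IsOpen I) (x : ℝ) {t : ℝ} (ht : t ∈ I) :
    D.covDx χ (dx fun x t => D.emb (χ x t)) x t =
      Ad (ψ x t : 𝔸ˣ) ⁅dx (hasimoto ψ) x t, D.A⁆ := by
  have hu := smooth_hasimoto hI h.smooth
  have hum := D.dx_mem_m hI hu h.mem x ht
  have h1 : HasDerivAt (fun y => ⁅hasimoto ψ y t, D.A⁆) ⁅dx (hasimoto ψ) x t, D.A⁆ x := by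
    simpa using hasDerivAt_lie (hu.hasDerivAt_dx hI x ht) (hasDerivAt_const x D.A)
  have h2 := hasDerivAt_Ad (hasDerivAt_frame_x hI h.smooth x ht) h1
  have h3 : dx (dx fun x t => D.emb (χ x t)) x t = _ :=
    (h2.congr_of_eventuallyEq (f₁ := fun y => dx (fun x t => D.emb (χ x t)) y t)
      (Eventually.of_forall fun y => (h.hasDerivAt_emb_x hI y ht).deriv)).deriv
  have h4 : ⁅hasimoto ψ x t, ⁅hasimoto ψ x t, D.A⁆⁆ ∈ D.𝔥 := by
    refine D.lie_mm _ (h.mem x t ht) _ ?_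
    exact D.lie_mh (h.mem x t ht) D.A_mem
  have h5 : ⁅dx (hasimoto ψ) x t, D.A⁆ ∈ D.𝔪 := D.lie_mh hum D.A_mem
  rw [covDx, h3, tangentProj, Jmap, Jmap, h.emb_eq x ht, ← Ad_lie, ← Ad_lie, lie_add, D.A_lie_h h4,
    zero_add, D.sq_eq _ h5, Ad_neg, neg_neg]

/-- Conjugated by Ad(ψ)⁻¹, the equation is [w, A] = -[A, [u_x, A]], and the right side is -u_x
because J² = -1 on 𝔪. -/
theorem schrodinger_iff (h : D.ParallelFrame I χ ψ) (hI : IsOpen I) :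
    D.SchrodingerMap I χ ↔ ∀ x, ∀ t ∈ I, ⁅D.A, frameVel ψ x t⁆ = dx (hasimoto ψ) x t := by
  have hu := smooth_hasimoto hI h.smooth
  refine forall_congr' fun x => forall_congr' fun t => forall_congr' fun ht => ?_
  have hum := D.dx_mem_m hI hu h.mem x ht
  have h1 : dt (fun x t => D.emb (χ x t)) x t = _ := (h.hasDerivAt_emb_t hI x ht).deriv
  rw [h1, h.covDx_eq hI x ht, Jmap, h.emb_eq x ht, ← Ad_lie, ← Ad_neg, (Ad_injective _).eq_iff,
    ← lie_skew (frameVel ψ x t) D.A, ← lie_skew (dx (hasimoto ψ) x t) D.A, lie_neg, D.sq_eq _ hum,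
    neg_neg, neg_inj]

/-- Two parallel frames of a map differ by a gauge transformation. -/
theorem exists_gauge (hI : IsOpen I) {ψ' : ℝ → ℝ → G} (h : D.ParallelFrame I χ ψ)
    (h' : D.ParallelFrame I χ ψ') :
    ∃ k : ℝ → G, (∀ t, k t ∈ D.H) ∧ ContDiffOn ℝ ∞ (fun t => ((k t : 𝔸ˣ) : 𝔸)) I ∧
      ∀ x, ∀ t ∈ I, ψ' x t = ψ x t * k t := by
  classical
  have hH : ∀ x, ∀ t ∈ I, (ψ x t)⁻¹ * ψ' x t ∈ D.H := fun x t ht =>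
    QuotientGroup.eq.1 ((h.lift x t ht).symm.trans (h'.lift x t ht))
  have hconst : ∀ x, ∀ t ∈ I, (ψ x t)⁻¹ * ψ' x t = (ψ 0 t)⁻¹ * ψ' 0 t := by
    intro x t ht
    refine curve_eq_of_hasDerivAt_zero (k := fun x => (ψ x t)⁻¹ * ψ' x t) isOpen_univ
      ordConnected_univ (fun y _ => ?_) (mem_univ x) (mem_univ 0)
    have h1 := hasDerivAt_mul_curve
      (hasDerivAt_inv_curve (hasDerivAt_frame_x hI h.smooth y ht))
      (hasDerivAt_frame_x hI h'.smooth y ht)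
    set k : G := (ψ y t)⁻¹ * ψ' y t with hk
    have e1 : Ad (ψ' y t : 𝔸ˣ)⁻¹ (-Ad (ψ y t : 𝔸ˣ) (hasimoto ψ y t)) =
        -Ad (k : 𝔸ˣ)⁻¹ (hasimoto ψ y t) := by
      rw [Ad_neg, ← Ad_mul, hk]
      simp
    rw [e1] at h1
    -- The x-velocity b of k = ψ⁻¹ψ' lies in 𝔪. Differentiating Ad(k)A = A shows that b also
    -- commutes with A, so b ∈ 𝔪 ∩ 𝔥 = 0.
    have hbm : -Ad (k : 𝔸ˣ)⁻¹ (hasimoto ψ y t) + hasimoto ψ' y t ∈ D.𝔪 :=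
      D.𝔪.add_mem (D.𝔪.neg_mem (D.Ad_inv_mem_m (hH y t ht) (h.mem y t ht))) (h'.mem y t ht)
    have h2 := hasDerivAt_Ad h1 (hasDerivAt_const y D.A)
    have h3 := h2.congr_of_eventuallyEq (f₁ := fun _ => D.A)
      (Eventually.of_forall fun z => (D.Ad_A (hH z t ht)).symm)
    have h4 := h3.unique (hasDerivAt_const y D.A)
    rw [add_zero, ← Ad_zero ((k : G) : 𝔸ˣ), (Ad_injective _).eq_iff, ← lie_skew, neg_eq_zero] at h4
    have hb := D.eq_zero_of_mem_of_mem hbm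
      ((D.centralizer _ (D.mem_lieAlg_of_mem_m hbm)).1 h4)
    rw [hb] at h1
    exact h1
  -- The value 1 off I keeps k in H for every t, where the frames carry no information.
  refine ⟨fun t => if t ∈ I then (ψ 0 t)⁻¹ * ψ' 0 t else 1, fun t => ?_, ?_, fun x t ht => ?_⟩
  · dsimp only
    split_ifs with ht
    · exact hH 0 t ht
    · exact D.H.one_mem
  · refine (contDiffOn_curve_mul (contDiffOn_curve_inv (h.smooth.contDiffOn_slice 0))
      (h'.smooth.contDiffOn_slice 0)).congr fun t ht => ?_
    simp only [if_pos ht]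
  · simp only [if_pos ht, ← hconst x t ht, mul_inv_cancel_left]

end ParallelFrame

end HermSymm

end NLSFrames

/-! ### Existence of parallel frames, gauge transformations and normalized frames. -/

section Correspondence

open Set Filter Topology

variable {𝔸 : Type*} [NormedRing 𝔸] [NormedAlgebra ℝ 𝔸] [FiniteDimensional ℝ 𝔸]
variable {G : Subgroup 𝔸ˣ} {I : Set ℝ}

namespace HermSymm

variable (D : HermSymm G)

theorem orbit_deriv_sq (hss : LieAlgebra.IsSemisimple ℝ (lieAlg G)) {p : ℝ → D.M} {p' : 𝔸} {s : ℝ}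
    (hp : HasDerivAt (fun r => D.emb (p r)) p' s) : ⁅D.emb (p s), ⁅D.emb (p s), p'⁆⁆ = -p' := by
  obtain ⟨g, -, hg⟩ := D.exists_emb_eq (p s)
  have h := D.deriv_orbit_mem hss hp
    (Eventually.of_forall fun r => (D.exists_emb_eq (p r)).imp fun _ h => h.2) hg
  rw [hg, ← Ad_Ad_inv (g : 𝔸ˣ) p', ← Ad_lie, ← Ad_lie, D.sq_eq _ h, Ad_neg]

/-- The velocity of Ad(k)p is Ad(k)([p, [p, p']] + p'), which vanishes for tangent p'. Hence -[p,
p'] is the coefficient that transports p to a fixed point. -/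
theorem hasDerivAt_transport {p : ℝ → 𝔸} {p' : 𝔸} {k : ℝ → G} {s : ℝ} (hp : HasDerivAt p p' s)
    (hsq : ⁅p s, ⁅p s, p'⁆⁆ = -p')
    (hk : HasDerivAt (fun r => ((k r : 𝔸ˣ) : 𝔸)) (((k s : 𝔸ˣ) : 𝔸) * (-⁅p s, p'⁆)) s) :
    HasDerivAt (fun r => Ad (k r : 𝔸ˣ) (p r)) 0 s := by
  refine (hasDerivAt_Ad hk hp).congr_deriv ?_
  rw [neg_lie, lie_skew, hsq, neg_add_cancel, Ad_zero]

/-- Every smooth map has a parallel frame. -/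
theorem exists_parallelFrame (hG : IsCompact (G : Set 𝔸ˣ))
    (hss : LieAlgebra.IsSemisimple ℝ (lieAlg G)) (hI : IsOpen I) (hIc : I.OrdConnected)
    {χ : ℝ → ℝ → D.M} (hχ : D.SmoothMap I χ) : ∃ ψ, D.ParallelFrame I χ ψ := by
  rcases I.eq_empty_or_nonempty with rfl | ⟨t₀, ht₀⟩
  · refine ⟨fun _ _ => 1, contDiffOn_const, fun x t ht => ht.elim, fun x t ht => ht.elim⟩
  let p : ℝ → ℝ → 𝔸 := fun x t => D.emb (χ x t)
  have hp : Smooth I p := hχ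
  have hpx := hp.dx hI
  have hpt := hp.dt hI
  have hpm : ∀ x t, p x t ∈ (lieAlg G).toSubmodule := fun x t => D.emb_mem _
  have hpxm : ∀ x, ∀ t ∈ I, dx p x t ∈ lieAlg G := fun x t ht =>
    HasDerivAt.mem_submodule (lieAlg G).toSubmodule (hp.hasDerivAt_dx hI x ht)
      (Eventually.of_forall fun y => hpm y t)
  have hptm : ∀ x, ∀ t ∈ I, dt p x t ∈ lieAlg G := fun x t ht =>
    HasDerivAt.mem_submodule (lieAlg G).toSubmodule (hp.hasDerivAt_dt hI x ht)
      (Eventually.of_forall fun s => hpm x s)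
  obtain ⟨g₀, -, hg₀⟩ := D.exists_emb_eq (χ 0 t₀)
  -- Transport along x = 0 in t, started at g₀⁻¹ so that the constant value is A; it gives smooth
  -- initial data for the transport in x.
  obtain ⟨k, hk0, hk, hkd⟩ := exists_curve hG hI hIc (a := fun t => -⁅p 0 t, dt p 0 t⁆)
    ((hp.lie hpt).neg.contDiffOn_slice 0)
    (fun t ht => (lieAlg G).neg_mem ((lieAlg G).lie_mem (hpm 0 t) (hptm 0 t ht))) ht₀ g₀⁻¹
  have hkA : ∀ t ∈ I, Ad (k t : 𝔸ˣ) (p 0 t) = D.A := by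
    intro t ht
    have h1 : Ad (k t : 𝔸ˣ) (p 0 t) = Ad (k t₀ : 𝔸ˣ) (p 0 t₀) :=
      eq_of_hasDerivAt_zero (c := fun t => Ad (k t : 𝔸ˣ) (p 0 t)) hI hIc (fun s hs =>
        hasDerivAt_transport (hp.hasDerivAt_dt hI 0 hs)
          (D.orbit_deriv_sq hss (hp.hasDerivAt_dt hI 0 hs)) (hkd s hs)) ht ht₀
    have h2 : p 0 t₀ = Ad (g₀ : 𝔸ˣ) D.A := hg₀
    rw [h1, hk0, h2]
    exact Ad_inv_Ad _ _
  obtain ⟨m, hm, hm0, hmd⟩ := exists_family hG hI (u := fun x t => -⁅p x t, dx p x t⁆)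
    (hp.lie hpx).neg
    (fun x t ht => (lieAlg G).neg_mem ((lieAlg G).lie_mem (hpm x t) (hpxm x t ht))) hk
  have hmA : ∀ x, ∀ t ∈ I, Ad (m x t : 𝔸ˣ) (p x t) = D.A := by
    intro x t ht
    have h1 : Ad (m x t : 𝔸ˣ) (p x t) = Ad (m 0 t : 𝔸ˣ) (p 0 t) :=
      eq_of_hasDerivAt_zero (c := fun x => Ad (m x t : 𝔸ˣ) (p x t)) isOpen_univ ordConnected_univ
        (fun y _ => hasDerivAt_transport (hp.hasDerivAt_dx hI y ht)
          (D.orbit_deriv_sq hss (p := fun y => χ y t) (hp.hasDerivAt_dx hI y ht)) (hmd y t ht)) (mem_univ x) (mem_univ 0)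
    rw [h1, hm0 t ht, hkA t ht]
  refine ⟨fun x t => (m x t)⁻¹, contDiffOn_curve_inv (c := fun q : ℝ × ℝ => m q.1 q.2) hm,
    fun x t ht => D.emb_injective ?_, fun x t ht => ?_⟩
  · rw [D.emb_mk, ← hmA x t ht]
    exact (Ad_inv_Ad _ _).symm
  -- For ψ = m⁻¹ one finds ψ⁻¹ψ_x = Ad(m)[p, p_x] = [A, Ad(m)p_x], which is in the image of ad(A),
  -- that is in 𝔪.
  · have h1 := hasDerivAt_inv_curve (hmd x t ht)
    rw [hasimoto_eq_of_hasDerivAt h1, Ad_neg, neg_neg, Ad_lie, hmA x t ht]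
    exact D.A_lie_mem (Ad_mem (m x t).2 (hpxm x t ht))

variable {u : ℝ → ℝ → 𝔸}

/-- The NLS flow in the time variable of the frame. -/
theorem NLS_iff (hρ : 0 < D.normSqA) {q : ℝ → ℝ → 𝔸} (hI : IsOpen I)
    (hqu : ∀ x, ∀ t ∈ scaleTime D.normSqA I, q x t = u x (D.normSqA * t)) :
    D.NLS (scaleTime D.normSqA I) q ↔ Smooth I u ∧ (∀ x, ∀ t ∈ I, u x t ∈ D.𝔪) ∧
      ∀ x, ∀ t ∈ I, dt u x t = D.nlsRhs u x t := by
  set c := D.normSqA with hc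
  have hc0 : c ≠ 0 := hρ.ne'
  have hdt : ∀ x, ∀ t ∈ scaleTime c I, (1 / c) • dt q x t = dt u x (c * t) := fun x t ht => by
    rw [dt_congr (isOpen_scaleTime hI c) hqu x ht, dt_comp_mul, smul_smul, one_div,
      inv_mul_cancel₀ hc0, one_smul]
  have hdx : ∀ x, ∀ t ∈ scaleTime c I, dx q x t = dx u x (c * t) := fun x t ht =>
    dx_congr hqu x ht
  have hdxx : ∀ x, ∀ t ∈ scaleTime c I, dx (dx q) x t = dx (dx u) x (c * t) := fun x t ht =>
    dx_congr (g := fun x t => dx u x (c * t)) hdx x ht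
  have hmem : ∀ t ∈ I, t / c ∈ scaleTime c I := fun t ht => (scaleTime_mem_iff hc0).2 ht
  have hmul : ∀ t, c * (t / c) = t := fun t => mul_div_cancel₀ t hc0
  constructor
  · rintro ⟨h1, h2, h3⟩
    refine ⟨?_, fun x t ht => ?_, fun x t ht => ?_⟩
    · have h4 := h1.scaleTime c⁻¹
      have h5 : scaleTime c⁻¹ (scaleTime c I) = I := by
        ext t
        simp [scaleTime, mul_inv_cancel_left₀ hc0]
      rw [h5] at h4
      refine h4.congr fun x t ht => ?_
      rw [hqu x _ (by simpa [scaleTime, mul_inv_cancel_left₀ hc0] using ht),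
        mul_inv_cancel_left₀ hc0]
    · have h4 := h2 x _ (hmem t ht)
      rwa [hqu x _ (hmem t ht), hmul] at h4
    · have h4 := h3 x _ (hmem t ht)
      rwa [hdt x _ (hmem t ht), hdxx x _ (hmem t ht), hqu x _ (hmem t ht), hmul] at h4
  · rintro ⟨h1, h2, h3⟩
    refine ⟨(h1.scaleTime c).congr hqu, fun x t ht => ?_, fun x t ht => ?_⟩
    · rw [hqu x t ht]
      exact h2 x _ ht
    · rw [hdt x t ht, hdxx x t ht, hqu x t ht]
      exact h3 x _ ht

/-- Elements of H fix A, so Ad(k) commutes with J; k does not depend on x, so Ad(k) commutes with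
∂/∂x. -/
theorem nlsVel_Ad (hI : IsOpen I) (hu : Smooth I u) {u' : ℝ → ℝ → 𝔸} {k : G} (hk : k ∈ D.H) {t : ℝ}
    (ht : t ∈ I) (h : ∀ x, u' x t = Ad (k : 𝔸ˣ) (u x t)) (x : ℝ) :
    D.nlsVel u' x t = Ad (k : 𝔸ˣ) (D.nlsVel u x t) := by
  have h1 : dx u' x t = Ad (k : 𝔸ˣ) (dx u x t) :=
    ((hasDerivAt_Ad_const (hu.hasDerivAt_dx hI x ht) (k : 𝔸ˣ)).congr_of_eventuallyEq
      (Eventually.of_forall h)).deriv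
  rw [nlsVel, nlsVel, h1, h, Ad_add, Ad_neg, D.Ad_A_lie hk, Ad_smul, Ad_lie, D.Ad_A_lie hk]

variable {χ : ℝ → ℝ → D.M} {ψ : ℝ → ℝ → G} {q : ℝ → ℝ → 𝔸}

variable {D} in
/-- The action of a gauge transformation on the velocities of a parallel frame. -/
theorem ParallelFrame.gauge (h : D.ParallelFrame I χ ψ) (hI : IsOpen I) {k : ℝ → G}
    (hkH : ∀ t, k t ∈ D.H) (hk : ContDiffOn ℝ ∞ (fun t => ((k t : 𝔸ˣ) : 𝔸)) I) :
    D.ParallelFrame I χ (fun x t => ψ x t * k t) ∧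
      ∀ x, ∀ t ∈ I, hasimoto (fun x t => ψ x t * k t) x t = Ad (k t : 𝔸ˣ)⁻¹ (hasimoto ψ x t) := by
  have hu : ∀ x, ∀ t ∈ I,
      hasimoto (fun x t => ψ x t * k t) x t = Ad (k t : 𝔸ˣ)⁻¹ (hasimoto ψ x t) := by
    intro x t ht
    have h1 := hasDerivAt_mul_curve (hasDerivAt_frame_x hI h.smooth x ht)
      (hasDerivAt_const_mul_zero (k t) x)
    rw [add_zero] at h1
    exact hasimoto_eq_of_hasDerivAt (ψ := fun x t => ψ x t * k t) h1
  refine ⟨⟨?_, fun x t ht => ?_, fun x t ht => ?_⟩, hu⟩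
  · exact contDiffOn_curve_mul (c := fun q : ℝ × ℝ => ψ q.1 q.2) (k := fun q : ℝ × ℝ => k q.2)
      h.smooth (smooth_of_contDiffOn hk)
  · rw [h.lift x t ht]
    exact QuotientGroup.eq.2 (by rw [inv_mul_cancel_left]; exact hkH t)
  · rw [hu x t ht]
    exact D.Ad_inv_mem_m (hkH t) (h.mem x t ht)

theorem frameVel_gauge (hI : IsOpen I) (hψ : Smooth I fun x t => ((ψ x t : 𝔸ˣ) : 𝔸)) {k : ℝ → G}
    {b : 𝔸} {t : ℝ} (ht : t ∈ I)
    (hk : HasDerivAt (fun t => ((k t : 𝔸ˣ) : 𝔸)) (((k t : 𝔸ˣ) : 𝔸) * b) t) (x : ℝ) :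
    frameVel (fun x t => ψ x t * k t) x t = Ad (k t : 𝔸ˣ)⁻¹ (frameVel ψ x t) + b :=
  frameVel_eq_of_hasDerivAt (ψ := fun x t => ψ x t * k t)
    (hasDerivAt_mul_curve (hasDerivAt_frame_t hI hψ x ht) hk)

variable {D} in
theorem ParallelFrame.hasimotoFrame (h : D.ParallelFrame I χ ψ)
    (hv : ∀ x, ∀ t ∈ I, frameVel ψ x t = D.nlsVel (hasimoto ψ) x t) :
    D.HasimotoFrame I χ ψ (fun x t => hasimoto ψ x (D.normSqA * t)) :=
  ⟨h, fun _ _ _ => rfl, hv⟩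

namespace HasimotoFrame

variable {D}

theorem vel_eq (h : D.HasimotoFrame I χ ψ q) (x : ℝ) {t : ℝ} (ht : t ∈ I) :
    frameVel ψ x t = D.nlsVel (hasimoto ψ) x t := h.vel x t ht

theorem nls (h : D.HasimotoFrame I χ ψ q) (hρ : 0 < D.normSqA) (hI : IsOpen I) :
    D.NLS (scaleTime D.normSqA I) q := by
  have hψ := h.parallel.smooth
  have hu := smooth_hasimoto hI hψ
  refine (D.NLS_iff hρ hI h.q_eq).2 ⟨hu, h.parallel.mem, fun x t ht => ?_⟩
  -- With w = N the left side is also R - [u, N], so u_t = R after cancelling [u, N].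
  have h1 := zero_curvature hI hψ x ht
  have h2 : dx (D.nlsVel (hasimoto ψ)) x t = _ :=
    (D.hasDerivAt_nlsVel hI hu h.parallel.mem x ht).deriv
  rw [dx_congr (fun x t ht => h.vel_eq x ht) x ht, h2, h.vel_eq x ht] at h1
  exact (sub_left_injective h1).symm

theorem schrodinger (h : D.HasimotoFrame I χ ψ q) (hI : IsOpen I) : D.SchrodingerMap I χ := by
  refine (h.parallel.schrodinger_iff hI).2 fun x t ht => ?_
  rw [h.vel_eq x ht]
  exact D.A_lie_nlsVel hI (smooth_hasimoto hI h.parallel.smooth) h.parallel.mem x ht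

/-- Normalized parallel frames of a map are unique up to a constant. -/
theorem exists_eq_mul (hI : IsOpen I) (hIc : I.OrdConnected) {ψ' : ℝ → ℝ → G} {q' : ℝ → ℝ → 𝔸}
    (h : D.HasimotoFrame I χ ψ q) (h' : D.HasimotoFrame I χ ψ' q') :
    ∃ k ∈ D.H, ∀ x, ∀ t ∈ I, ψ' x t = ψ x t * k := by
  obtain ⟨k, hkH, hk, hψ'⟩ := h.parallel.exists_gauge hI h'.parallel
  have hψ := h.parallel.smooth
  have hu := smooth_hasimoto hI hψ
  have hk0 : ∀ t ∈ I, HasDerivAt (fun t => ((k t : 𝔸ˣ) : 𝔸)) (((k t : 𝔸ˣ) : 𝔸) * 0) t := by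
    intro t ht
    have h1 := hasDerivAt_curve hI hk ht
    set b := (((k t : 𝔸ˣ)⁻¹ : 𝔸ˣ) : 𝔸) * deriv (fun t => ((k t : 𝔸ˣ) : 𝔸)) t
    have h2 := frameVel_gauge hI hψ ht h1 0
    have h3 : frameVel ψ' 0 t = frameVel (fun x t => ψ x t * k t) 0 t :=
      frameVel_congr hI hψ' 0 ht
    have h5 : ∀ x, hasimoto ψ' x t = Ad ((k t)⁻¹ : G).1 (hasimoto ψ x t) := fun x =>
      (hasimoto_congr hψ' x ht).trans ((h.parallel.gauge hI hkH hk).2 x t ht)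
    have h6 := D.nlsVel_Ad hI hu (D.H.inv_mem (hkH t)) ht h5 0
    -- A gauge transformation turns w into Ad(k)⁻¹w + b with b = k⁻¹k', while normalization of both
    -- frames demands Ad(k)⁻¹w. Hence b = 0.
    rw [← h'.vel_eq 0 ht, ← h.vel_eq 0 ht, h3, h2] at h6
    have hb : b = 0 := left_eq_add.1 h6.symm
    rwa [hb] at h1
  rcases I.eq_empty_or_nonempty with rfl | ⟨t₀, ht₀⟩
  · exact ⟨1, D.H.one_mem, fun x t ht => ht.elim⟩
  · refine ⟨k t₀, hkH t₀, fun x t ht => ?_⟩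
    rw [hψ' x t ht, curve_eq_of_hasDerivAt_zero hI hIc hk0 ht ht₀]

end HasimotoFrame

end HermSymm

end Correspondence

/-! ### Schrödinger maps and NLS solutions: normalization, reconstruction, symmetries. -/

section Correspondence

open Set Filter Topology

variable {𝔸 : Type*} [NormedRing 𝔸] [NormedAlgebra ℝ 𝔸] [FiniteDimensional ℝ 𝔸]
variable {G : Subgroup 𝔸ˣ} {I : Set ℝ}

namespace HermSymm

variable {D : HermSymm G} {χ : ℝ → ℝ → D.M} {ψ : ℝ → ℝ → G} {q : ℝ → ℝ → 𝔸}

theorem ParallelFrame.congr_map (h : D.ParallelFrame I χ ψ) {χ' : ℝ → ℝ → D.M}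
    (hχ : ∀ x, ∀ t ∈ I, χ' x t = χ x t) : D.ParallelFrame I χ' ψ :=
  ⟨h.smooth, fun x t ht => (hχ x t ht).trans (h.lift x t ht), h.mem⟩

/-- Curves in the stabilizer with prescribed velocity. -/
theorem exists_stabilizer_curve (D : HermSymm G) (hG : IsCompact (G : Set 𝔸ˣ)) (hI : IsOpen I)
    (hIc : I.OrdConnected) {a : ℝ → 𝔸} (ha : ContDiffOn ℝ ∞ a I) (hmem : ∀ t ∈ I, a t ∈ D.𝔥) :
    ∃ k : ℝ → G, (∀ t, k t ∈ D.H) ∧ ContDiffOn ℝ ∞ (fun t => ((k t : 𝔸ˣ) : 𝔸)) I ∧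
      ∀ t ∈ I, HasDerivAt (fun t => ((k t : 𝔸ˣ) : 𝔸)) (((k t : 𝔸ˣ) : 𝔸) * a t) t := by
  classical
  rcases I.eq_empty_or_nonempty with rfl | ⟨t₀, ht₀⟩
  · exact ⟨fun _ => 1, fun _ => D.H.one_mem, contDiffOn_const, fun t ht => ht.elim⟩
  obtain ⟨k, hk0, hk, hkd⟩ := exists_curve hG hI hIc ha
    (fun t ht => D.mem_lieAlg_of_mem_h (hmem t ht)) ht₀ 1
  have hkA : ∀ t ∈ I, k t ∈ D.H := by
    intro t ht
    -- The velocity of Ad(k)A is Ad(k)[a, A], zero because a ∈ 𝔥.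
    have h1 : Ad (k t : 𝔸ˣ) D.A = Ad (k t₀ : 𝔸ˣ) D.A :=
      eq_of_hasDerivAt_zero (c := fun t => Ad (k t : 𝔸ˣ) D.A) hI hIc (fun s hs => by
        refine (hasDerivAt_Ad (hkd s hs) (hasDerivAt_const s D.A)).congr_deriv ?_
        rw [add_zero, ← lie_skew, D.A_lie_h (hmem s hs), neg_zero, Ad_zero]) ht ht₀
    rw [hk0] at h1
    exact h1.trans (Ad_one _)
  obtain ⟨K, hKI, hKH⟩ : ∃ K : ℝ → G, (∀ t ∈ I, K t = k t) ∧ ∀ t, K t ∈ D.H := by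
    refine ⟨fun t => if t ∈ I then k t else 1, fun t ht => if_pos ht, fun t => ?_⟩
    dsimp only
    split_ifs with ht
    · exact hkA t ht
    · exact D.H.one_mem
  refine ⟨K, hKH, hk.congr fun t ht => by rw [hKI t ht], fun t ht => ?_⟩
  rw [hKI t ht]
  refine (hkd t ht).congr_of_eventuallyEq ?_
  filter_upwards [hI.mem_nhds ht] with s hs
  rw [hKI s hs]

/-- The parallel frame of a Schrödinger map is normalized by a gauge transformation. -/
theorem ParallelFrame.exists_normalizing_gauge (h : D.ParallelFrame I χ ψ)
    (hG : IsCompact (G : Set 𝔸ˣ)) (hI : IsOpen I) (hIc : I.OrdConnected)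
    (hS : D.SchrodingerMap I χ) :
    ∃ k : ℝ → G, (∀ t, k t ∈ D.H) ∧ ContDiffOn ℝ ∞ (fun t => ((k t : 𝔸ˣ) : 𝔸)) I ∧
      D.HasimotoFrame I χ (fun x t => ψ x t * k t)
        (fun x t => hasimoto (fun x t => ψ x t * k t) x (D.normSqA * t)) := by
  have hψ := h.smooth
  have hu := smooth_hasimoto hI hψ
  have hw := smooth_frameVel hI hψ
  let N := D.nlsVel (hasimoto ψ)
  have hN : Smooth I N := D.smooth_nlsVel hI hu
  let c : ℝ → ℝ → 𝔸 := fun x t => frameVel ψ x t - N x t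
  have hc : Smooth I c := hw.sub hN
  -- The Schrödinger equation fixes only the 𝔪-part of w, so the defect c is in 𝔥.
  have hch : ∀ x, ∀ t ∈ I, c x t ∈ D.𝔥 := by
    intro x t ht
    refine (D.centralizer _ ((lieAlg G).sub_mem (frameVel_mem hI hψ x ht)
      (D.nlsVel_mem hI hu h.mem x ht))).1 ?_
    rw [lie_sub, (h.schrodinger_iff hI).1 hS x t ht, D.A_lie_nlsVel hI hu h.mem x ht, sub_self]
  -- c_x is in 𝔥 with c, and by zero curvature it equals u_t - R - [u, c], which is in 𝔪.
  have hcx : ∀ x, ∀ t ∈ I, HasDerivAt (fun y => c y t) 0 x := by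
    intro x t ht
    have h1 := (hw.hasDerivAt_dx hI x ht).sub (D.hasDerivAt_nlsVel hI hu h.mem x ht)
    have h2 := HasDerivAt.mem_submodule D.𝔥 h1 (Eventually.of_forall fun y => hch y t ht)
    have h3 : dx (frameVel ψ) x t - (D.nlsRhs (hasimoto ψ) x t - ⁅hasimoto ψ x t, N x t⁆) =
        dt (hasimoto ψ) x t - D.nlsRhs (hasimoto ψ) x t - ⁅hasimoto ψ x t, c x t⁆ := by
      simp only [c]
      rw [zero_curvature hI hψ x ht, lie_sub]
      abel
    have h4 : D.nlsRhs (hasimoto ψ) x t ∈ D.𝔪 := by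
      have hm := h.mem x t ht
      refine D.𝔪.add_mem (D.𝔪.neg_mem (D.A_lie_m (D.dx_mem_m hI (hu.dx hI)
        (fun x t ht => D.dx_mem_m hI hu h.mem x ht) x ht))) (D.𝔪.smul_mem _ ?_)
      exact D.lie_mh hm (D.lie_mm _ hm _ (D.A_lie_m hm))
    have h5 : dx (frameVel ψ) x t - (D.nlsRhs (hasimoto ψ) x t - ⁅hasimoto ψ x t, N x t⁆) ∈ D.𝔪 := by
      rw [h3]
      exact D.𝔪.sub_mem (D.𝔪.sub_mem (D.dt_mem_m hI hu h.mem x ht) h4)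
        (D.lie_mh (h.mem x t ht) (hch x t ht))
    exact h1.congr_deriv (D.eq_zero_of_mem_of_mem h5 h2)
  have hc0 : ∀ x, ∀ t ∈ I, c x t = c 0 t := fun x t ht =>
    eq_of_hasDerivAt_zero (c := fun x => c x t) isOpen_univ ordConnected_univ
      (fun y _ => hcx y t ht) (mem_univ x) (mem_univ 0)
  -- With m' = mc and gauge k = m⁻¹ the new t-velocity is Ad(m)(w - c) = Ad(m)N, the normalized
  -- velocity of the new Hasimoto variable.
  obtain ⟨m, hmH, hm, hmd⟩ := D.exists_stabilizer_curve hG hI hIc (hc.contDiffOn_slice 0)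
    fun t ht => hch 0 t ht
  have hkH : ∀ t, (m t)⁻¹ ∈ D.H := fun t => D.H.inv_mem (hmH t)
  have hk := contDiffOn_curve_inv hm
  obtain ⟨hpar, hhas⟩ := h.gauge hI hkH hk
  refine ⟨fun t => (m t)⁻¹, hkH, hk, hpar.hasimotoFrame fun x t ht => ?_⟩
  have h1 : ∀ x, hasimoto (fun x t => ψ x t * (m t)⁻¹) x t = Ad (m t : 𝔸ˣ) (hasimoto ψ x t) :=
    fun x => by
      rw [hhas x t ht, Subgroup.coe_inv, inv_inv]
  rw [frameVel_gauge hI hψ ht (hasDerivAt_inv_curve (hmd t ht)) x, D.nlsVel_Ad hI hu (hmH t) ht h1,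
    Subgroup.coe_inv, inv_inv, ← hc0 x t ht, ← sub_eq_add_neg, ← Ad_sub]
  congr 1
  simp only [c, N]
  abel

/-- Solutions of the NLS flow have a normalized frame. -/
theorem NLS.exists_hasimotoFrame (hG : IsCompact (G : Set 𝔸ˣ)) (hρ : 0 < D.normSqA) (hI : IsOpen I)
    (hIc : I.OrdConnected) (hq : D.NLS (scaleTime D.normSqA I) q) :
    ∃ (χ : ℝ → ℝ → D.M) (ψ : ℝ → ℝ → G), D.HasimotoFrame I χ ψ q := by
  let u : ℝ → ℝ → 𝔸 := fun x t => q x (t / D.normSqA)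
  have hqu : ∀ x, ∀ t ∈ scaleTime D.normSqA I, q x t = u x (D.normSqA * t) := fun x t _ => by
    simp only [u, mul_div_cancel_left₀ _ hρ.ne']
  obtain ⟨hu, hum, hut⟩ := (D.NLS_iff hρ hI hqu).1 hq
  have hN := D.smooth_nlsVel hI hu
  obtain ⟨φ, hφ, hφd⟩ := exists_curve_of_velocity hG hI hIc (hN.contDiffOn_slice 0)
    fun t ht => D.nlsVel_mem hI hu hum 0 ht
  obtain ⟨ψ, hψ, hψ0, hψd⟩ := exists_family hG hI hu
    (fun x t ht => D.mem_lieAlg_of_mem_m (hum x t ht)) hφ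
  have hhas : ∀ x, ∀ t ∈ I, hasimoto ψ x t = u x t := fun x t ht =>
    hasimoto_eq_of_hasDerivAt (hψd x t ht)
  have hvel0 : ∀ t ∈ I, frameVel ψ 0 t = D.nlsVel u 0 t := fun t ht => by
    refine frameVel_eq_of_hasDerivAt ?_
    rw [hψ0 t ht]
    refine (hφd t ht).congr_of_eventuallyEq ?_
    filter_upwards [hI.mem_nhds ht] with s hs
    rw [hψ0 s hs]
  have hvel : ∀ x, ∀ t ∈ I, frameVel ψ x t = D.nlsVel u x t := by
    intro x t ht
    -- The frame was integrated with t-velocity N only along x = 0; the NLS equation propagates w =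
    -- N to all x.
    have h1 := Ad_frameVel_sub_const hI hψ (N := D.nlsVel u) (fun y s hs => by
      rw [dt_congr hI hhas y hs, hhas y s hs, hut y s hs]
      exact D.hasDerivAt_nlsVel hI hu hum y hs) x ht
    rw [hvel0 t ht, sub_self, Ad_zero, ← Ad_zero (ψ x t : 𝔸ˣ), (Ad_injective _).eq_iff] at h1
    exact sub_eq_zero.1 h1
  refine ⟨fun x t => QuotientGroup.mk (ψ x t), ψ, ⟨hψ, fun _ _ _ => rfl, fun x t ht => ?_⟩,
    fun x t ht => ?_, fun x t ht => ?_⟩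
  · rw [hhas x t ht]
    exact hum x t ht
  · rw [hqu x t ht, hhas x _ ht]
  · rw [hvel x t ht, dx_congr hhas x ht, hhas x t ht]
    rfl

theorem NLS_iff_exists (hG : IsCompact (G : Set 𝔸ˣ)) (hρ : 0 < D.normSqA) (hI : IsOpen I)
    (hIc : I.OrdConnected) : D.NLS (scaleTime D.normSqA I) q ↔
      ∃ (χ : ℝ → ℝ → D.M) (ψ : ℝ → ℝ → G),
        D.SmoothMap I χ ∧ D.SchrodingerMap I χ ∧ D.HasimotoFrame I χ ψ q := by
  constructor
  · intro hq
    obtain ⟨χ, ψ, h⟩ := hq.exists_hasimotoFrame hG hρ hI hIc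
    exact ⟨χ, ψ, h.parallel.smoothMap, h.schrodinger hI, h⟩
  · rintro ⟨χ, ψ, -, -, h⟩
    exact h.nls hρ hI

/-- The action of a time-dependent rigid motion on the velocities of a parallel frame. -/
theorem ParallelFrame.smul (h : D.ParallelFrame I χ ψ) (hI : IsOpen I) {g : ℝ → G}
    (hg : ContDiffOn ℝ ∞ (fun t => ((g t : 𝔸ˣ) : 𝔸)) I) :
    D.ParallelFrame I (fun x t => g t • χ x t) (fun x t => g t * ψ x t) ∧
      ∀ x, ∀ t ∈ I, hasimoto (fun x t => g t * ψ x t) x t = hasimoto ψ x t := by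
  have hu : ∀ x, ∀ t ∈ I, hasimoto (fun x t => g t * ψ x t) x t = hasimoto ψ x t := by
    intro x t ht
    have h1 := hasDerivAt_mul_curve (hasDerivAt_const_mul_zero (g t) x)
      (hasDerivAt_frame_x hI h.smooth x ht)
    rw [Ad_zero, zero_add] at h1
    exact hasimoto_eq_of_hasDerivAt (ψ := fun x t => g t * ψ x t) h1
  refine ⟨⟨?_, fun x t ht => ?_, fun x t ht => ?_⟩, hu⟩
  · exact contDiffOn_curve_mul (c := fun q : ℝ × ℝ => g q.2) (k := fun q : ℝ × ℝ => ψ q.1 q.2)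
      (smooth_of_contDiffOn hg) h.smooth
  · rw [h.lift x t ht]
    rfl
  · rw [hu x t ht]
    exact h.mem x t ht

theorem frameVel_smul (hI : IsOpen I) (hψ : Smooth I fun x t => ((ψ x t : 𝔸ˣ) : 𝔸)) {g : ℝ → G}
    {b : 𝔸} {t : ℝ} (ht : t ∈ I)
    (hg : HasDerivAt (fun t => ((g t : 𝔸ˣ) : 𝔸)) (((g t : 𝔸ˣ) : 𝔸) * b) t) (x : ℝ) :
    frameVel (fun x t => g t * ψ x t) x t = Ad (ψ x t : 𝔸ˣ)⁻¹ b + frameVel ψ x t :=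
  frameVel_eq_of_hasDerivAt (ψ := fun x t => g t * ψ x t)
    (hasDerivAt_mul_curve hg (hasDerivAt_frame_t hI hψ x ht))

/-- A parallel frame whose Hasimoto variable solves the NLS flow is normalized by a rigid motion. -/
theorem ParallelFrame.exists_normalizing_motion (h : D.ParallelFrame I χ ψ)
    (hG : IsCompact (G : Set 𝔸ˣ)) (hρ : 0 < D.normSqA) (hI : IsOpen I) (hIc : I.OrdConnected)
    (hqu : ∀ x, ∀ t ∈ scaleTime D.normSqA I, q x t = hasimoto ψ x (D.normSqA * t))
    (hq : D.NLS (scaleTime D.normSqA I) q) :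
    ∃ g : ℝ → G, ContDiffOn ℝ ∞ (fun t => ((g t : 𝔸ˣ) : 𝔸)) I ∧
      D.HasimotoFrame I (fun x t => g t • χ x t) (fun x t => g t * ψ x t) q := by
  have hψ := h.smooth
  obtain ⟨hu, -, hut⟩ := (D.NLS_iff hρ hI hqu).1 hq
  have hN := D.smooth_nlsVel hI hu
  let c : ℝ → ℝ → 𝔸 := fun x t => Ad (ψ x t : 𝔸ˣ) (frameVel ψ x t - D.nlsVel (hasimoto ψ) x t)
  have hc : Smooth I c := Smooth.Ad (c := fun x t => (ψ x t : 𝔸ˣ)) hψ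
    ((smooth_frameVel hI hψ).sub hN)
  have hc0 : ∀ x, ∀ t ∈ I, c x t = c 0 t := fun x t ht =>
    Ad_frameVel_sub_const hI hψ (fun y s hs => by
      rw [hut y s hs]
      exact D.hasDerivAt_nlsVel hI hu h.mem y hs) x ht
  -- For g' = -gc the frame gψ has t-velocity w - Ad(ψ)⁻¹c = N and the same Hasimoto variable. Here
  -- c is merely in 𝔤, so the correction acts on the left and moves the map.
  obtain ⟨g, hg, hgd⟩ := exists_curve_of_velocity hG hI hIc (hc.neg.contDiffOn_slice 0)
    fun t ht => (lieAlg G).neg_mem (Ad_mem (ψ 0 t).2 ((lieAlg G).sub_mem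
      (frameVel_mem hI hψ 0 ht) (D.nlsVel_mem hI hu h.mem 0 ht)))
  obtain ⟨hpar, hhas⟩ := h.smul hI hg
  refine ⟨g, hg, hpar, fun x t ht => ?_, fun x t ht => ?_⟩
  · rw [hqu x t ht, hhas x _ ht]
  · rw [frameVel_smul hI hψ ht (hgd t ht) x, ← hc0 x t ht, Ad_neg, Ad_inv_Ad, dx_congr hhas x ht,
      hhas x t ht, neg_sub, sub_add_cancel]
    rfl

/-- Schrödinger maps up to rigid motions correspond to NLS solutions up to `Ad(H)`. -/
theorem HasimotoFrame.exists_smul_iff (hI : IsOpen I) (hIc : I.OrdConnected) (hρ : 0 < D.normSqA)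
    {χ' : ℝ → ℝ → D.M} {ψ' : ℝ → ℝ → G} {q' : ℝ → ℝ → 𝔸} (h : D.HasimotoFrame I χ ψ q)
    (h' : D.HasimotoFrame I χ' ψ' q') :
    (∃ g : G, ∀ x, ∀ t ∈ I, χ' x t = g • χ x t) ↔
      ∃ k ∈ D.H, ∀ x, ∀ t ∈ scaleTime D.normSqA I, q' x t = Ad (k : 𝔸ˣ) (q x t) := by
  have hψ := h.parallel.smooth
  have hψ' := h'.parallel.smooth
  have hu := smooth_hasimoto hI hψ
  constructor
  · rintro ⟨g, hg⟩
    have hgc : ContDiffOn ℝ ∞ (fun _ : ℝ => ((g : 𝔸ˣ) : 𝔸)) I := contDiffOn_const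
    obtain ⟨hpar, hhas⟩ := h.parallel.smul hI (g := fun _ => g) hgc
    -- gψ and ψ' are two normalized frames of the same map χ', so they differ by a constant in H.
    have h1 : D.HasimotoFrame I χ' (fun x t => g * ψ x t) q := by
      refine ⟨hpar.congr_map hg, fun x t ht => ?_, fun x t ht => ?_⟩
      · rw [h.q_eq x t ht, hhas x _ ht]
      · rw [frameVel_smul (g := fun _ => g) hI hψ ht (hasDerivAt_const_mul_zero g t) x, Ad_zero,
          zero_add, dx_congr hhas x ht, hhas x t ht]
        exact h.vel x t ht
    obtain ⟨k, hk, hkeq⟩ := h1.exists_eq_mul hI hIc h'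
    refine ⟨k⁻¹, D.H.inv_mem hk, fun x t ht => ?_⟩
    rw [h'.q_eq x t ht, h1.q_eq x t ht, hasimoto_congr hkeq x ht]
    exact (h1.parallel.gauge hI (k := fun _ => k) (fun _ => hk) contDiffOn_const).2 x _ ht
  · rintro ⟨k, hk, hkq⟩
    have hku : ∀ x, ∀ t ∈ I, hasimoto ψ' x t = Ad (k : 𝔸ˣ) (hasimoto ψ x t) := by
      intro x t ht
      have hs : t / D.normSqA ∈ scaleTime D.normSqA I := (scaleTime_mem_iff hρ.ne').2 ht
      have h1 := hkq x _ hs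
      rwa [h.q_eq x _ hs, h'.q_eq x _ hs, mul_div_cancel₀ _ hρ.ne'] at h1
    have hkw : ∀ x, ∀ t ∈ I, frameVel ψ' x t = Ad (k : 𝔸ˣ) (frameVel ψ x t) := by
      intro x t ht
      rw [h.vel_eq x ht, h'.vel_eq x ht]
      exact D.nlsVel_Ad hI hu hk ht (fun x => hku x t ht) x
    -- ψ' and ψk⁻¹ have equal velocities in x and in t, so ψ'(ψk⁻¹)⁻¹ is constant; this constant is
    -- the required motion g.
    have key : ∀ a b : 𝔸, b = Ad (k : 𝔸ˣ) a → ∀ (c c' : ℝ → G) (s : ℝ),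
        HasDerivAt (fun s => ((c s : 𝔸ˣ) : 𝔸)) (((c s : 𝔸ˣ) : 𝔸) * a) s →
        HasDerivAt (fun s => ((c' s : 𝔸ˣ) : 𝔸)) (((c' s : 𝔸ˣ) : 𝔸) * b) s →
        HasDerivAt (fun s => (((c' s * (c s * k⁻¹)⁻¹ : G) : 𝔸ˣ) : 𝔸))
          ((((c' s * (c s * k⁻¹)⁻¹ : G) : 𝔸ˣ) : 𝔸) * 0) s := by
      intro a b hb c c' s hc hc'
      have h1 := hasDerivAt_mul_curve hc (hasDerivAt_const_mul_zero k⁻¹ s)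
      have h2 := hasDerivAt_mul_curve hc' (hasDerivAt_inv_curve h1)
      refine h2.congr_deriv ?_
      congr 1
      have h3 : Ad (((k⁻¹ : G) : 𝔸ˣ))⁻¹ a = b := by rw [hb, Subgroup.coe_inv, inv_inv]
      rw [add_zero, h3, Subgroup.coe_inv, inv_inv, add_neg_cancel]
    have hx : ∀ x, ∀ t ∈ I, ψ' x t * (ψ x t * k⁻¹)⁻¹ = ψ' 0 t * (ψ 0 t * k⁻¹)⁻¹ := fun x t ht =>
      curve_eq_of_hasDerivAt_zero (k := fun x => ψ' x t * (ψ x t * k⁻¹)⁻¹) isOpen_univ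
        ordConnected_univ (fun y _ => key _ _ (hku y t ht) _ _ y (hasDerivAt_frame_x hI hψ y ht)
          (hasDerivAt_frame_x hI hψ' y ht)) (mem_univ x) (mem_univ 0)
    rcases I.eq_empty_or_nonempty with rfl | ⟨t₀, ht₀⟩
    · exact ⟨1, fun x t ht => ht.elim⟩
    refine ⟨ψ' 0 t₀ * (ψ 0 t₀ * k⁻¹)⁻¹, fun x t ht => ?_⟩
    have ht' : ψ' 0 t * (ψ 0 t * k⁻¹)⁻¹ = ψ' 0 t₀ * (ψ 0 t₀ * k⁻¹)⁻¹ :=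
      curve_eq_of_hasDerivAt_zero (k := fun t => ψ' 0 t * (ψ 0 t * k⁻¹)⁻¹) hI hIc
        (fun s hs => key _ _ (hkw 0 s hs) _ _ s (hasDerivAt_frame_t hI hψ 0 hs)
          (hasDerivAt_frame_t hI hψ' 0 hs)) ht ht₀
    rw [← ht', ← hx x t ht, h.parallel.lift x t ht, h'.parallel.lift x t ht]
    refine QuotientGroup.eq.2 ?_
    have h1 : (ψ' x t)⁻¹ * (ψ' x t * (ψ x t * k⁻¹)⁻¹ * ψ x t) = k := by group
    change (ψ' x t)⁻¹ * (ψ' x t * (ψ x t * k⁻¹)⁻¹ * ψ x t) ∈ D.H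
    rwa [h1]

theorem NLS.Ad (hI : IsOpen I) (hq : D.NLS I q) {k : G} (hk : k ∈ D.H) :
    D.NLS I fun x t => HermitianNLS.Ad (k : 𝔸ˣ) (q x t) := by
  have hdx : ∀ x, ∀ t ∈ I, dx (fun x t => HermitianNLS.Ad (k : 𝔸ˣ) (q x t)) x t =
      HermitianNLS.Ad (k : 𝔸ˣ) (dx q x t) := fun x t ht =>
    (hasDerivAt_Ad_const (hq.smooth.hasDerivAt_dx hI x ht) (k : 𝔸ˣ)).deriv
  refine ⟨Smooth.Ad (c := fun _ _ => (k : 𝔸ˣ)) contDiffOn_const hq.smooth,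
    fun x t ht => D.Ad_mem_m hk (hq.mem x t ht), fun x t ht => ?_⟩
  have h1 : dt (fun x t => HermitianNLS.Ad (k : 𝔸ˣ) (q x t)) x t =
      HermitianNLS.Ad (k : 𝔸ˣ) (dt q x t) :=
    (hasDerivAt_Ad_const (hq.smooth.hasDerivAt_dt hI x ht) (k : 𝔸ˣ)).deriv
  have h2 : dx (dx fun x t => HermitianNLS.Ad (k : 𝔸ˣ) (q x t)) x t =
      HermitianNLS.Ad (k : 𝔸ˣ) (dx (dx q) x t) :=
    (dx_congr hdx x ht).trans
      (hasDerivAt_Ad_const ((hq.smooth.dx hI).hasDerivAt_dx hI x ht) (k : 𝔸ˣ)).deriv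
  rw [h1, h2, ← Ad_smul, hq.eqn x t ht]
  simp only [Ad_add, Ad_neg, Ad_smul, Ad_lie, D.Ad_A hk]

/-- Periodic maps are those with quasi-periodic normalized frames. -/
theorem HasimotoFrame.periodic_iff (hI : IsOpen I) (hIc : I.OrdConnected)
    (h : D.HasimotoFrame I χ ψ q) (L : ℝ) :
    (∀ x, ∀ t ∈ I, χ (x + L) t = χ x t) ↔
      ∃ k ∈ D.H, ∀ x, ∀ t ∈ I, ψ (x + L) t = ψ x t * k := by
  have hψ := h.parallel.smooth
  constructor
  · intro hper
    have hhas : ∀ x t, hasimoto (fun x t => ψ (x + L) t) x t = hasimoto ψ (x + L) t := by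
      intro x t
      have h1 : dx (fun x t => ((ψ (x + L) t : 𝔸ˣ) : 𝔸)) x t =
          dx (fun x t => ((ψ x t : 𝔸ˣ) : 𝔸)) (x + L) t :=
        deriv_comp_add_const (fun x => ((ψ x t : 𝔸ˣ) : 𝔸)) L x
      rw [hasimoto, hasimoto, h1]
    -- For periodic χ the translated frame is again a normalized frame of χ, and uniqueness up to a
    -- constant applies.
    have hpar : D.ParallelFrame I χ (fun x t => ψ (x + L) t) := by
      refine ⟨hψ.translate L, fun x t ht => ?_, fun x t ht => ?_⟩
      · rw [← hper x t ht, h.parallel.lift _ t ht]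
      · rw [hhas]
        exact h.parallel.mem _ t ht
    refine h.exists_eq_mul hI hIc (hpar.hasimotoFrame fun x t ht => ?_)
    have h1 : dx (hasimoto fun x t => ψ (x + L) t) x t = dx (hasimoto ψ) (x + L) t := by
      refine Eq.trans ?_ (deriv_comp_add_const (fun x => hasimoto ψ x t) L x)
      simp only [dx, hhas]
    rw [nlsVel, hhas, h1]
    exact h.vel (x + L) t ht
  · rintro ⟨k, hk, hkψ⟩ x t ht
    rw [h.parallel.lift _ t ht, h.parallel.lift _ t ht, hkψ x t ht]
    exact (QuotientGroup.eq.2 (by rwa [inv_mul_cancel_left])).symm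

end HermSymm

end Correspondence

/-! ### Spin vectors and the two Heisenberg models. -/

section Spin

open Set Filter Topology

variable {𝔸 : Type*} [NormedRing 𝔸] [NormedAlgebra ℝ 𝔸] [FiniteDimensional ℝ 𝔸]
variable {G : Subgroup 𝔸ˣ} {I : Set ℝ}

namespace HermSymm

variable {D : HermSymm G} {χ : ℝ → ℝ → D.M} {T : ℝ → ℝ → Aff G} {q : ℝ → ℝ → 𝔸}

theorem normSq_eq_one (hρ : 0 < D.normSqA) {v : Aff G} {g : G}
    (h : v.vec = (√D.normSqA)⁻¹ • Ad (g : 𝔸ˣ) D.A) : v.normSq = 1 := by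
  have h1 : Aff.equiv G v = (√D.normSqA)⁻¹ •
      (⟨Ad (g : 𝔸ˣ) D.A, Ad_mem g.2 D.A_mem_lieAlg⟩ : lieAlg G) := Subtype.ext h
  have h2 : -killingForm ℝ (lieAlg G) ⟨D.A, D.A_mem_lieAlg⟩ ⟨D.A, D.A_mem_lieAlg⟩ = D.normSqA := rfl
  rw [Aff.normSq, h1, map_smul, map_smul, LinearMap.smul_apply, killingForm_Ad g D.A_mem_lieAlg,
    smul_eq_mul, smul_eq_mul, ← mul_assoc, ← mul_neg, h2, ← mul_inv, Real.mul_self_sqrt hρ.le,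
    inv_mul_cancel₀ hρ.ne']

theorem Corresponds.spinVector {c : ℝ} (hρ : 0 < D.normSqA) (hχ : D.SmoothMap I χ)
    (h : D.Corresponds c I χ T) : D.SpinVector (scaleTime c I) T := by
  have h1 : ∀ x, ∀ t ∈ scaleTime c I, ∃ g : G, (T x t).vec = (√D.normSqA)⁻¹ • Ad (g : 𝔸ˣ) D.A := by
    intro x t ht
    obtain ⟨g, -, hg⟩ := D.exists_emb_eq (χ x (c * t))
    exact ⟨g, by rw [h x t ht, hg]⟩
  refine ⟨?_, fun x t ht => ?_, fun x t ht => ?_⟩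
  · exact ((Smooth.scaleTime hχ c).const_smul (√D.normSqA)⁻¹).congr h
  · obtain ⟨g, hg⟩ := h1 x t ht
    exact normSq_eq_one hρ hg
  · obtain ⟨g, hg⟩ := h1 x t ht
    exact ⟨g, g.2, hg⟩

theorem exists_corresponds (c : ℝ) (I : Set ℝ) (χ : ℝ → ℝ → D.M) : ∃ T, D.Corresponds c I χ T := by
  refine ⟨fun x t => (Aff.equiv G).symm ⟨(√D.normSqA)⁻¹ • D.emb (χ x (c * t)),
    (lieAlg G).smul_mem _ (D.emb_mem _)⟩, fun x t _ => ?_⟩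
  rw [Aff.vec, Equiv.apply_symm_apply]

theorem SpinVector.exists_corresponds {c : ℝ} (hc : 0 < c) (hρ : 0 < D.normSqA)
    (hT : D.SpinVector (scaleTime c I) T) : ∃ χ, D.SmoothMap I χ ∧ D.Corresponds c I χ T := by
  have hmem : ∀ t ∈ I, t / c ∈ scaleTime c I := fun t ht => (scaleTime_mem_iff hc.ne').2 ht
  have hsqrt : √D.normSqA ≠ 0 := (Real.sqrt_pos.2 hρ).ne'
  -- The group elements are chosen pointwise with no regularity: smoothness of a map into M is that
  -- of its embedding, which is a multiple of T.
  have h1 : ∀ x t, ∃ g : G, t ∈ I →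
      (T x (t / c)).vec = (√D.normSqA)⁻¹ • HermitianNLS.Ad (g : 𝔸ˣ) D.A := by
    intro x t
    by_cases ht : t ∈ I
    · obtain ⟨g, hg, h⟩ := hT.type x _ (hmem t ht)
      exact ⟨⟨g, hg⟩, fun _ => h⟩
    · exact ⟨1, fun h => (ht h).elim⟩
  choose g hg using h1
  refine ⟨fun x t => QuotientGroup.mk (g x t), ?_, fun x t ht => ?_⟩
  · have h2 := (hT.smooth.scaleTime c⁻¹).const_smul √D.normSqA
    have h3 : scaleTime c⁻¹ (scaleTime c I) = I := by
      ext t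
      simp [scaleTime, mul_inv_cancel_left₀ hc.ne']
    rw [h3] at h2
    refine h2.congr fun x t ht => ?_
    rw [D.emb_mk, inv_mul_eq_div, hg x t ht, smul_inv_smul₀ hsqrt]
  · have h2 := hg x (c * t) ht
    rwa [mul_div_cancel_left₀ _ hc.ne'] at h2

theorem dx_emb_mem (hI : IsOpen I) (hχ : D.SmoothMap I χ) (x : ℝ) {t : ℝ} (ht : t ∈ I) :
    dx (fun x t => D.emb (χ x t)) x t ∈ lieAlg G :=
  HasDerivAt.mem_submodule (lieAlg G).toSubmodule (Smooth.hasDerivAt_dx hχ hI x ht)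
    (Eventually.of_forall fun _ => D.emb_mem _)

theorem dx_dx_emb_mem (hI : IsOpen I) (hχ : D.SmoothMap I χ) (x : ℝ) {t : ℝ} (ht : t ∈ I) :
    dx (dx fun x t => D.emb (χ x t)) x t ∈ lieAlg G :=
  HasDerivAt.mem_submodule (lieAlg G).toSubmodule
    (Smooth.hasDerivAt_dx (Smooth.dx hχ hI) hI x ht)
    (Eventually.of_forall fun y => dx_emb_mem hI hχ y ht)

/-- The Schrödinger map equation in terms of the embedding. -/
theorem schrodinger_iff_lie (hI : IsOpen I) (hχ : D.SmoothMap I χ) :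
    D.SchrodingerMap I χ ↔ ∀ x, ∀ t ∈ I, dt (fun x t => D.emb (χ x t)) x t =
      -⁅D.emb (χ x t), dx (dx fun x t => D.emb (χ x t)) x t⁆ := by
  refine forall_congr' fun x => forall_congr' fun t => forall_congr' fun ht => ?_
  -- J(-J²) = J on 𝔤: applying J already discards the normal part of χ_xx.
  have h := D.Jmap_cube (χ x t) (dx_dx_emb_mem hI hχ x ht)
  have h1 : -D.Jmap (χ x t) (D.covDx χ (dx fun x t => D.emb (χ x t)) x t) =
      -⁅D.emb (χ x t), dx (dx fun x t => D.emb (χ x t)) x t⁆ := by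
    refine Eq.trans ?_ h
    simp only [covDx, tangentProj, Jmap, lie_neg, neg_neg]
  rw [h1]

theorem forall_scaleTime {c : ℝ} (hc : c ≠ 0) {P : ℝ → ℝ → Prop} :
    (∀ x, ∀ t ∈ scaleTime c I, P x (c * t)) ↔ ∀ x, ∀ t ∈ I, P x t := by
  refine ⟨fun h x t ht => ?_, fun h x t ht => h x _ ht⟩
  have := h x (t / c) ((scaleTime_mem_iff hc).2 ht)
  rwa [mul_div_cancel₀ _ hc] at this

theorem Corresponds.derivs {c : ℝ} (hI : IsOpen I) (hχ : D.SmoothMap I χ)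
    (h : D.Corresponds c I χ T) (x : ℝ) {t : ℝ} (ht : t ∈ scaleTime c I) :
    dt (fun x t => (T x t).vec) x t =
        (√D.normSqA)⁻¹ • c • dt (fun x t => D.emb (χ x t)) x (c * t) ∧
      dx (dx fun x t => (T x t).vec) x t =
        (√D.normSqA)⁻¹ • dx (dx fun x t => D.emb (χ x t)) x (c * t) := by
  have hχ' : Smooth I fun x t => D.emb (χ x t) := hχ
  have hdx : ∀ x, ∀ t ∈ scaleTime c I, dx (fun x t => (T x t).vec) x t =
      (√D.normSqA)⁻¹ • dx (fun x t => D.emb (χ x t)) x (c * t) := fun x t ht =>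
    (dx_congr h x ht).trans ((hχ'.hasDerivAt_dx hI x ht).const_smul (√D.normSqA)⁻¹).deriv
  refine ⟨?_, (dx_congr hdx x ht).trans
    (((hχ'.dx hI).hasDerivAt_dx hI x ht).const_smul (√D.normSqA)⁻¹).deriv⟩
  refine (dt_congr (isOpen_scaleTime hI c) h x ht).trans ?_
  rw [← dt_comp_mul]
  exact (((hχ'.scaleTime c).hasDerivAt_dt (isOpen_scaleTime hI c) x ht).const_smul
    (√D.normSqA)⁻¹).deriv

/-- On tangent vectors ad(X)⁻¹ = -ad(X). Scaling X and Y by the same r cancels, since ad(rX)⁻¹(rY) =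
ad(X)⁻¹Y. -/
theorem isAdInv_iff {r : ℝ} (hr : r ≠ 0) {X Y Z : 𝔸} (hX : X ∈ lieAlg G) (hZ : Z ∈ lieAlg G)
    (hsq : ⁅X, ⁅X, Z⁆⁆ = -Z) : IsAdInv G (r • X) (r • Y) Z ↔ Z = -⁅X, Y⁆ := by
  have h1 : ⁅r • X, r • Y - ⁅r • X, Z⁆⁆ = (r * r) • (Z + ⁅X, Y⁆) := by
    simp only [lie_sub, smul_lie, lie_smul, hsq, smul_smul, smul_neg, smul_add, sub_neg_eq_add]
    abel
  rw [IsAdInv, h1, smul_eq_zero, or_iff_right (mul_ne_zero hr hr), ← eq_neg_iff_add_eq_zero]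
  refine ⟨fun h => h.2, fun h => ⟨⟨-(r⁻¹ • ⁅X, Z⁆), ?_, ?_⟩, h⟩⟩
  · exact (lieAlg G).neg_mem ((lieAlg G).smul_mem _ ((lieAlg G).lie_mem hX hZ))
  · rw [lie_neg, smul_lie, lie_smul, smul_inv_smul₀ hr, hsq, neg_neg]

/-- ad(T)⁻¹T_xx is free of ρ, so time must run at speed ρ to make T_t = ρ⁻¹·ρ·χ_t free of it too. -/
theorem schrodinger_iff_heisenberg (hss : LieAlgebra.IsSemisimple ℝ (lieAlg G))
    (hρ : 0 < D.normSqA) (hI : IsOpen I) (hχ : D.SmoothMap I χ)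
    (h : D.Corresponds √D.normSqA I χ T) :
    D.SchrodingerMap I χ ↔ Heisenberg (scaleTime √D.normSqA I) T := by
  have hsqrt : √D.normSqA ≠ 0 := (Real.sqrt_pos.2 hρ).ne'
  rw [schrodinger_iff_lie hI hχ, ← forall_scaleTime hsqrt]
  refine forall_congr' fun x => forall_congr' fun t => forall_congr' fun ht => ?_
  obtain ⟨h1, h2⟩ := h.derivs hI hχ x ht
  have h3 := Smooth.hasDerivAt_dt hχ hI x ht
  rw [h x t ht, h1, h2, inv_smul_smul₀ hsqrt]
  refine (isAdInv_iff (inv_ne_zero hsqrt) (D.emb_mem _) ?_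
    (D.orbit_deriv_sq hss (p := fun s => χ x s) h3)).symm
  exact HasDerivAt.mem_submodule (lieAlg G).toSubmodule h3
    (Eventually.of_forall fun _ => D.emb_mem _)

/-- -[T, T_xx] carries ρ⁻², one factor from T and one from T_xx; T_t matches it at speed ρ⁻¹. -/
theorem schrodinger_iff_heisenberg' (hρ : 0 < D.normSqA) (hI : IsOpen I) (hχ : D.SmoothMap I χ)
    (h : D.Corresponds (√D.normSqA)⁻¹ I χ T) :
    D.SchrodingerMap I χ ↔ Heisenberg' (scaleTime (√D.normSqA)⁻¹ I) T := by
  have hsqrt : (√D.normSqA)⁻¹ ≠ 0 := inv_ne_zero (Real.sqrt_pos.2 hρ).ne'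
  rw [schrodinger_iff_lie hI hχ, ← forall_scaleTime hsqrt]
  refine forall_congr' fun x => forall_congr' fun t => forall_congr' fun ht => ?_
  obtain ⟨h1, h2⟩ := h.derivs hI hχ x ht
  rw [h x t ht, h1, h2, smul_lie, lie_smul, ← smul_neg, ← smul_neg, smul_right_inj hsqrt,
    smul_right_inj hsqrt]

theorem NLS_iff_exists_heisenberg (hG : IsCompact (G : Set 𝔸ˣ))
    (hss : LieAlgebra.IsSemisimple ℝ (lieAlg G)) (hρ : 0 < D.normSqA) (hI : IsOpen I)
    (hIc : I.OrdConnected) : D.NLS (scaleTime D.normSqA I) q ↔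
      ∃ (T : ℝ → ℝ → Aff G) (χ : ℝ → ℝ → D.M) (ψ : ℝ → ℝ → G),
        D.SpinVector (scaleTime √D.normSqA I) T ∧ Heisenberg (scaleTime √D.normSqA I) T ∧
        D.HasimotoFrame I χ ψ q ∧ D.Corresponds √D.normSqA I χ T := by
  constructor
  · intro hq
    obtain ⟨χ, ψ, hχ, hS, h⟩ := (NLS_iff_exists hG hρ hI hIc).1 hq
    obtain ⟨T, hT⟩ := exists_corresponds √D.normSqA I χ
    exact ⟨T, χ, ψ, hT.spinVector hρ hχ, (schrodinger_iff_heisenberg hss hρ hI hχ hT).1 hS, h, hT⟩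
  · rintro ⟨T, χ, ψ, -, -, h, -⟩
    exact h.nls hρ hI

end HermSymm

end Spin

end HermitianNLS

end

/-! ### The main theorem, assembled from the correspondences. -/

theorem mainTheorem9 {𝔸 : Type*} [NormedRing 𝔸] [NormedAlgebra ℝ 𝔸] [FiniteDimensional ℝ 𝔸]
    (G : Subgroup 𝔸ˣ) (hcompact : IsCompact (G : Set 𝔸ˣ))
    (hss : LieAlgebra.IsSemisimple ℝ (lieAlg G))
    (D : HermSymm G) (hm : D.𝔪 ≠ ⊥)
    (I : Set ℝ) (hI : IsOpen I) (hIc : I.OrdConnected) :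
    -- every map has parallel frames, unique up to a time-dependent gauge transformation in `H`
    (∀ χ : ℝ → ℝ → D.M, D.SmoothMap I χ →
      (∃ ψ, D.ParallelFrame I χ ψ) ∧
      ∀ ψ ψ', D.ParallelFrame I χ ψ → D.ParallelFrame I χ ψ' →
        ∃ k : ℝ → G, (∀ t, k t ∈ D.H) ∧ ContDiffOn ℝ ∞ (fun t => ((k t : 𝔸ˣ) : 𝔸)) I ∧
          ∀ x, ∀ t ∈ I, ψ' x t = ψ x t * k t) ∧
    -- a map with parallel frame `ψ` solves the Schrödinger map equation if and only if, after such
    -- a gauge transformation, the Hasimoto variable undergoes the NLS flow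
    (∀ (χ : ℝ → ℝ → D.M) (ψ : ℝ → ℝ → G), D.SmoothMap I χ → D.ParallelFrame I χ ψ →
      (D.SchrodingerMap I χ ↔
        ∃ k : ℝ → G, (∀ t, k t ∈ D.H) ∧ ContDiffOn ℝ ∞ (fun t => ((k t : 𝔸ˣ) : 𝔸)) I ∧
          ∃ q, D.HasimotoFrame I χ (fun x t => ψ x t * k t) q ∧
            D.NLS (scaleTime D.normSqA I) q)) ∧
    -- the solutions of the NLS flow are exactly the Hasimoto variables of Schrödinger maps
    (∀ q : ℝ → ℝ → 𝔸, D.NLS (scaleTime D.normSqA I) q ↔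
      ∃ (χ : ℝ → ℝ → D.M) (ψ : ℝ → ℝ → G),
        D.SmoothMap I χ ∧ D.SchrodingerMap I χ ∧ D.HasimotoFrame I χ ψ q) ∧
    -- a parallel frame whose Hasimoto variable solves the NLS flow belongs to a Schrödinger map up
    -- to a time-dependent rigid motion
    (∀ (χ : ℝ → ℝ → D.M) (ψ : ℝ → ℝ → G) (q : ℝ → ℝ → 𝔸),
      D.SmoothMap I χ → D.ParallelFrame I χ ψ →
      (∀ x, ∀ t ∈ scaleTime D.normSqA I, q x t = hasimoto ψ x (D.normSqA * t)) →
      D.NLS (scaleTime D.normSqA I) q →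
        ∃ g : ℝ → G, ContDiffOn ℝ ∞ (fun t => ((g t : 𝔸ˣ) : 𝔸)) I ∧
          D.SchrodingerMap I (fun x t => g t • χ x t)) ∧
    -- Schrödinger maps modulo `G` correspond one to one to NLS solutions modulo `Ad(H)`
    (∀ (χ χ' : ℝ → ℝ → D.M) (ψ ψ' : ℝ → ℝ → G) (q q' : ℝ → ℝ → 𝔸),
      D.HasimotoFrame I χ ψ q → D.HasimotoFrame I χ' ψ' q' →
      ((∃ g : G, ∀ x, ∀ t ∈ I, χ' x t = g • χ x t) ↔
        ∃ k ∈ D.H, ∀ x, ∀ t ∈ scaleTime D.normSqA I, q' x t = Ad (k : 𝔸ˣ) (q x t))) ∧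
    -- the NLS flow is `H`-invariant
    (∀ q : ℝ → ℝ → 𝔸, D.NLS (scaleTime D.normSqA I) q → ∀ k ∈ D.H,
      D.NLS (scaleTime D.normSqA I) (fun x t => Ad (k : 𝔸ˣ) (q x t))) ∧
    -- maps of a circle of length `L`
    (∀ (χ : ℝ → ℝ → D.M) (ψ : ℝ → ℝ → G) (q : ℝ → ℝ → 𝔸) (L : ℝ),
      D.HasimotoFrame I χ ψ q →
      ((∀ x, ∀ t ∈ I, χ (x + L) t = χ x t) ↔
        ∃ k ∈ D.H, ∀ x, ∀ t ∈ I, ψ (x + L) t = ψ x t * k)) ∧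
    -- smooth maps into `M` are the same as spin vectors, in any time scale
    (∀ c : ℝ, 0 < c →
      (∀ χ : ℝ → ℝ → D.M, D.SmoothMap I χ →
        ∃ T, D.SpinVector (scaleTime c I) T ∧ D.Corresponds c I χ T) ∧
      (∀ T : ℝ → ℝ → Aff G, D.SpinVector (scaleTime c I) T →
        ∃ χ, D.SmoothMap I χ ∧ D.Corresponds c I χ T)) ∧
    -- the Schrödinger map equation is the Heisenberg spin model, in either normalization
    (∀ (χ : ℝ → ℝ → D.M) (T : ℝ → ℝ → Aff G), D.SmoothMap I χ →
      (D.Corresponds √D.normSqA I χ T →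
        (D.SchrodingerMap I χ ↔ Heisenberg (scaleTime √D.normSqA I) T)) ∧
      (D.Corresponds (√D.normSqA)⁻¹ I χ T →
        (D.SchrodingerMap I χ ↔ Heisenberg' (scaleTime (√D.normSqA)⁻¹ I) T))) ∧
    -- the NLS flow on `q` is the Heisenberg spin model for the vector `T = ‖A‖⁻¹ Ad(ψ) A`
    (∀ q : ℝ → ℝ → 𝔸, D.NLS (scaleTime D.normSqA I) q ↔
      ∃ (T : ℝ → ℝ → Aff G) (χ : ℝ → ℝ → D.M) (ψ : ℝ → ℝ → G),
        D.SpinVector (scaleTime √D.normSqA I) T ∧ Heisenberg (scaleTime √D.normSqA I) T ∧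
        D.HasimotoFrame I χ ψ q ∧ D.Corresponds √D.normSqA I χ T) := by
  have hρ : 0 < D.normSqA := D.normSqA_pos hm
  refine ⟨fun χ hχ => ⟨D.exists_parallelFrame hcompact hss hI hIc hχ,
    fun ψ ψ' h h' => h.exists_gauge hI h'⟩, fun χ ψ hχ h => ⟨fun hS => ?_, ?_⟩,
    fun q => HermSymm.NLS_iff_exists hcompact hρ hI hIc, fun χ ψ q hχ h hqu hq => ?_,
    fun χ χ' ψ ψ' q q' h h' => h.exists_smul_iff hI hIc hρ h',
    fun q hq k hk => hq.Ad (isOpen_scaleTime hI _) hk,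
    fun χ ψ q L h => h.periodic_iff hI hIc L, fun c hc => ⟨fun χ hχ => ?_, fun T hT =>
      hT.exists_corresponds hc hρ⟩, fun χ T hχ =>
      ⟨HermSymm.schrodinger_iff_heisenberg hss hρ hI hχ,
        HermSymm.schrodinger_iff_heisenberg' hρ hI hχ⟩,
    fun q => HermSymm.NLS_iff_exists_heisenberg hcompact hss hρ hI hIc⟩
  · obtain ⟨k, hkH, hk, hf⟩ := h.exists_normalizing_gauge hcompact hI hIc hS
    exact ⟨k, hkH, hk, _, hf, hf.nls hρ hI⟩
  · rintro ⟨k, -, -, q, hf, -⟩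
    exact hf.schrodinger hI
  · obtain ⟨g, hg, hf⟩ := h.exists_normalizing_motion hcompact hρ hI hIc hqu hq
    exact ⟨g, hg, hf.schrodinger hI⟩
  · obtain ⟨T, hT⟩ := HermSymm.exists_corresponds c I χ
    exact ⟨T, hT.spinVector hρ hχ, hT⟩
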